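/- Write $\langle f\rangle_A=\frac1{\mu(A)}\int_A f\,d\mu$ for the integral mean. Let $(X,d,\mu)$ be a metric space with a $\sigma$-finite Borel regular measure for which every ball has positive and finite measure, and let $\Omega\subset X$ be a bounded domain (nonempty, open, connected). Assume that $\mu|_\Omega$ is doubling, i.e. there is $c$ with $0<\mu(B(x,2r)\cap\Omega)\le c\,\mu(B(x,r)\cap\Omega)<\infty$ for all $x\in\overline\Omega$, $r>0$, and that the metric measure space $(\Omega,d,\mu)$ admits a $\theta$-Poincaré inequality for some $\theta\ge1$. Here a metric measure space admits a $q$-Poincaré inequality if there are $C>0$, $\lambda\ge1$ with $$\bigl\langle |u-\langle u\rangle_B|\bigr\rangle_B\le C\,\mathrm{rad}(B)\,\bigl\langle g^q\bigr\rangle_{\lambda B}^{1/q}$$ for every ball $B$, every locally integrable $u$ and every a.e. finite upper gradient $g$ of $u$; an upper gradient of $u$ is a Borel function $g\ge0$ with $|u(\gamma(b))-u(\gamma(a))|\le\int_\gamma g\,ds$ for every rectifiable curve $\gamma:[a,b]\to\Omega$. Assume that $\partial\Omega$ is endowed with a $\sigma$-finite Borel regular measure $\mathcal H$ that is Ahlfors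 codimension-$\theta$ regular: $\mathcal H(B(z,r)\cap\partial\Omega)\ge c\,\mu(B(z,r)\cap\Omega)/r^\theta$ for $z\in\partial\Omega$, $0<r<2\operatorname{diam}\partial\Omega$, and $\mathcal H(B(z,r)\cap\partial\Omega)\le C\,\mu(B(z,r)\cap\Omega)/r^\theta$ for $z\in\partial\Omega$, $0<r<2\operatorname{diam}\Omega$, with constants $0<c,C<\infty$. For $a\in\mathbb R$ write $L(x)^a=\bigl(\log\frac{2\operatorname{diam}\Omega}{\operatorname{dist}(x,\partial\Omega)}\bigr)^{a}$, and for $\varepsilon>0$ let $w_\varepsilon=L^{\theta+\varepsilon}$. For a measure $\nu$ on $\Omega$, $N^{1,\theta}(\Omega,\nu)$ is the space of functions with finite norm $\|u\|_{N^{1,\theta}}^\theta=\|u\|_{L^\theta(\nu)}^\theta+\inf_g\|g\|_{L^\theta(\nu)}^\theta$, the infimum being over the upper gradients $g$ of $u$ in $\Omega$. A function $f$ on $\partial\Omega$ is called the trace of $u$ if $$\lim_{r\to0^+}\bigl\langle|u-f(z)|\bigr\rangle_{B(z,r)\cap\Omega}=0\qquad\text{for }\mathcal H\text{-a.e. }z\in\partial\Omega.\tag{1}$$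 (i) For every $\varepsilon>0$ there is a bounded linear operator $T:N^{1,\theta}(\Omega,w_\varepsilon\,d\mu)\to L^\theta(\partial\Omega,d\mathcal H)$ such that $Tu$ is the trace of $u$ in the sense of (1). (ii) There is a (in general non-linear) operator $E:L^\theta(\partial\Omega,d\mathcal H)\to N^{1,\theta}(\Omega,d\mu)$ that is bounded, $\|Ef\|_{N^{1,\theta}(\Omega,d\mu)}\le C\|f\|_{L^\theta(\partial\Omega)}$, and is a right inverse of the trace: $f$ is the trace of $Ef$ in the sense of (1), for every $f\in L^\theta(\partial\Omega,d\mathcal H)$. (iii) The weight is essentially sharp. Let $0<\varepsilon<1$ and $\theta\ge2/\varepsilon$, let $\Omega$ be the open unit disk in $X=\mathbb R^2$, let $d\mu=(\operatorname{dist}(x,X\setminus\Omega)^{\theta-1}+\chi_{X\setminus\Omega})\,dx$, and let $\mathcal H$ be the length measure on $\partial\Omega$. Then balls in $X$ have positive finite measure, $\Omega$ is a uniform domain, $\mu|_\Omega$ is doubling, $\Omega$ admits a $1$-Poincaré inequality, and $\mathcal H$ is Ahlfors codimension-$\theta$ regular. If the admissible weight $w_{\theta\varepsilon/4}=L^{\theta+\theta\varepsilon/4}$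 of (i) is replaced by $\tilde w=w_{\theta\varepsilon/4}^{\,1-\varepsilon}=L^{(1-\varepsilon)(\theta+\theta\varepsilon/4)}$, then the trace may fail to exist: there are $u\in L^\theta(\Omega,d\mu)\cap N^{1,\theta}(\Omega,\tilde w\,d\mu)$ and a Hajłasz gradient $g\in L^\theta(\Omega,d\mu)\cap L^\theta(\Omega,\tilde w\,d\mu)$ of $u$ (that is, $|u(x)-u(y)|\le d(x,y)(g(x)+g(y))$ outside a $\mu$-null set) such that for every $z\in\partial\Omega$ one has $\langle u\rangle_{B(z,r)\cap\Omega}\to\infty$ as $r\to0^+$, and for no $c\in\mathbb R$ does $\langle|u-c|\rangle_{B(z,r)\cap\Omega}\to0$. -/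

import Mathlib

open MeasureTheory Set Filter Topology
open scoped ENNReal NNReal

/-- A domain: a nonempty connected open set. -/
def IsMetricDomain {X : Type*} [TopologicalSpace X] (Ω : Set X) : Prop :=
  IsOpen Ω ∧ IsConnected Ω

/-- Every ball has positive and finite measure. -/
def BallsPosFinite {X : Type*} [MetricSpace X] [MeasurableSpace X] (μ : Measure X) : Prop :=
  ∀ (x : X) (r : ℝ), 0 < r → 0 < μ (Metric.ball x r) ∧ μ (Metric.ball x r) < ∞

/-- The restriction of `μ` to `Ω` is doubling and non-trivial, with balls centred in the closure
of `Ω`. -/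
def IsDoublingOn {X : Type*} [MetricSpace X] [MeasurableSpace X] (μ : Measure X) (Ω : Set X) :
    Prop :=
  ∃ c : ℝ≥0, ∀ x ∈ closure Ω, ∀ r : ℝ, 0 < r →
    0 < μ (Metric.ball x (2 * r) ∩ Ω) ∧
    μ (Metric.ball x (2 * r) ∩ Ω) ≤ c * μ (Metric.ball x r ∩ Ω) ∧
    μ (Metric.ball x r ∩ Ω) < ∞

/-- The measure `μ` on the metric space `Ω` (a subspace of `X`). -/
noncomputable def measureOn {X : Type*} [MeasurableSpace X] (μ : Measure X) (Ω : Set X) :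
    Measure Ω :=
  μ.comap ((↑) : Ω → X)

/-- The Borel function `g` is an upper gradient of `u` in the metric space `Y`:
`|u(γ(b)) - u(γ(a))| ≤ ∫_γ g ds` for every rectifiable curve `γ`. The line integral is the integral
over the arc-length parametrization, and every rectifiable curve has one, with the same end
points, so the condition is written for the curves `γ : [0, l] → Y` parametrized by arc length
(a unit speed map on `[0, l]` is 1-Lipschitz there).
Functions are real valued. For an extended real valued `u` the definition asks that `∫_γ g ds = ∞`
if `u` is infinite at an end point of `γ`; redefining such a `u` as `0` where it is infinite keeps
all its upper gradients, so real valued representatives suffice. -/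
def IsUpperGradient {Y : Type*} [MetricSpace Y] [MeasurableSpace Y] (u : Y → ℝ) (g : Y → ℝ≥0∞) :
    Prop :=
  Measurable g ∧ ∀ (l : ℝ) (γ : ℝ → Y), 0 ≤ l → HasUnitSpeedOn γ (Icc 0 l) →
    ENNReal.ofReal |u (γ l) - u (γ 0)| ≤ ∫⁻ t in Icc 0 l, g (γ t)

/-- The Newtonian norm
`‖u‖ = (‖u‖_{L^p}^p + inf {‖g‖_{L^p}^p : g upper gradient of u})^{1/p}`. -/
noncomputable def newtonNorm {Y : Type*} [MetricSpace Y] [MeasurableSpace Y] (p : ℝ)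
    (ν : Measure Y) (u : Y → ℝ) : ℝ≥0∞ :=
  ((∫⁻ x, ‖u x‖ₑ ^ p ∂ν) +
    ⨅ (g : Y → ℝ≥0∞) (_ : IsUpperGradient u g), ∫⁻ x, g x ^ p ∂ν) ^ (1 / p)

theorem newtonNorm_lt_top_iff {Y : Type*} [MetricSpace Y] [MeasurableSpace Y] {p : ℝ}
    (hp : 1 ≤ p) (ν : Measure Y) (u : Y → ℝ) :
    newtonNorm p ν u < ∞ ↔ (∫⁻ x, ‖u x‖ₑ ^ p ∂ν) < ∞ ∧
      ∃ g, IsUpperGradient u g ∧ (∫⁻ x, g x ^ p ∂ν) < ∞ := by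
  have h0 : 0 < 1 / p := by positivity
  unfold newtonNorm
  rw [ENNReal.rpow_lt_top_iff_of_pos h0, ENNReal.add_lt_top]
  simp only [iInf_lt_iff, exists_prop]

/-- The Newtonian space `N^{1,p}(Y, ν)`, `p ≥ 1`, as a vector space of functions. -/
noncomputable def newtonian {Y : Type*} [MetricSpace Y] [MeasurableSpace Y] (p : ℝ) (hp : 1 ≤ p)
    (ν : Measure Y) : Submodule ℝ (Y → ℝ) where
  carrier := {u | AEStronglyMeasurable u ν ∧ newtonNorm p ν u < ∞}
  zero_mem' := by
    have hp0 : 0 < p := by linarith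
    refine ⟨aestronglyMeasurable_zero, (newtonNorm_lt_top_iff hp ν _).2 ⟨?_, 0, ⟨?_, ?_⟩, ?_⟩⟩
    · simp [hp0]
    · exact measurable_zero
    · intro l γ _ _
      simp
    · simp [hp0]
  add_mem' := by
    rintro u v ⟨hu, hu'⟩ ⟨hv, hv'⟩
    obtain ⟨hu1, g, ⟨hgm, hg⟩, hg1⟩ := (newtonNorm_lt_top_iff hp ν _).1 hu'
    obtain ⟨hv1, h, ⟨hhm, hh⟩, hh1⟩ := (newtonNorm_lt_top_iff hp ν _).1 hv'
    refine ⟨hu.add hv, (newtonNorm_lt_top_iff hp ν _).2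
      ⟨?_, g + h, ⟨hgm.add hhm, ?_⟩, ?_⟩⟩
    · refine lt_of_le_of_lt (lintegral_mono fun x => ?_)
        (ENNReal.lintegral_rpow_add_lt_top_of_lintegral_rpow_lt_top hu.enorm hu1 hv1 hp)
      exact ENNReal.rpow_le_rpow (enorm_add_le _ _) (by linarith)
    · intro l γ hl hγ
      have e : (u + v) (γ l) - (u + v) (γ 0) =
          (u (γ l) - u (γ 0)) + (v (γ l) - v (γ 0)) := by
        simp only [Pi.add_apply]; ring
      rw [e]
      calc ENNReal.ofReal |(u (γ l) - u (γ 0)) + (v (γ l) - v (γ 0))|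
          ≤ ENNReal.ofReal (|u (γ l) - u (γ 0)| + |v (γ l) - v (γ 0)|) :=
            ENNReal.ofReal_le_ofReal (abs_add_le _ _)
        _ = ENNReal.ofReal |u (γ l) - u (γ 0)| + ENNReal.ofReal |v (γ l) - v (γ 0)| :=
            ENNReal.ofReal_add (abs_nonneg _) (abs_nonneg _)
        _ ≤ (∫⁻ t in Icc 0 l, g (γ t)) + ∫⁻ t in Icc 0 l, h (γ t) :=
            add_le_add (hg l γ hl hγ) (hh l γ hl hγ)
        _ ≤ ∫⁻ t in Icc 0 l, (g + h) (γ t) := le_lintegral_add _ _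
    · exact ENNReal.lintegral_rpow_add_lt_top_of_lintegral_rpow_lt_top hgm.aemeasurable hg1 hh1 hp
  smul_mem' := by
    rintro c u ⟨hu, hu'⟩
    obtain ⟨hu1, g, ⟨hgm, hg⟩, hg1⟩ := (newtonNorm_lt_top_iff hp ν _).1 hu'
    have hp0 : 0 ≤ p := by linarith
    have key : ∀ f : Y → ℝ≥0∞, (∫⁻ x, f x ^ p ∂ν) < ∞ → (∫⁻ x, (‖c‖ₑ * f x) ^ p ∂ν) < ∞ := by
      intro f hf
      simp_rw [ENNReal.mul_rpow_of_nonneg _ _ hp0]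
      rw [lintegral_const_mul' _ _ (ENNReal.rpow_ne_top_of_nonneg hp0 enorm_ne_top)]
      exact ENNReal.mul_lt_top (ENNReal.rpow_lt_top_of_nonneg hp0 enorm_ne_top) hf
    refine ⟨hu.const_smul c, (newtonNorm_lt_top_iff hp ν _).2
      ⟨?_, fun x => ‖c‖ₑ * g x, ⟨hgm.const_mul _, ?_⟩, key g hg1⟩⟩
    · simpa [enorm_mul] using key _ hu1
    · intro l γ hl hγ
      rw [lintegral_const_mul' _ _ enorm_ne_top]
      have e : ENNReal.ofReal |(c • u) (γ l) - (c • u) (γ 0)| =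
          ‖c‖ₑ * ENNReal.ofReal |u (γ l) - u (γ 0)| := by
        rw [Real.enorm_eq_ofReal_abs, ← ENNReal.ofReal_mul (abs_nonneg _), ← abs_mul]
        simp [mul_sub]
      rw [e]
      exact mul_le_mul_right (hg l γ hl hγ) _

/-- The metric measure space `(Y, ν)` admits a `q`-Poincaré inequality: for some `C` and `lam ≥ 1`,
`⨍_B |u - u_B| dν ≤ C rad(B) (⨍_{lam B} g^q dν)^{1/q}` for every ball `B` of `Y`, every locally
integrable `u`, and every (measurable, a.e. finite) upper gradient `g` of `u`. -/
def AdmitsPoincare {Y : Type*} [MetricSpace Y] [MeasurableSpace Y] (q : ℝ) (ν : Measure Y) :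
    Prop :=
  ∃ C lam : ℝ, 0 < C ∧ 1 ≤ lam ∧ ∀ (u : Y → ℝ) (g : Y → ℝ≥0∞),
    LocallyIntegrable u ν → IsUpperGradient u g → (∀ᵐ x ∂ν, g x < ∞) →
    ∀ (x : Y) (r : ℝ), 0 < r →
      ⨍⁻ y in Metric.ball x r, ‖u y - ⨍ a in Metric.ball x r, u a ∂ν‖ₑ ∂ν ≤
        ENNReal.ofReal (C * r) * (⨍⁻ y in Metric.ball x (lam * r), g y ^ q ∂ν) ^ (1 / q)

/-- The measure `H` on the boundary of `Ω` is Ahlfors codimension-`θ` regular: `H(B(z,r) ∩ ∂Ω)` is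
bounded from below for `0 < r < 2 diam ∂Ω`, and from above for `0 < r < 2 diam Ω`, by a constant
times `μ(B(z,r) ∩ Ω) / r^θ`. A ball of the space `∂Ω` is `B(z,r) ∩ ∂Ω`. -/
def IsCodimRegular {X : Type*} [MetricSpace X] [MeasurableSpace X] (μ : Measure X) (Ω : Set X)
    (H : Measure (frontier Ω)) (θ : ℝ) : Prop :=
  ∃ c C : ℝ≥0, 0 < c ∧
    (∀ (z : frontier Ω) (r : ℝ), 0 < r → r < 2 * Metric.diam (frontier Ω) →
      c * (μ (Metric.ball (z : X) r ∩ Ω) / ENNReal.ofReal (r ^ θ)) ≤ H (Metric.ball z r)) ∧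
    (∀ (z : frontier Ω) (r : ℝ), 0 < r → r < 2 * Metric.diam Ω →
      H (Metric.ball z r) ≤ C * (μ (Metric.ball (z : X) r ∩ Ω) / ENNReal.ofReal (r ^ θ)))

/-- The weight `log(2 diam Ω / dist(x, ∂Ω))^a`. -/
noncomputable def logWeight {X : Type*} [MetricSpace X] (Ω : Set X) (a : ℝ) (x : X) : ℝ :=
  Real.log (2 * Metric.diam Ω / Metric.infDist x (frontier Ω)) ^ a

/-- The measure `log(2 diam Ω / dist(x, ∂Ω))^a dμ(x)` on `Ω`. -/
noncomputable def logMeasureOn {X : Type*} [MetricSpace X] [MeasurableSpace X] (μ : Measure X)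
    (Ω : Set X) (a : ℝ) : Measure Ω :=
  (measureOn μ Ω).withDensity fun x => ENNReal.ofReal (logWeight Ω a (x : X))

/-- `c` is the trace of `u : Ω → ℝ` at the point `z`:
`⨍_{B(z,r) ∩ Ω} |u - c| dμ → 0` as `r → 0+`. -/
def HasTraceAt {X : Type*} [MetricSpace X] [MeasurableSpace X] (μ : Measure X) (Ω : Set X)
    (u : Ω → ℝ) (z : X) (c : ℝ) : Prop :=
  Tendsto (fun r : ℝ =>
      ⨍⁻ x in ((↑) : Ω → X) ⁻¹' Metric.ball z r, ‖u x - c‖ₑ ∂(measureOn μ Ω))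
    (𝓝[>] 0) (𝓝 0)

/-- `f` is the trace of `u` on the boundary: for `H`-a.e. `z`, `f z` is the trace of `u` at `z`. -/
def HasTrace {X : Type*} [MetricSpace X] [MeasurableSpace X] (μ : Measure X) (Ω : Set X)
    (H : Measure (frontier Ω)) (u : Ω → ℝ) (f : frontier Ω → ℝ) : Prop :=
  ∀ᵐ z : frontier Ω ∂H, HasTraceAt μ Ω u (z : X) (f z)

/-- `g` is a Hajłasz gradient of `u` with respect to `ν`. -/
def IsHajlaszGradient {Y : Type*} [MetricSpace Y] [MeasurableSpace Y] (ν : Measure Y)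
    (u : Y → ℝ) (g : Y → ℝ≥0∞) : Prop :=
  Measurable g ∧ ∃ E : Set Y, ν E = 0 ∧ ∀ x ∉ E, ∀ y ∉ E,
    ENNReal.ofReal |u x - u y| ≤ ENNReal.ofReal (dist x y) * (g x + g y)

/-- `Ω` is a uniform domain. -/
def IsUniformDomain {X : Type*} [MetricSpace X] (Ω : Set X) : Prop :=
  IsMetricDomain Ω ∧ ∃ c : ℝ, 0 < c ∧ c ≤ 1 ∧ ∀ x ∈ Ω, ∀ y ∈ Ω, x ≠ y →
    ∃ (l : ℝ) (γ : ℝ → X), 0 ≤ l ∧ HasUnitSpeedOn γ (Icc 0 l) ∧ MapsTo γ (Icc 0 l) Ω ∧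
      γ 0 = x ∧ γ l = y ∧ l ≤ c⁻¹ * dist x y ∧
      ∀ t ∈ Icc 0 l, c * min t (l - t) ≤ Metric.infDist (γ t) Ωᶜ

/-- The open unit disk of the Euclidean plane. -/
def unitDisk : Set (EuclideanSpace ℝ (Fin 2)) := Metric.ball 0 1

open Classical in
/-- The measure on the plane with density `dist(x, X \ Ω)^(θ-1)` on the unit disk `Ω`
and density `1` outside it. -/
noncomputable def diskMeasure (θ : ℝ) : Measure (EuclideanSpace ℝ (Fin 2)) :=
  volume.withDensity fun x =>
    if x ∈ unitDisk then ENNReal.ofReal (Metric.infDist x unitDiskᶜ ^ (θ - 1)) else 1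

/-- The length (one-dimensional Hausdorff) measure on the unit circle. -/
noncomputable def circleLength : Measure (frontier unitDisk) := Measure.hausdorffMeasure 1

/-!
The trace. Chaining the `θ`-Poincaré inequality over the dyadic balls `B(z, R / 2 ^ k) ∩ Ω` about a
boundary point `z` bounds the oscillation of `u` near `z` by a sum over the scales `r = R / 2 ^ k`
of `r (⨍ g ^ θ) ^ (1 / θ)`, the mean being over a fixed multiple of the ball
(`exists_hasTraceAt_of_tsum_ne_top`). Hölder's inequality with the weights
`(k + 1) ^ (θ - 1 + ε)` puts the power `θ` inside the sum. After integration against `H` and an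
application of Tonelli's theorem, the codimension bound cancels the factor `r ^ θ`, and a point `x`
receives a contribution only from the scales with `R / 2 ^ k ≳ dist(x, ∂Ω)`. There are about
`log (R / dist(x, ∂Ω))` of them, and their weights add up to the weight `L ^ (θ + ε)`
(`HasCodimUpperBound.exists_lintegral_tsum_oscillation_le`, `exists_traceOperator`).

The extension. A boundary function `f` is approximated by Lipschitz functions `φ k` with an
`L^θ(H)` error of `8 ^ (-k) ‖f‖`, and `E f = ∑ (φ (k + 1) - φ k) η k`, where `η k` is a cutoff to a
boundary layer of width `ρ k`. The lower codimension bound shows that the energy of one term is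
bounded by the `L^θ(H)` norm of `φ (k + 1) - φ k` once the layer is thin enough
(`HasCodimLowerBound.exists_eventually_layer_le`). The width `ρ k` is chosen recursively, so thin
that the term has a negligible mean over all balls of radius at least `ρ (k - 1)`. At a radius
between two consecutive widths the outer terms telescope to `φ n`, the inner ones are negligible,
and so `E f` has the trace `lim φ k = f` almost everywhere (`hasTraceAt_tsum_layers`). Doubling, and
no Poincaré inequality, is needed here.

The disk. The density `(1 - ‖x‖) ^ (θ - 1)` changes by a bounded factor when a convex set is
contracted by at most `1 / 2` towards one of its points, because the depth `1 - ‖x‖` is concave;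
integrating the upper gradient along segments then gives the 1-Poincaré inequality
(`lintegral_contraction_le`, `admitsPoincare_measureOn_unitDisk`). The function
`u = log log (4 / (1 - ‖x‖))` tends to infinity at the boundary, so it has no trace, while its
gradient `g = 1 / ((1 - ‖x‖) L)` satisfies `g ^ θ L ^ a dμ = L ^ (a - θ) / (1 - ‖x‖) dx`, which is
integrable as soon as `a < θ - 1`; in the case at hand `a ≤ θ - 3 / 2`.
-/

/-! ### Upper gradients, series and Lipschitz approximation -/

theorem HasUnitSpeedOn.lipschitzOnWith {Y : Type*} [PseudoEMetricSpace Y] {γ : ℝ → Y} {s : Set ℝ}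
    (h : HasUnitSpeedOn γ s) : LipschitzOnWith 1 γ s := by
  have key : ∀ x ∈ s, ∀ y ∈ s, x ≤ y → edist (γ x) (γ y) ≤ edist x y := by
    intro x hx y hy hxy
    calc edist (γ x) (γ y) ≤ eVariationOn γ (s ∩ Icc x y) :=
          eVariationOn.edist_le γ ⟨hx, le_rfl, hxy⟩ ⟨hy, hxy, le_rfl⟩
      _ = ENNReal.ofReal (y - x) := by rw [h hx hy]; simp
      _ = edist x y := by
          rw [edist_comm, edist_dist, Real.dist_eq, abs_of_nonneg (sub_nonneg.2 hxy)]
  intro x hx y hy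
  rw [ENNReal.coe_one, one_mul]
  rcases le_total x y with hxy | hxy
  · exact key x hx y hy hxy
  · rw [edist_comm, edist_comm x]; exact key y hy x hx hxy

/-- A Lipschitz function on an interval is controlled by the integral of any upper bound for the
modulus of its derivative at the points where it is differentiable. -/
theorem ofReal_abs_sub_le_lintegral {l : ℝ} (hl : 0 ≤ l) {F : ℝ → ℝ} {G : ℝ → ℝ≥0∞} {K : ℝ≥0}
    (hF : LipschitzOnWith K F (Icc 0 l))
    (hG : ∀ t ∈ Ioo 0 l, ∀ D : ℝ, HasDerivAt F D t → ENNReal.ofReal |D| ≤ G t) :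
    ENNReal.ofReal |F l - F 0| ≤ ∫⁻ t in Icc 0 l, G t := by
  have hac : AbsolutelyContinuousOnInterval F 0 l :=
    LipschitzOnWith.absolutelyContinuousOnInterval (by rwa [uIcc_of_le hl])
  rw [← hac.integral_deriv_eq_sub, intervalIntegral.integral_of_le hl, ← Real.enorm_eq_ofReal_abs,
    integral_Ioc_eq_integral_Ioo]
  refine (enorm_integral_le_lintegral_enorm _).trans ?_
  refine le_trans ?_ (lintegral_mono_set Ioo_subset_Icc_self)
  refine setLIntegral_mono' measurableSet_Ioo fun t ht => ?_
  by_cases hd : DifferentiableAt ℝ F t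
  · rw [Real.enorm_eq_ofReal_abs]; exact hG t ht _ hd.hasDerivAt
  · simp [deriv_zero_of_not_differentiableAt hd]

/-- A measurable function that bounds the pointwise Lipschitz constant of `u` is an upper gradient
of `u`, as soon as `u` is Lipschitz on compact sets. -/
theorem isUpperGradient_of_slope {Y : Type*} [MetricSpace Y] [MeasurableSpace Y] {u : Y → ℝ}
    {g : Y → ℝ≥0∞} (hg : Measurable g)
    (hu : ∀ S : Set Y, IsCompact S → ∃ K : ℝ≥0, LipschitzOnWith K u S)
    (hs : ∀ x, ∀ c : ℝ≥0, g x < c → ∀ᶠ y in 𝓝 x, |u y - u x| ≤ c * dist y x) :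
    IsUpperGradient u g := by
  refine ⟨hg, fun l γ hl hγ => ?_⟩
  have hlip := hγ.lipschitzOnWith
  obtain ⟨K, hK⟩ := hu (γ '' Icc 0 l) (isCompact_Icc.image_of_continuousOn hlip.continuousOn)
  have hF : LipschitzOnWith (K * 1) (u ∘ γ) (Icc 0 l) := hK.comp hlip (mapsTo_image _ _)
  refine ofReal_abs_sub_le_lintegral (F := u ∘ γ) hl hF fun t ht D hD => ?_
  refine le_of_forall_gt fun c hc => ?_
  obtain ⟨c', hc1, hc2⟩ := ENNReal.lt_iff_exists_nnreal_btwn.1 hc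
  refine lt_of_le_of_lt ?_ hc2
  have hnhds : Icc 0 l ∈ 𝓝 t := Icc_mem_nhds ht.1 ht.2
  have hcont : ContinuousAt γ t := hlip.continuousOn.continuousAt hnhds
  have hD' : ‖D‖ ≤ c' := by
    refine hD.le_of_lip' c'.2 ?_
    filter_upwards [hcont.eventually (hs (γ t) c' hc1), hnhds] with y hy hyI
    refine hy.trans (mul_le_mul_of_nonneg_left ?_ c'.2)
    have := hlip.dist_le_mul y hyI t (Ioo_subset_Icc_self ht)
    simpa [Real.dist_eq] using this
  rw [Real.norm_eq_abs] at hD'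
  rw [← ENNReal.ofReal_coe_nnreal]
  exact ENNReal.ofReal_le_ofReal hD'

/-- Countable form of the quasi-triangle inequality for `a ↦ a ^ p`. -/
theorem ENNReal.tsum_rpow_le_tsum_two_pow_mul_rpow {p : ℝ} (hp : 0 < p) (a : ℕ → ℝ≥0∞) :
    (∑' k, a k) ^ p ≤ 2 ^ p * ∑' k, (2 ^ k * a k) ^ p := by
  have h1 : ∑' k, a k ≤ 2 * ⨆ k, 2 ^ k * a k := by
    have h2 : ∀ k, a k ≤ (2⁻¹ : ℝ≥0∞) ^ k * ⨆ k, 2 ^ k * a k := by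
      intro k
      calc a k = (2⁻¹ : ℝ≥0∞) ^ k * (2 ^ k * a k) := by
            rw [← mul_assoc, ← mul_pow, ENNReal.inv_mul_cancel (by simp) (by simp), one_pow,
              one_mul]
        _ ≤ _ := by gcongr; exact le_iSup (fun k => 2 ^ k * a k) k
    calc ∑' k, a k ≤ ∑' k, (2⁻¹ : ℝ≥0∞) ^ k * ⨆ k, 2 ^ k * a k := ENNReal.tsum_le_tsum h2
      _ = 2 * ⨆ k, 2 ^ k * a k := by
          rw [ENNReal.tsum_mul_right, ENNReal.tsum_geometric, ENNReal.one_sub_inv_two, inv_inv]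
  calc (∑' k, a k) ^ p ≤ (2 * ⨆ k, 2 ^ k * a k) ^ p := ENNReal.rpow_le_rpow h1 hp.le
    _ = 2 ^ p * ⨆ k, (2 ^ k * a k) ^ p := by
        rw [ENNReal.mul_rpow_of_nonneg _ _ hp.le]
        congr 1
        exact (ENNReal.orderIsoRpow p hp).map_iSup _
    _ ≤ _ := by gcongr; exact iSup_le fun k => ENNReal.le_tsum k

/-- Hölder's inequality for series, with polynomial weights. -/
theorem ENNReal.exists_tsum_rpow_le_tsum_weight {p : ℝ} (hp : 1 ≤ p) {ε : ℝ} (hε : 0 < ε) :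
    ∃ C : ℝ≥0, ∀ a : ℕ → ℝ≥0∞,
      (∑' k, a k) ^ p ≤ C * ∑' k : ℕ, ENNReal.ofReal (((k : ℝ) + 1) ^ (p - 1 + ε)) * a k ^ p := by
  rcases hp.eq_or_lt with rfl | hp1
  · refine ⟨1, fun a => ?_⟩
    simp only [ENNReal.rpow_one, ENNReal.coe_one, one_mul]
    refine ENNReal.tsum_le_tsum fun k => ?_
    refine le_mul_of_one_le_left zero_le ?_
    rw [ENNReal.one_le_ofReal]
    exact Real.one_le_rpow (by linarith [(Nat.cast_nonneg k : (0 : ℝ) ≤ k)]) (by linarith)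
  · have hpq : p.HolderConjugate (p.conjExponent) := Real.HolderConjugate.conjExponent hp1
    set q := p.conjExponent with hq
    have hp0 : 0 < p := by linarith
    set s : ℝ := (p - 1 + ε) / p with hs
    have hs0 : 0 < s := by rw [hs]; apply div_pos <;> linarith
    have hsq : 1 < s * q := by
      rw [hs, hq, Real.conjExponent]
      have : 0 < p - 1 := by linarith
      rw [div_mul_div_comm, lt_div_iff₀ (by positivity)]
      nlinarith
    have hsum : Summable fun k : ℕ => ((k : ℝ) + 1) ^ (-(s * q)) := by
      have := (summable_nat_add_iff 1).2 (Real.summable_nat_rpow.2 (neg_lt_neg hsq))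
      simpa using this
    set B : ℝ≥0∞ := ∑' k : ℕ, ENNReal.ofReal (((k : ℝ) + 1) ^ (-(s * q))) with hB
    have hBtop : B ≠ ∞ := hsum.tsum_ofReal_ne_top
    refine ⟨(B ^ (p / q)).toNNReal, fun a => ?_⟩
    have hpos : ∀ k : ℕ, (0 : ℝ) < (k : ℝ) + 1 := fun k => by positivity
    rw [ENNReal.coe_toNNReal (ENNReal.rpow_ne_top_of_nonneg
      (div_nonneg hp0.le hpq.symm.nonneg) hBtop)]
    have key : ∑' k, a k ≤ B ^ (1 / q) *
        (∑' k : ℕ, ENNReal.ofReal (((k : ℝ) + 1) ^ (p - 1 + ε)) * a k ^ p) ^ (1 / p) := by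
      rw [ENNReal.tsum_eq_iSup_sum]
      refine iSup_le fun t => ?_
      calc ∑ k ∈ t, a k
          = ∑ k ∈ t, ENNReal.ofReal (((k : ℝ) + 1) ^ (-s)) *
              (ENNReal.ofReal (((k : ℝ) + 1) ^ s) * a k) := by
            refine Finset.sum_congr rfl fun k _ => ?_
            rw [← mul_assoc, ← ENNReal.ofReal_mul (Real.rpow_nonneg (hpos k).le _),
              ← Real.rpow_add (hpos k)]
            simp
        _ ≤ (∑ k ∈ t, ENNReal.ofReal (((k : ℝ) + 1) ^ (-s)) ^ q) ^ (1 / q) *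
            (∑ k ∈ t, (ENNReal.ofReal (((k : ℝ) + 1) ^ s) * a k) ^ p) ^ (1 / p) :=
            ENNReal.inner_le_Lp_mul_Lq _ _ _ hpq.symm
        _ ≤ _ := by
            gcongr
            · exact hpq.symm.one_div_nonneg
            · refine le_trans (Finset.sum_le_sum fun k _ => ?_) (ENNReal.sum_le_tsum t)
              rw [ENNReal.ofReal_rpow_of_nonneg (Real.rpow_nonneg (hpos k).le _) hpq.symm.nonneg,
                ← Real.rpow_mul (hpos k).le, neg_mul]
            · refine le_trans (Finset.sum_le_sum fun k _ => ?_) (ENNReal.sum_le_tsum t)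
              rw [ENNReal.mul_rpow_of_nonneg _ _ hp0.le,
                ENNReal.ofReal_rpow_of_nonneg (Real.rpow_nonneg (hpos k).le _) hp0.le,
                ← Real.rpow_mul (hpos k).le, hs, div_mul_cancel₀ _ hp0.ne']
    calc (∑' k, a k) ^ p ≤ _ := ENNReal.rpow_le_rpow key hp0.le
      _ = _ := by
          rw [ENNReal.mul_rpow_of_nonneg _ _ hp0.le, ← ENNReal.rpow_mul, ← ENNReal.rpow_mul,
            one_div_mul_cancel hp0.ne', ENNReal.rpow_one, one_div_mul_eq_div]


/-- Lipschitz functions are dense in `L^p` of a finite Borel measure on a metric space, `p < ∞`. -/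
theorem MeasureTheory.MemLp.exists_lipschitz_eLpNorm_sub_le {Y : Type*} [MetricSpace Y]
    [MeasurableSpace Y] [BorelSpace Y] {ν : Measure Y} [IsFiniteMeasure ν] {p : ℝ≥0∞}
    (hp1 : 1 ≤ p) (hp : p ≠ ∞) {f : Y → ℝ} (hf : MemLp f p ν) {ε : ℝ≥0∞} (hε : ε ≠ 0) :
    ∃ g : Y → ℝ, eLpNorm (f - g) p ν ≤ ε ∧ ∃ K : ℝ≥0, LipschitzWith K g := by
  refine hf.induction_dense hp (fun g => ∃ K : ℝ≥0, LipschitzWith K g) ?_ ?_ ?_ hε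
  · intro c s hs _ ε hε
    obtain ⟨η, hη, hη'⟩ := exists_eLpNorm_indicator_le (μ := ν) hp c (ε := ε / 2) (by simpa using hε)
    -- a closed set `F ⊆ s` and a thickening of `F`, both close to `s` in measure; the indicator of
    -- `s` is approximated by a Lipschitz function that is `1` on `F` and `0` off the thickening
    obtain ⟨F, hFs, hFc, hF⟩ := hs.exists_isClosed_sdiff_lt (measure_ne_top ν s)
      (ε := (η : ℝ≥0∞)) (by exact_mod_cast hη.ne')
    have hlim : Tendsto (fun n : ℕ => ν (Metric.thickening (1 / ((n : ℝ) + 1)) F)) atTop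
        (𝓝 (ν F)) := by
      have := tendsto_measure_thickening_of_isClosed (μ := ν) (s := F)
        ⟨1, one_pos, measure_ne_top _ _⟩ hFc
      exact this.comp (tendsto_nhdsWithin_iff.2 ⟨tendsto_one_div_add_atTop_nhds_zero_nat,
        Eventually.of_forall fun n => by simp only [mem_Ioi]; positivity⟩)
    have hlt : ν F < ν F + η :=
      ENNReal.lt_add_right (measure_ne_top _ _) (by exact_mod_cast hη.ne')
    obtain ⟨n, hn⟩ := (hlim.eventually (gt_mem_nhds hlt)).exists
    set δ : ℝ := 1 / ((n : ℝ) + 1) with hδ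
    have hδ0 : 0 < δ := by positivity
    refine ⟨fun x => (thickenedIndicator hδ0 F x : ℝ) * c, ?_, ?_⟩
    · have hd : ν (Metric.thickening δ F \ F) ≤ η := by
        rw [measure_sdiff (Metric.self_subset_thickening hδ0 F) hFc.measurableSet.nullMeasurableSet
          (measure_ne_top _ _)]
        exact tsub_le_iff_left.2 hn.le
      have hb : ∀ x, ‖((fun x => (thickenedIndicator hδ0 F x : ℝ) * c) - s.indicator fun _ => c) x‖
          ≤ ‖((Metric.thickening δ F \ F).indicator (fun _ => c)
            + (s \ F).indicator (fun _ => c)) x‖ := by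
        intro x
        have h0 : (0 : ℝ) ≤ thickenedIndicator hδ0 F x := NNReal.coe_nonneg _
        have h1 : (thickenedIndicator hδ0 F x : ℝ) ≤ 1 := by
          exact_mod_cast thickenedIndicator_le_one hδ0 F x
        have h2 : x ∈ F → (thickenedIndicator hδ0 F x : ℝ) = 1 := fun h => by
          exact_mod_cast thickenedIndicator_one hδ0 F h
        have h3 : x ∉ Metric.thickening δ F → (thickenedIndicator hδ0 F x : ℝ) = 0 := fun h => by
          exact_mod_cast thickenedIndicator_zero hδ0 F h
        simp only [Pi.sub_apply, Pi.add_apply, Real.norm_eq_abs]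
        generalize (thickenedIndicator hδ0 F x : ℝ) = t at h0 h1 h2 h3 ⊢
        by_cases hxF : x ∈ F
        · simp [h2 hxF, hFs hxF, hxF]
        · by_cases hxs : x ∈ s
          · have e1 : t * c - s.indicator (fun _ => c) x = -((1 - t) * c) := by
              rw [indicator_of_mem hxs]; ring
            rw [e1, abs_neg, abs_mul, abs_of_nonneg (sub_nonneg.2 h1),
              indicator_of_mem (show x ∈ s \ F from ⟨hxs, hxF⟩)]
            by_cases hxt : x ∈ Metric.thickening δ F
            · rw [indicator_of_mem (show x ∈ Metric.thickening δ F \ F from ⟨hxt, hxF⟩),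
                ← two_mul, abs_mul, abs_two]
              nlinarith [abs_nonneg c]
            · rw [indicator_of_notMem (fun h => hxt h.1), zero_add]
              nlinarith [abs_nonneg c]
          · rw [indicator_of_notMem hxs, sub_zero, abs_mul, abs_of_nonneg h0,
              indicator_of_notMem (show x ∉ s \ F from fun h => hxs h.1), add_zero]
            by_cases hxt : x ∈ Metric.thickening δ F
            · rw [indicator_of_mem (show x ∈ Metric.thickening δ F \ F from ⟨hxt, hxF⟩)]
              nlinarith [abs_nonneg c]
            · simp [h3 hxt]
      refine (eLpNorm_mono hb).trans ((eLpNorm_add_le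
        (aestronglyMeasurable_const.indicator (Metric.isOpen_thickening.measurableSet.diff
          hFc.measurableSet)) (aestronglyMeasurable_const.indicator (hs.diff hFc.measurableSet))
        hp1).trans ?_)
      exact (add_le_add (hη' _ hd) (hη' _ hF.le)).trans (ENNReal.add_halves ε).le
    · have h1 := lipschitzWith_thickenedIndicator hδ0 F
      refine ⟨δ.toNNReal⁻¹ * ‖c‖₊, LipschitzWith.of_dist_le_mul fun x y => ?_⟩
      have h2 := h1.dist_le_mul x y
      rw [NNReal.dist_eq] at h2
      rw [Real.dist_eq, ← sub_mul, abs_mul, NNReal.coe_mul, coe_nnnorm, Real.norm_eq_abs]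
      nlinarith [abs_nonneg c]
  · rintro f g ⟨K, hK⟩ ⟨L, hL⟩
    exact ⟨K + L, hK.add hL⟩
  · rintro f ⟨K, hK⟩
    exact hK.continuous.aestronglyMeasurable

/-! ### Doubling measures and balls centred in the closure -/

/-- The trace on `Ω` of the ball of `X` with centre `z` (typically a boundary point) and
radius `r`, as a subset of the metric space `Ω`. -/
abbrev ballIn {X : Type*} [MetricSpace X] (Ω : Set X) (z : X) (r : ℝ) : Set Ω :=
  ((↑) : Ω → X) ⁻¹' Metric.ball z r

/-- The measure `ν` on `Ω` is positive and doubling, with constant `c`, on balls centred in the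
closure of `Ω`. -/
structure IsClosureDoubling {X : Type*} [MetricSpace X] [MeasurableSpace X] {Ω : Set X}
    (ν : Measure Ω) (c : ℝ≥0) : Prop where
  pos : ∀ z ∈ closure Ω, ∀ r : ℝ, 0 < r → 0 < ν (ballIn Ω z r)
  le : ∀ z ∈ closure Ω, ∀ r : ℝ, 0 < r → ν (ballIn Ω z (2 * r)) ≤ c * ν (ballIn Ω z r)

section

variable {X : Type*} [MetricSpace X] [MeasurableSpace X] [BorelSpace X] {Ω : Set X}

theorem measurableSet_ballIn (z : X) (r : ℝ) : MeasurableSet (ballIn Ω z r) :=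
  (Metric.isOpen_ball.preimage continuous_subtype_val).measurableSet

omit [MeasurableSpace X] [BorelSpace X] in
theorem ballIn_subset {z w : X} {r s : ℝ} (h : dist z w + r ≤ s) : ballIn Ω z r ⊆ ballIn Ω w s :=
  preimage_mono (Metric.ball_subset_ball' (by linarith))

omit [MeasurableSpace X] [BorelSpace X] in
theorem ballIn_eq_univ (hb : Bornology.IsBounded Ω) {z : X} (hz : z ∈ closure Ω) {r : ℝ}
    (hr : Metric.diam Ω < r) : ballIn Ω z r = univ := by
  refine eq_univ_of_forall fun x => ?_
  have := Metric.dist_le_diam_of_mem hb.closure (subset_closure x.2) hz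
  rw [Metric.diam_closure] at this
  exact lt_of_le_of_lt this hr

theorem measureOn_ballIn (hΩ : IsOpen Ω) (μ : Measure X) (z : X) (r : ℝ) :
    measureOn μ Ω (ballIn Ω z r) = μ (Metric.ball z r ∩ Ω) := by
  rw [measureOn, comap_subtype_coe_apply hΩ.measurableSet, Subtype.image_preimage_coe, inter_comm]

theorem IsDoublingOn.exists_isClosureDoubling {μ : Measure X} (h : IsDoublingOn μ Ω)
    (hΩ : IsOpen Ω) : ∃ c : ℝ≥0, 1 ≤ c ∧ IsClosureDoubling (measureOn μ Ω) c := by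
  obtain ⟨c, hc⟩ := h
  refine ⟨max 1 c, le_max_left _ _, ⟨fun z hz r hr => ?_, fun z hz r hr => ?_⟩⟩
  · have := (hc z hz (r / 2) (by positivity)).1
    rwa [measureOn_ballIn hΩ, show r = 2 * (r / 2) by ring]
  · rw [measureOn_ballIn hΩ, measureOn_ballIn hΩ]
    refine (hc z hz r hr).2.1.trans ?_
    gcongr
    exact le_max_right _ _

theorem IsDoublingOn.isFiniteMeasure {μ : Measure X} (h : IsDoublingOn μ Ω)
    (hΩ : IsMetricDomain Ω) (hb : Bornology.IsBounded Ω) : IsFiniteMeasure (measureOn μ Ω) := by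
  obtain ⟨c, hc⟩ := h
  obtain ⟨x, hx⟩ := hΩ.2.nonempty
  have hd : 0 ≤ Metric.diam Ω := Metric.diam_nonneg
  have := (hc x (subset_closure hx) (Metric.diam Ω + 1) (by linarith)).2.2
  rw [← measureOn_ballIn hΩ.1, ballIn_eq_univ hb (subset_closure hx) (by linarith)] at this
  exact ⟨this⟩

namespace IsClosureDoubling

variable {ν : Measure Ω} {c : ℝ≥0}

omit [BorelSpace X] in
theorem le_pow (h : IsClosureDoubling ν c) {z : X} (hz : z ∈ closure Ω) {r : ℝ} (hr : 0 < r)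
    (n : ℕ) : ν (ballIn Ω z (2 ^ n * r)) ≤ c ^ n * ν (ballIn Ω z r) := by
  induction n with
  | zero => simp
  | succ n ih =>
    calc ν (ballIn Ω z (2 ^ (n + 1) * r)) = ν (ballIn Ω z (2 * (2 ^ n * r))) := by ring_nf
      _ ≤ c * ν (ballIn Ω z (2 ^ n * r)) := h.le z hz _ (by positivity)
      _ ≤ c * (c ^ n * ν (ballIn Ω z r)) := by gcongr
      _ = _ := by rw [pow_succ]; ring

omit [BorelSpace X] in
/-- Doubling compares balls of comparable radii whose centres are at comparable distance. -/
theorem exists_le (h : IsClosureDoubling ν c) (M : ℝ) :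
    ∃ C : ℝ≥0, 1 ≤ C ∧ ∀ z ∈ closure Ω, ∀ w : X, ∀ r : ℝ, 0 < r → ∀ s : ℝ, dist w z + s ≤ M * r →
      ν (ballIn Ω w s) ≤ C * ν (ballIn Ω z r) := by
  obtain ⟨n, hn⟩ := pow_unbounded_of_one_lt M (one_lt_two)
  refine ⟨max 1 (c ^ n), le_max_left _ _, fun z hz w r hr s hs => ?_⟩
  calc ν (ballIn Ω w s) ≤ ν (ballIn Ω z (2 ^ n * r)) :=
        measure_mono (ballIn_subset (hs.trans (by gcongr)))
    _ ≤ c ^ n * ν (ballIn Ω z r) := h.le_pow hz hr n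
    _ ≤ _ := by
      gcongr
      exact_mod_cast le_max_right 1 (c ^ n)

omit [BorelSpace X] in
/-- Balls of a fixed radius, centred in the closure, have measure bounded from below. -/
theorem exists_lower_bound [IsFiniteMeasure ν] (h : IsClosureDoubling ν c)
    (hb : Bornology.IsBounded Ω) (hne : Ω.Nonempty) {r : ℝ} (hr : 0 < r) :
    ∃ η : ℝ≥0, 0 < η ∧ ∀ z ∈ closure Ω, (η : ℝ≥0∞) ≤ ν (ballIn Ω z r) := by
  obtain ⟨C, hC1, hC⟩ := h.exists_le ((Metric.diam Ω + 1) / r)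
  have hu : 0 < ν univ := by
    obtain ⟨x, hx⟩ := hne
    exact (h.pos x (subset_closure hx) 1 one_pos).trans_le (measure_mono (subset_univ _))
  have hC0 : (C : ℝ≥0∞) ≠ 0 := by
    exact_mod_cast (zero_lt_one.trans_le hC1).ne'
  refine ⟨(ν univ / C).toNNReal, ENNReal.toNNReal_pos
    (ENNReal.div_pos hu.ne' ENNReal.coe_ne_top).ne'
    (ENNReal.div_ne_top (measure_ne_top _ _) hC0), fun z hz => ?_⟩
  rw [ENNReal.coe_toNNReal (ENNReal.div_ne_top (measure_ne_top _ _) hC0)]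
  refine ENNReal.div_le_of_le_mul' ?_
  have := hC z hz z r hr (Metric.diam Ω + 1) (by rw [dist_self, zero_add, div_mul_cancel₀ _ hr.ne'])
  rwa [ballIn_eq_univ hb hz (by linarith)] at this

/-- A metric space that carries a finite measure with positive measure of balls is second
countable. -/
theorem secondCountableTopology [IsFiniteMeasure ν] (h : IsClosureDoubling ν c) :
    SecondCountableTopology Ω := by
  refine Metric.secondCountable_of_almost_dense_set fun ε hε => ?_
  -- a maximal `ε`-separated set is countable, as its balls are disjoint and of positive measure
  obtain ⟨N, hN⟩ := zorn_subset {N : Set Ω | N.Pairwise fun x y => ε ≤ dist x y} (by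
    intro C hC hchain
    refine ⟨⋃₀ C, ?_, fun s hs => subset_sUnion_of_mem hs⟩
    exact (pairwise_sUnion hchain.directedOn).2 fun s hs => hC hs)
  refine ⟨N, ?_, fun x => ?_⟩
  · have hdisj : Pairwise (Function.onFun Disjoint fun i : N => ballIn Ω (i : Ω) (ε / 2)) := by
      intro i j hij
      refine Disjoint.preimage _ (Metric.ball_disjoint_ball ?_)
      have := hN.prop i.2 j.2 (fun h => hij (Subtype.ext h))
      rw [add_halves]; exact this
    have hc := Measure.countable_meas_pos_of_disjoint_iUnion (μ := ν)
      (fun i : N => measurableSet_ballIn _ _) hdisj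
    have : {i : N | 0 < ν (ballIn Ω (i : Ω) (ε / 2))} = univ :=
      eq_univ_of_forall fun i => h.pos _ (subset_closure i.1.2) _ (by positivity)
    rw [this, countable_univ_iff] at hc
    exact countable_coe_iff.1 hc
  · by_contra! hx
    have hins : insert x N ∈ {N : Set Ω | N.Pairwise fun x y => ε ≤ dist x y} := by
      exact pairwise_insert.2
        ⟨hN.prop, fun y hy _ => ⟨(hx y hy).le, by rw [dist_comm]; exact (hx y hy).le⟩⟩
    have hxN : x ∈ N := hN.le_of_ge hins (subset_insert _ _) (mem_insert _ _)
    have := hx x hxN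
    rw [dist_self] at this
    linarith

end IsClosureDoubling

theorem measurableSet_dist_lt [SecondCountableTopology Ω] (r : ℝ) :
    MeasurableSet {q : frontier Ω × Ω | dist (q.2 : X) q.1 < r} :=
  (isOpen_lt (by fun_prop) continuous_const).measurableSet

theorem measurable_measure_ballIn [SecondCountableTopology Ω] (ν : Measure Ω) [SFinite ν] (r : ℝ) :
    Measurable fun z : frontier Ω => ν (ballIn Ω (z : X) r) :=
  measurable_measure_prodMk_left (measurableSet_dist_lt r)

theorem measurable_setLIntegral_ballIn [SecondCountableTopology Ω] (ν : Measure Ω) [SFinite ν]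
    (r : ℝ) {ψ : Ω → ℝ≥0∞} (hψ : Measurable ψ) :
    Measurable fun z : frontier Ω => ∫⁻ x in ballIn Ω (z : X) r, ψ x ∂ν := by
  have h1 : ∀ z : frontier Ω, ∫⁻ x in ballIn Ω (z : X) r, ψ x ∂ν = ∫⁻ x,
      ({q : frontier Ω × Ω | dist (q.2 : X) q.1 < r}.indicator (fun q => ψ q.2)) (z, x) ∂ν := by
    intro z
    rw [← lintegral_indicator (measurableSet_ballIn _ _)]
    rfl
  simp_rw [h1]
  exact Measurable.lintegral_prod_right
    ((hψ.comp measurable_snd).indicator (measurableSet_dist_lt r))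

/-- Tonelli's theorem for the incidence relation `dist x z < ρ` between `Ω` and its boundary. -/
theorem lintegral_boundary_ballIn [SecondCountableTopology Ω] {ν : Measure Ω} [SFinite ν]
    {H : Measure (frontier Ω)} [SFinite H] {φ : frontier Ω → ℝ≥0∞} (hφ : Measurable φ)
    {ψ : Ω → ℝ≥0∞} (hψ : Measurable ψ) (ρ : ℝ) :
    ∫⁻ z, φ z * ∫⁻ x in ballIn Ω (z : X) ρ, ψ x ∂ν ∂H =
      ∫⁻ x, ψ x * ∫⁻ z in ((↑) : frontier Ω → X) ⁻¹' Metric.ball (x : X) ρ, φ z ∂H ∂ν := by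
  set D : Set (frontier Ω × Ω) := {q | dist (q.2 : X) q.1 < ρ} with hD
  have hDm : MeasurableSet D := measurableSet_dist_lt ρ
  have hm : Measurable (D.indicator fun q => φ q.1 * ψ q.2) :=
    ((hφ.comp measurable_fst).mul (hψ.comp measurable_snd)).indicator hDm
  have h1 : ∀ z : frontier Ω, φ z * ∫⁻ x in ballIn Ω (z : X) ρ, ψ x ∂ν =
      ∫⁻ x, D.indicator (fun q => φ q.1 * ψ q.2) (z, x) ∂ν := by
    intro z
    rw [← lintegral_const_mul _ hψ, ← lintegral_indicator (measurableSet_ballIn _ _)]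
    rfl
  have h2 : ∀ x : Ω, ψ x * ∫⁻ z in ((↑) : frontier Ω → X) ⁻¹' Metric.ball (x : X) ρ, φ z ∂H =
      ∫⁻ z, D.indicator (fun q => φ q.1 * ψ q.2) (z, x) ∂H := by
    intro x
    rw [← lintegral_const_mul _ hφ, ← lintegral_indicator
      (Metric.isOpen_ball.preimage continuous_subtype_val).measurableSet]
    refine lintegral_congr fun z => ?_
    simp only [indicator, hD, mem_preimage, Metric.mem_ball, mem_ofPred_eq, dist_comm (z : X),
      mul_comm (φ z)]
  simp_rw [h1, h2]
  exact lintegral_lintegral_swap hm.aemeasurable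

end

/-! ### Averages and the codimension bound -/

section Averages

variable {Y : Type*} [MeasurableSpace Y] {ν : Measure Y} {s t : Set Y}

theorem setLAverage_le_mul_setLAverage (hst : s ⊆ t) {C : ℝ≥0} (hC : C ≠ 0)
    (h : ν t ≤ C * ν s) (f : Y → ℝ≥0∞) :
    ⨍⁻ x in s, f x ∂ν ≤ C * ⨍⁻ x in t, f x ∂ν := by
  have hC' : (C : ℝ≥0∞) ≠ 0 := by exact_mod_cast hC
  rw [setLAverage_eq, setLAverage_eq, div_eq_mul_inv, div_eq_mul_inv, mul_left_comm]
  gcongr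
  calc (ν s)⁻¹ = C * (C * ν s)⁻¹ := by
        rw [ENNReal.mul_inv (Or.inl hC') (Or.inl ENNReal.coe_ne_top), ← mul_assoc,
          ENNReal.mul_inv_cancel hC' ENNReal.coe_ne_top, one_mul]
    _ ≤ C * (ν t)⁻¹ := by gcongr

theorem isProbabilityMeasure_normalized (h0 : ν s ≠ 0) (h1 : ν s ≠ ∞) :
    IsProbabilityMeasure (((ν.restrict s) univ)⁻¹ • ν.restrict s) := by
  refine ⟨?_⟩
  rw [Measure.smul_apply, Measure.restrict_apply_univ, smul_eq_mul, ENNReal.inv_mul_cancel h0 h1]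

theorem setLAverage_enorm_sub_le (h0 : ν s ≠ 0) (h1 : ν s ≠ ∞) (u : Y → ℝ) (a b : ℝ) :
    ⨍⁻ x in s, ‖u x - b‖ₑ ∂ν ≤ (⨍⁻ x in s, ‖u x - a‖ₑ ∂ν) + ‖a - b‖ₑ := by
  have := isProbabilityMeasure_normalized h0 h1
  unfold laverage
  calc _ ≤ ∫⁻ x, (‖u x - a‖ₑ + ‖a - b‖ₑ) ∂(((ν.restrict s) univ)⁻¹ • ν.restrict s) := by
        refine lintegral_mono fun x => ?_
        have : u x - b = (u x - a) + (a - b) := by ring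
        rw [this]; exact enorm_add_le _ _
    _ = _ := by rw [lintegral_add_right _ measurable_const, lintegral_const, this.measure_univ, mul_one]

theorem enorm_setAverage_sub_le (h0 : ν s ≠ 0) (h1 : ν s ≠ ∞) {u : Y → ℝ}
    (hu : IntegrableOn u s ν) (a : ℝ) :
    ‖(⨍ x in s, u x ∂ν) - a‖ₑ ≤ ⨍⁻ x in s, ‖u x - a‖ₑ ∂ν := by
  have := isProbabilityMeasure_normalized h0 h1
  unfold average laverage
  have hu' : Integrable u (((ν.restrict s) univ)⁻¹ • ν.restrict s) :=
    hu.smul_measure (by simpa using h0)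
  have : (∫ x, u x ∂(((ν.restrict s) univ)⁻¹ • ν.restrict s)) - a =
      ∫ x, (u x - a) ∂(((ν.restrict s) univ)⁻¹ • ν.restrict s) := by
    rw [integral_sub hu' (integrable_const _), integral_const, probReal_univ, one_smul]
  rw [this]
  exact enorm_integral_le_lintegral_enorm _

theorem enorm_setAverage_rpow_le (h0 : ν s ≠ 0) (h1 : ν s ≠ ∞) {u : Y → ℝ}
    (hu : AEStronglyMeasurable u ν) {p : ℝ} (hp : 1 ≤ p) :
    ‖⨍ x in s, u x ∂ν‖ₑ ^ p ≤ (ν s)⁻¹ * ∫⁻ x in s, ‖u x‖ₑ ^ p ∂ν := by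
  have := isProbabilityMeasure_normalized h0 h1
  have hp0 : 0 < p := by linarith
  have hu' : AEStronglyMeasurable u (((ν.restrict s) univ)⁻¹ • ν.restrict s) :=
    hu.restrict.smul_measure _
  have h2 := eLpNorm'_le_eLpNorm'_of_exponent_le (f := u) one_pos hp
    (((ν.restrict s) univ)⁻¹ • ν.restrict s) hu'
  simp only [eLpNorm', ENNReal.rpow_one, div_one] at h2
  have h3 : ‖⨍ x in s, u x ∂ν‖ₑ ≤ (∫⁻ x, ‖u x‖ₑ ^ p
      ∂(((ν.restrict s) univ)⁻¹ • ν.restrict s)) ^ (1 / p) :=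
    (enorm_integral_le_lintegral_enorm _).trans h2
  calc _ ≤ _ := ENNReal.rpow_le_rpow h3 hp0.le
    _ = _ := by
      rw [← ENNReal.rpow_mul, one_div_mul_cancel hp0.ne', ENNReal.rpow_one,
        lintegral_smul_measure, Measure.restrict_apply_univ, smul_eq_mul]

end Averages

section BoundaryMeasure

variable {X : Type*} [MetricSpace X] [MeasurableSpace X] [BorelSpace X] {Ω : Set X}

omit [MeasurableSpace X] [BorelSpace X] in
theorem diam_pos_of_mem_frontier (hΩ : IsMetricDomain Ω) (hb : Bornology.IsBounded Ω) {z : X}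
    (hz : z ∈ frontier Ω) : 0 < Metric.diam Ω := by
  obtain ⟨x, hx⟩ := hΩ.2.nonempty
  have hzx : x ≠ z := by
    rintro rfl
    rw [hΩ.1.frontier_eq] at hz
    exact hz.2 hx
  have := Metric.dist_le_diam_of_mem hb.closure (subset_closure hx) (frontier_subset_closure hz)
  rw [Metric.diam_closure] at this
  exact (dist_pos.2 hzx).trans_le this

omit [MeasurableSpace X] [BorelSpace X] in
theorem infDist_frontier_pos (hΩ : IsOpen Ω) (hne : (frontier Ω).Nonempty) {x : X} (hx : x ∈ Ω) :
    0 < Metric.infDist x (frontier Ω) := by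
  refine (isClosed_frontier.notMem_iff_infDist_pos hne).1 fun h => ?_
  rw [hΩ.frontier_eq] at h
  exact h.2 hx

omit [MeasurableSpace X] [BorelSpace X] in
theorem infDist_frontier_le_diam (hb : Bornology.IsBounded Ω) (hne : (frontier Ω).Nonempty) {x : X}
    (hx : x ∈ Ω) : Metric.infDist x (frontier Ω) ≤ Metric.diam Ω := by
  obtain ⟨z, hz⟩ := hne
  refine (Metric.infDist_le_dist_of_mem hz).trans ?_
  rw [← Metric.diam_closure]
  exact Metric.dist_le_diam_of_mem hb.closure (subset_closure hx) (frontier_subset_closure hz)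

/-- The upper codimension bound, extended to all radii: beyond the diameter of `Ω` the power of the
radius is replaced by that of the diameter, as the balls no longer grow. -/
def HasCodimUpperBound (ν : Measure Ω) (H : Measure (frontier Ω)) (θ : ℝ) (C : ℝ≥0) : Prop :=
  ∀ (z : frontier Ω) (r : ℝ), 0 < r →
    H (Metric.ball z r) ≤
      C * (ν (ballIn Ω (z : X) r) / ENNReal.ofReal (min r (Metric.diam Ω) ^ θ))

variable {μ : Measure X} {H : Measure (frontier Ω)} {θ : ℝ}

omit [MeasurableSpace X] [BorelSpace X] in
theorem ball_boundary_eq_univ (hb : Bornology.IsBounded Ω) (z : frontier Ω) {r : ℝ}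
    (hr : Metric.diam Ω < r) : Metric.ball z r = univ := by
  refine eq_univ_of_forall fun w => ?_
  have := Metric.dist_le_diam_of_mem hb.closure (frontier_subset_closure w.2)
    (frontier_subset_closure z.2)
  rw [Metric.diam_closure] at this
  exact lt_of_le_of_lt this hr

theorem IsCodimRegular.exists_upperBound (h : IsCodimRegular μ Ω H θ) (hΩ : IsMetricDomain Ω)
    (hb : Bornology.IsBounded Ω) (hθ : 0 < θ) :
    ∃ C : ℝ≥0, HasCodimUpperBound (measureOn μ Ω) H θ C := by
  obtain ⟨_, C, _, _, hC⟩ := h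
  refine ⟨C, fun z r hr => ?_⟩
  have hR := diam_pos_of_mem_frontier hΩ hb z.2
  have key : ∀ s, 0 < s → s ≤ r → min r (Metric.diam Ω) ≤ s →
      C * (μ (Metric.ball (z : X) s ∩ Ω) / ENNReal.ofReal (s ^ θ)) ≤
      C * (measureOn μ Ω (ballIn Ω (z : X) r) /
        ENNReal.ofReal (min r (Metric.diam Ω) ^ θ)) := by
    intro s hs hsr hms
    rw [← measureOn_ballIn hΩ.1]
    have h1 : measureOn μ Ω (ballIn Ω (z : X) s) ≤ measureOn μ Ω (ballIn Ω (z : X) r) :=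
      measure_mono (ballIn_subset (by simpa using hsr))
    have h2 : min r (Metric.diam Ω) ^ θ ≤ s ^ θ :=
      Real.rpow_le_rpow (le_min hr.le hR.le) hms hθ.le
    gcongr
  rcases lt_or_ge r (2 * Metric.diam Ω) with h1 | h1
  · exact (hC z r hr h1).trans (key r hr le_rfl (min_le_left _ _))
  · -- a ball of radius `3 / 2 * diam Ω` is already the whole boundary
    have h2 := hC z (3 / 2 * Metric.diam Ω) (by positivity) (by linarith)
    rw [ball_boundary_eq_univ hb z (by linarith)] at h2
    exact (measure_mono (subset_univ _)).trans (h2.trans (key _ (by positivity) (by linarith)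
      ((min_le_right _ _).trans (by linarith))))

omit [BorelSpace X] in
theorem HasCodimUpperBound.isFiniteMeasure {ν : Measure Ω} [IsFiniteMeasure ν] {C : ℝ≥0}
    (h : HasCodimUpperBound ν H θ C) (hΩ : IsMetricDomain Ω) (hb : Bornology.IsBounded Ω) :
    IsFiniteMeasure H := by
  rcases isEmpty_or_nonempty (frontier Ω) with he | ⟨⟨z⟩⟩
  · have := H.eq_zero_of_isEmpty
    rw [this]; infer_instance
  · have hR := diam_pos_of_mem_frontier hΩ hb z.2
    have h1 := h z (Metric.diam Ω + 1) (by linarith)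
    rw [ball_boundary_eq_univ hb z (by linarith)] at h1
    refine ⟨h1.trans_lt (ENNReal.mul_lt_top ENNReal.coe_lt_top (ENNReal.div_lt_top
      (measure_ne_top _ _) ?_))⟩
    rw [min_eq_right (by linarith)]
    simpa using Real.rpow_pos_of_pos hR θ

/-- The kernel of the operator that maps the energy of a gradient in `Ω` to the energy of the
oscillation at scale `r` on the boundary is bounded, and supported near the boundary. -/
theorem HasCodimUpperBound.exists_lintegral_inv_le {ν : Measure Ω} [IsFiniteMeasure ν] {C c : ℝ≥0}
    (h : HasCodimUpperBound ν H θ C) (hd : IsClosureDoubling ν c) (hθ : 0 < θ)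
    {M : ℝ} (hM : 1 ≤ M) :
    ∃ K : ℝ≥0, ∀ r : ℝ, 0 < r → r ≤ Metric.diam Ω → ∀ x : Ω,
      ENNReal.ofReal (r ^ θ) * ∫⁻ z in ((↑) : frontier Ω → X) ⁻¹' Metric.ball (x : X) (M * r),
        (ν (ballIn Ω (z : X) r))⁻¹ ∂H ≤
      {x : Ω | Metric.infDist (x : X) (frontier Ω) < M * r}.indicator (fun _ => (K : ℝ≥0∞)) x := by
  obtain ⟨D, hD1, hD⟩ := hd.exists_le (4 * M)
  refine ⟨D * C, fun r hr hrR x => ?_⟩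
  set S := ((↑) : frontier Ω → X) ⁻¹' Metric.ball (x : X) (M * r) with hS
  rcases S.eq_empty_or_nonempty with he | ⟨z₀, hz₀⟩
  · simp [he]
  have hz₀' : dist (z₀ : X) x < M * r := hz₀
  have hx : x ∈ {x : Ω | Metric.infDist (x : X) (frontier Ω) < M * r} := by
    refine (Metric.infDist_le_dist_of_mem z₀.2).trans_lt ?_
    rwa [dist_comm]
  rw [indicator_of_mem hx]
  have hMr : r ≤ M * r := le_mul_of_one_le_left hr.le hM
  set A := ν (ballIn Ω (z₀ : X) (2 * (M * r))) with hA
  have hA0 : A ≠ 0 := (hd.pos _ (frontier_subset_closure z₀.2) _ (by linarith)).ne'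
  have hAt : A ≠ ∞ := measure_ne_top _ _
  have h1 : ∀ z ∈ S, (ν (ballIn Ω (z : X) r))⁻¹ ≤ D * A⁻¹ := by
    intro z hz
    have hz' : dist (z : X) x < M * r := hz
    have hzz : dist (z₀ : X) z < 2 * (M * r) :=
      (dist_triangle_right (z₀ : X) z x).trans_lt (by linarith)
    have h2 := hD z (frontier_subset_closure z.2) z₀ r hr (2 * (M * r)) (by linarith)
    have hD0 : (D : ℝ≥0∞) ≠ 0 := by exact_mod_cast (zero_lt_one.trans_le hD1).ne'
    calc (ν (ballIn Ω (z : X) r))⁻¹ = D * (D * ν (ballIn Ω (z : X) r))⁻¹ := by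
          rw [ENNReal.mul_inv (Or.inl hD0) (Or.inl ENNReal.coe_ne_top), ← mul_assoc,
            ENNReal.mul_inv_cancel hD0 ENNReal.coe_ne_top, one_mul]
      _ ≤ D * A⁻¹ := by gcongr
  have hSm : MeasurableSet S := (Metric.isOpen_ball.preimage continuous_subtype_val).measurableSet
  -- all the balls involved are comparable to the one of measure `A` about `z₀`
  have h3 : H S ≤ C * (A / ENNReal.ofReal (r ^ θ)) := by
    calc H S ≤ H (Metric.ball z₀ (2 * (M * r))) := by
          refine measure_mono fun z hz => ?_
          have hz' : dist (z : X) x < M * r := hz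
          exact (dist_triangle_right (z : X) z₀ x).trans_lt (by linarith)
      _ ≤ C * (A / ENNReal.ofReal (min (2 * (M * r)) (Metric.diam Ω) ^ θ)) :=
          h z₀ _ (by linarith)
      _ ≤ _ := by
          have : r ^ θ ≤ min (2 * (M * r)) (Metric.diam Ω) ^ θ :=
            Real.rpow_le_rpow hr.le (le_min (by linarith) hrR) hθ.le
          gcongr
  have hrθ : ENNReal.ofReal (r ^ θ) ≠ 0 := by simpa using Real.rpow_pos_of_pos hr θ
  calc ENNReal.ofReal (r ^ θ) * ∫⁻ z in S, (ν (ballIn Ω (z : X) r))⁻¹ ∂H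
      ≤ ENNReal.ofReal (r ^ θ) * ∫⁻ z in S, D * A⁻¹ ∂H := by
        exact mul_le_mul_right (setLIntegral_mono' hSm h1) _
    _ = ENNReal.ofReal (r ^ θ) * (D * A⁻¹ * H S) := by rw [setLIntegral_const]
    _ ≤ ENNReal.ofReal (r ^ θ) * (D * A⁻¹ * (C * (A / ENNReal.ofReal (r ^ θ)))) := by gcongr
    _ = (D * C) * (A⁻¹ * A) * (ENNReal.ofReal (r ^ θ) * (ENNReal.ofReal (r ^ θ))⁻¹) := by
        rw [div_eq_mul_inv]; ring
    _ = _ := by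
        rw [ENNReal.inv_mul_cancel hA0 hAt, ENNReal.mul_inv_cancel hrθ ENNReal.ofReal_ne_top]
        simp

end BoundaryMeasure

/-! ### Traces from summable oscillations -/

section Trace

variable {X : Type*} [MetricSpace X] [MeasurableSpace X] [BorelSpace X] {Ω : Set X}

omit [BorelSpace X] in
/-- The Poincaré inequality transferred to balls centred in the closure of `Ω`. -/
theorem AdmitsPoincare.exists_closure {ν : Measure Ω} [IsFiniteMeasure ν] {c : ℝ≥0} {θ : ℝ}
    (hθ : 1 ≤ θ) (hP : AdmitsPoincare θ ν) (hd : IsClosureDoubling ν c) :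
    ∃ (C : ℝ≥0) (M : ℝ), 1 ≤ M ∧ ∀ (u : Ω → ℝ) (g : Ω → ℝ≥0∞), Integrable u ν →
      IsUpperGradient u g → (∀ᵐ x ∂ν, g x < ∞) → ∀ z ∈ closure Ω, ∀ r : ℝ, 0 < r →
      ∃ m : ℝ, ⨍⁻ x in ballIn Ω z r, ‖u x - m‖ₑ ∂ν ≤ C * (ENNReal.ofReal r *
        ((ν (ballIn Ω z r))⁻¹ * ∫⁻ x in ballIn Ω z (M * r), g x ^ θ ∂ν) ^ (1 / θ)) := by
  obtain ⟨C, lam, hC, hlam, hP⟩ := hP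
  obtain ⟨D, hD1, hD⟩ := hd.exists_le 4
  -- `B(z, r)` lies in a ball of radius `2 r` centred at a point of `Ω` near `z`
  refine ⟨D * (C * 2).toNNReal, 3 * lam, by linarith, fun u g hu hg hgf z hz r hr => ?_⟩
  obtain ⟨x, hx, hxz⟩ := Metric.mem_closure_iff.1 hz r hr
  set B : Set Ω := Metric.ball (⟨x, hx⟩ : Ω) (2 * r) with hB
  have hBz : B ⊆ ballIn Ω z (4 * r) := by
    intro y hy
    have h1 : dist (y : X) x < 2 * r := hy
    have : dist (y : X) z < 4 * r := by
      have := dist_triangle (y : X) x z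
      rw [dist_comm x z] at this
      linarith
    exact this
  have hzB : ballIn Ω z r ⊆ B := by
    intro y hy
    have h1 : dist (y : X) z < r := hy
    have : dist (y : X) x < 2 * r := by
      have := dist_triangle (y : X) z x
      linarith
    exact this
  have hz0 : ν (ballIn Ω z r) ≠ 0 := (hd.pos z hz r hr).ne'
  have hBD : ν B ≤ D * ν (ballIn Ω z r) :=
    (measure_mono hBz).trans (hD z hz z r hr (4 * r) (by simp))
  refine ⟨⨍ a in B, u a ∂ν, ?_⟩
  have h1 := hP u g hu.locallyIntegrable hg hgf ⟨x, hx⟩ (2 * r) (by linarith)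
  have h2 : ⨍⁻ y in Metric.ball (⟨x, hx⟩ : Ω) (lam * (2 * r)), g y ^ θ ∂ν ≤
      (ν (ballIn Ω z r))⁻¹ * ∫⁻ x in ballIn Ω z (3 * lam * r), g x ^ θ ∂ν := by
    rw [setLAverage_eq, div_eq_mul_inv, mul_comm]
    have h3 : Metric.ball (⟨x, hx⟩ : Ω) (lam * (2 * r)) ⊆ ballIn Ω z (3 * lam * r) := by
      intro y hy
      have h1 : dist (y : X) x < lam * (2 * r) := hy
      have : dist (y : X) z < 3 * lam * r := by
        have := dist_triangle (y : X) x z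
        rw [dist_comm x z] at this
        nlinarith
      exact this
    have h4 : ballIn Ω z r ⊆ Metric.ball (⟨x, hx⟩ : Ω) (lam * (2 * r)) :=
      hzB.trans (Metric.ball_subset_ball (by nlinarith))
    gcongr
  have hD0 : D ≠ 0 := (zero_lt_one.trans_le hD1).ne'
  calc _ ≤ D * ⨍⁻ x in B, ‖u x - ⨍ a in B, u a ∂ν‖ₑ ∂ν :=
        setLAverage_le_mul_setLAverage hzB hD0 hBD _
    _ ≤ D * (ENNReal.ofReal (C * (2 * r)) *
        ((ν (ballIn Ω z r))⁻¹ * ∫⁻ x in ballIn Ω z (3 * lam * r), g x ^ θ ∂ν) ^ (1 / θ)) := by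
        refine mul_le_mul_right (h1.trans (mul_le_mul_right ?_ _)) _
        exact ENNReal.rpow_le_rpow h2 (by positivity)
    _ = _ := by
        rw [← mul_assoc C, ENNReal.ofReal_mul (by positivity), ENNReal.coe_mul, ENNReal.ofReal]
        ring

theorem exists_between_pow_half {R r : ℝ} (hr : 0 < r) (hrR : r ≤ R) :
    ∃ k : ℕ, R / 2 ^ (k + 1) < r ∧ r ≤ R / 2 ^ k := by
  have hR : 0 < R := hr.trans_le hrR
  obtain ⟨k, hk1, hk2⟩ := exists_nat_pow_near (x := R / r) (y := 2)
    ((one_le_div hr).2 hrR) one_lt_two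
  refine ⟨k, ?_, ?_⟩
  · rw [div_lt_iff₀ hr] at hk2
    rw [div_lt_iff₀ (by positivity)]
    linarith
  · rw [le_div_iff₀ hr] at hk1
    rw [le_div_iff₀ (by positivity)]
    linarith

omit [BorelSpace X] in
/-- If the mean oscillations of `u` over the dyadic balls about `z` are summable, then `u` has a
trace at `z`, the limit of the means over these balls. -/
theorem exists_hasTraceAt_of_tsum_ne_top {μ : Measure X} [IsFiniteMeasure (measureOn μ Ω)]
    {c : ℝ≥0} (hc : 1 ≤ c)
    (hd : IsClosureDoubling (measureOn μ Ω) c) {u : Ω → ℝ} (hu : Integrable u (measureOn μ Ω))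
    {z : X} (hz : z ∈ closure Ω) {R : ℝ} (hR : 0 < R) {G : ℕ → ℝ≥0∞}
    (hG : ∀ k : ℕ, ∃ m : ℝ,
      ⨍⁻ x in ballIn Ω z (R / 2 ^ k), ‖u x - m‖ₑ ∂(measureOn μ Ω) ≤ G k)
    (hsum : ∑' k, G k ≠ ∞) :
    ∃ l : ℝ, Tendsto (fun k : ℕ => ⨍ x in ballIn Ω z (R / 2 ^ k), u x ∂(measureOn μ Ω)) atTop (𝓝 l) ∧
      ‖l‖ₑ ≤ ‖⨍ x in ballIn Ω z R, u x ∂(measureOn μ Ω)‖ₑ + (1 + c) * ∑' k, G k ∧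
      HasTraceAt μ Ω u z l := by
  set ν := measureOn μ Ω with hν
  have hc0 : c ≠ 0 := (zero_lt_one.trans_le hc).ne'
  choose m hm using hG
  have hRk : ∀ k : ℕ, 0 < R / 2 ^ k := fun k => by positivity
  have hb0 : ∀ r, 0 < r → ν (ballIn Ω z r) ≠ 0 := fun r hr => (hd.pos z hz _ hr).ne'
  have hbt : ∀ r, ν (ballIn Ω z r) ≠ ∞ := fun r => measure_ne_top _ _
  set a : ℕ → ℝ := fun k => ⨍ x in ballIn Ω z (R / 2 ^ k), u x ∂ν with ha
  have ham : ∀ k, ‖a k - m k‖ₑ ≤ G k := fun k =>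
    (enorm_setAverage_sub_le (hb0 _ (hRk k)) (hbt _) hu.integrableOn _).trans (hm k)
  have hhalf : ∀ k : ℕ, 2 * (R / 2 ^ (k + 1)) = R / 2 ^ k := fun k => by
    rw [pow_succ]; field_simp
  have hdbl : ∀ (k : ℕ) (r : ℝ), R / 2 ^ (k + 1) < r → r ≤ R / 2 ^ k → ∀ f : Ω → ℝ≥0∞,
      ⨍⁻ x in ballIn Ω z r, f x ∂ν ≤ c * ⨍⁻ x in ballIn Ω z (R / 2 ^ k), f x ∂ν := by
    intro k r hr1 hr2 f
    have hr : 0 < r := (hRk (k + 1)).trans hr1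
    refine setLAverage_le_mul_setLAverage (ballIn_subset (by simpa using hr2)) hc0 ?_ f
    refine le_trans (measure_mono (ballIn_subset ?_)) (hd.le z hz r hr)
    rw [dist_self, zero_add, ← hhalf k]; linarith
  have hdbl' : ∀ (k : ℕ) (f : Ω → ℝ≥0∞), ⨍⁻ x in ballIn Ω z (R / 2 ^ (k + 1)), f x ∂ν ≤
      c * ⨍⁻ x in ballIn Ω z (R / 2 ^ k), f x ∂ν := by
    intro k f
    refine setLAverage_le_mul_setLAverage (ballIn_subset ?_) hc0 ?_ f
    · rw [dist_self, zero_add, ← hhalf k]; linarith [hRk (k + 1)]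
    · rw [← hhalf k]; exact hd.le z hz _ (hRk _)
  have hstep : ∀ k, edist (a k) (a (k + 1)) ≤ (1 + c) * G k := by
    intro k
    have h1 : ‖a (k + 1) - m k‖ₑ ≤ c * G k :=
      (enorm_setAverage_sub_le (hb0 _ (hRk _)) (hbt _) hu.integrableOn _).trans
        ((hdbl' k _).trans (mul_le_mul_right (hm k) _))
    calc edist (a k) (a (k + 1)) ≤ edist (a k) (m k) + edist (a (k + 1)) (m k) :=
          edist_triangle_right _ _ _
      _ ≤ G k + c * G k := by
          rw [edist_eq_enorm_sub, edist_eq_enorm_sub]; exact add_le_add (ham k) h1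
      _ = _ := by ring
  have hsum' : ∑' k, (1 + c : ℝ≥0∞) * G k ≠ ∞ := by
    rw [ENNReal.tsum_mul_left]
    exact ENNReal.mul_ne_top (by simp) hsum
  obtain ⟨l, hl⟩ := cauchySeq_tendsto_of_complete
    (cauchySeq_of_edist_le_of_tsum_ne_top _ hstep hsum')
  have htail : ∀ n, ‖a n - l‖ₑ ≤ (1 + c) * ∑' k, G (n + k) := by
    intro n
    rw [← edist_eq_enorm_sub, ← ENNReal.tsum_mul_left]
    exact edist_le_tsum_of_edist_le_of_tendsto _ hstep hl n
  refine ⟨l, hl, ?_, ?_⟩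
  · have h0 := htail 0
    simp only [zero_add] at h0
    have h1 : a 0 = ⨍ x in ballIn Ω z R, u x ∂ν := by simp [ha]
    rw [← h1]
    calc ‖l‖ₑ = ‖a 0 + -(a 0 - l)‖ₑ := by congr 1; ring
      _ ≤ ‖a 0‖ₑ + ‖-(a 0 - l)‖ₑ := enorm_add_le _ _
      _ ≤ _ := by rw [enorm_neg]; gcongr
  · set e : ℕ → ℝ≥0∞ := fun n => c * (2 + (1 + c)) * ∑' k, G (n + k) with he
    have hbound : ∀ (n : ℕ) (r : ℝ), R / 2 ^ (n + 1) < r → r ≤ R / 2 ^ n →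
        ⨍⁻ x in ballIn Ω z r, ‖u x - l‖ₑ ∂ν ≤ e n := by
      intro n r h1 h2
      have hGn : G n ≤ ∑' k, G (n + k) := ENNReal.le_tsum (f := fun k => G (n + k)) 0
      calc _ ≤ c * ⨍⁻ x in ballIn Ω z (R / 2 ^ n), ‖u x - l‖ₑ ∂ν := hdbl n r h1 h2 _
        _ ≤ c * ((⨍⁻ x in ballIn Ω z (R / 2 ^ n), ‖u x - m n‖ₑ ∂ν) + ‖m n - l‖ₑ) := by
            gcongr
            exact setLAverage_enorm_sub_le (hb0 _ (hRk n)) (hbt _) u (m n) l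
        _ ≤ c * (G n + (G n + (1 + c) * ∑' k, G (n + k))) := by
            gcongr
            · exact hm n
            · calc ‖m n - l‖ₑ = ‖-(a n - m n) + (a n - l)‖ₑ := by congr 1; ring
                _ ≤ ‖-(a n - m n)‖ₑ + ‖a n - l‖ₑ := enorm_add_le _ _
                _ ≤ _ := by rw [enorm_neg]; exact add_le_add (ham n) (htail n)
        _ ≤ c * (∑' k, G (n + k) + (∑' k, G (n + k) + (1 + c) * ∑' k, G (n + k))) := by gcongr
        _ = e n := by rw [he]; ring
    have he0 : Tendsto e atTop (𝓝 0) := by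
      have h1 : Tendsto (fun n => ∑' k, G (n + k)) atTop (𝓝 0) := by
        simpa only [add_comm] using ENNReal.tendsto_sum_nat_add G hsum
      have := ENNReal.Tendsto.const_mul (a := (c * (2 + (1 + c)) : ℝ≥0∞)) h1
        (Or.inr (ENNReal.mul_ne_top ENNReal.coe_ne_top (by simp)))
      simpa using this
    rw [HasTraceAt, ENNReal.tendsto_nhds_zero]
    intro δ hδ
    obtain ⟨N, hN⟩ := eventually_atTop.1 (ENNReal.tendsto_nhds_zero.1 he0 δ hδ)
    have hev : ∀ᶠ r in 𝓝[>] (0 : ℝ), r ∈ Ioo 0 (R / 2 ^ N) := Ioo_mem_nhdsGT (hRk N)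
    filter_upwards [hev] with r hr
    obtain ⟨n, hn1, hn2⟩ := exists_between_pow_half (R := R) hr.1 (hr.2.le.trans
      (div_le_self hR.le (one_le_pow₀ one_le_two)))
    refine (hbound n r hn1 hn2).trans (hN n ?_)
    by_contra! hlt
    have : R / 2 ^ N ≤ R / 2 ^ (n + 1) := by
      gcongr
      · norm_num
      · exact hlt
    linarith [hr.2]

omit [BorelSpace X] in
/-- Measurability of `u` is needed, as the trace is defined by lower integrals. -/
theorem HasTraceAt.unique {μ : Measure X} [IsFiniteMeasure (measureOn μ Ω)] {c : ℝ≥0}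
    (hd : IsClosureDoubling (measureOn μ Ω) c) {u : Ω → ℝ}
    (hu : AEStronglyMeasurable u (measureOn μ Ω)) {z : X} (hz : z ∈ closure Ω) {a b : ℝ}
    (ha : HasTraceAt μ Ω u z a) (hb : HasTraceAt μ Ω u z b) : a = b := by
  have h1 : ∀ᶠ r in 𝓝[>] (0 : ℝ), ‖a - b‖ₑ ≤
      (⨍⁻ x in ballIn Ω z r, ‖u x - a‖ₑ ∂(measureOn μ Ω)) +
        ⨍⁻ x in ballIn Ω z r, ‖u x - b‖ₑ ∂(measureOn μ Ω) := by
    filter_upwards [self_mem_nhdsWithin] with r hr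
    have h0 := (hd.pos z hz r hr).ne'
    have := isProbabilityMeasure_normalized h0 (measure_ne_top _ _)
    unfold laverage
    rw [← lintegral_add_left' (f := fun x => ‖u x - a‖ₑ)]
    · calc ‖a - b‖ₑ = ∫⁻ _, ‖a - b‖ₑ ∂((((measureOn μ Ω).restrict (ballIn Ω z r)) univ)⁻¹ •
            (measureOn μ Ω).restrict (ballIn Ω z r)) := by
            rw [lintegral_const, this.measure_univ, mul_one]
        _ ≤ _ := lintegral_mono fun x => by
            calc ‖a - b‖ₑ = ‖-(u x - a) + (u x - b)‖ₑ := by congr 1; ring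
              _ ≤ ‖-(u x - a)‖ₑ + ‖u x - b‖ₑ := enorm_add_le _ _
              _ = _ := by rw [enorm_neg]
    · exact ((hu.sub aestronglyMeasurable_const).enorm.restrict).smul_measure _
  have h2 := ha.add hb
  rw [add_zero] at h2
  have := le_of_tendsto_of_tendsto tendsto_const_nhds h2 h1
  simpa [sub_eq_zero] using this

end Trace

/-! ### The weighted energy controls the oscillations -/

section TraceEstimate

variable {X : Type*} [MetricSpace X] [MeasurableSpace X] [BorelSpace X] {Ω : Set X}

theorem measurable_logWeight (a : ℝ) : Measurable fun x : Ω => logWeight Ω a (x : X) := by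
  unfold logWeight
  refine Measurable.pow_const (Real.measurable_log.comp (measurable_const.div ?_)) _
  exact ((Metric.continuous_infDist_pt _).comp continuous_subtype_val).measurable

omit [MeasurableSpace X] [BorelSpace X] in
theorem log_two_le_log_diam_div (hΩ : IsMetricDomain Ω) (hb : Bornology.IsBounded Ω)
    (hne : (frontier Ω).Nonempty) (x : Ω) :
    Real.log 2 ≤ Real.log (2 * Metric.diam Ω / Metric.infDist (x : X) (frontier Ω)) := by
  have h1 := infDist_frontier_pos hΩ.1 hne x.2
  have h2 := infDist_frontier_le_diam hb hne x.2
  refine Real.log_le_log (by norm_num) ?_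
  rw [le_div_iff₀ h1]
  linarith

omit [MeasurableSpace X] [BorelSpace X] in
/-- The weight `L ^ (θ + ε)` dominates the sum of the weights `(k + 1) ^ (θ - 1 + ε)` over the
dyadic scales that are larger than the distance to the boundary. -/
theorem exists_tsum_scales_le_logWeight (hΩ : IsMetricDomain Ω) (hb : Bornology.IsBounded Ω)
    (hne : (frontier Ω).Nonempty) {M a : ℝ} (hM : 1 ≤ M) (ha : 0 ≤ a) :
    ∃ K : ℝ≥0, ∀ x : Ω, (∑' k : ℕ, ENNReal.ofReal (((k : ℝ) + 1) ^ a) *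
      {x : Ω | Metric.infDist (x : X) (frontier Ω) < M * (Metric.diam Ω / 2 ^ k)}.indicator
        (fun _ => (1 : ℝ≥0∞)) x) ≤ K * ENNReal.ofReal (logWeight Ω (1 + a) x) := by
  have hl2 : 0 < Real.log 2 := Real.log_pos one_lt_two
  have hlM : 0 ≤ Real.log M := Real.log_nonneg hM
  set A : ℝ := Real.log M / Real.log 2 ^ 2 + 2 / Real.log 2 with hA
  have hA0 : 0 ≤ A := by positivity
  refine ⟨(A ^ (1 + a)).toNNReal, fun x => ?_⟩
  set δ := Metric.infDist (x : X) (frontier Ω) with hδ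
  have hδ0 : 0 < δ := infDist_frontier_pos hΩ.1 hne x.2
  set l := Real.log (2 * Metric.diam Ω / δ) with hl
  have hll : Real.log 2 ≤ l := log_two_le_log_diam_div hΩ hb hne x
  have hl0 : 0 < l := hl2.trans_le hll
  have hR : 0 < Metric.diam Ω := diam_pos_of_mem_frontier hΩ hb hne.choose_spec
  -- a scale `k` that sees `x` has `k + 1 ≤ A l`, so that at most `A l` weights of size at most
  -- `(A l) ^ a` are added
  have hscale : ∀ k : ℕ, δ < M * (Metric.diam Ω / 2 ^ k) → (k : ℝ) + 1 ≤ A * l := by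
    intro k hk
    have h1 : (2 : ℝ) ^ k ≤ M * (2 * Metric.diam Ω / δ) := by
      rw [← mul_div_assoc, lt_div_iff₀ (by positivity)] at hk
      rw [← mul_div_assoc, le_div_iff₀ hδ0]
      nlinarith [mul_pos (zero_lt_one.trans_le hM) hR]
    have h2 : k * Real.log 2 ≤ Real.log M + l := by
      rw [← Real.log_pow, ← Real.log_mul (by positivity) (by positivity)]
      exact Real.log_le_log (by positivity) h1
    have h3 : (k : ℝ) + 1 ≤ Real.log M / Real.log 2 + l / Real.log 2 + 1 := by
      rw [← add_div]
      gcongr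
      rwa [le_div_iff₀ hl2]
    have h4 : Real.log M / Real.log 2 ≤ Real.log M / Real.log 2 ^ 2 * l := by
      rw [pow_two, ← div_div, div_mul_eq_mul_div, le_div_iff₀ hl2]
      gcongr
    have h5 : 1 ≤ l / Real.log 2 := (one_le_div hl2).2 hll
    calc (k : ℝ) + 1 ≤ Real.log M / Real.log 2 ^ 2 * l + l / Real.log 2 + l / Real.log 2 := by
          linarith
      _ = A * l := by rw [hA]; ring
  set n := ⌊A * l⌋₊ with hn
  have hAl : 0 ≤ A * l := by positivity
  rw [tsum_eq_sum (s := Finset.range n)]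
  · calc _ ≤ ∑ k ∈ Finset.range n, ENNReal.ofReal ((A * l) ^ a) := by
          refine Finset.sum_le_sum fun k hk => ?_
          refine (mul_le_mul_right (indicator_le_self' (fun _ _ => zero_le_one) x) _).trans ?_
          rw [mul_one]
          have : (k : ℝ) + 1 ≤ n := by exact_mod_cast Finset.mem_range.1 hk
          exact ENNReal.ofReal_le_ofReal (Real.rpow_le_rpow (by positivity)
            (this.trans (Nat.floor_le hAl)) ha)
      _ = ENNReal.ofReal (n * (A * l) ^ a) := by
          rw [Finset.sum_const, Finset.card_range, nsmul_eq_mul,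
            ENNReal.ofReal_mul (by positivity), ENNReal.ofReal_natCast]
      _ ≤ ENNReal.ofReal (A ^ (1 + a) * l ^ (1 + a)) := by
          refine ENNReal.ofReal_le_ofReal ?_
          rw [← Real.mul_rpow hA0 hl0.le]
          rcases hAl.eq_or_lt with h0 | h0
          · have : n = 0 := by rw [hn, ← h0]; simp
            rw [this, Nat.cast_zero, zero_mul]
            positivity
          · rw [Real.rpow_add h0, Real.rpow_one]
            gcongr
            exact Nat.floor_le hAl
      _ = _ := by rw [ENNReal.ofReal_mul (by positivity)]; rfl
  · intro k hk
    have : x ∉ {x : Ω | Metric.infDist (x : X) (frontier Ω) < M * (Metric.diam Ω / 2 ^ k)} := by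
      intro h
      have h1 := hscale k h
      have : k + 1 ≤ n := Nat.le_floor (by exact_mod_cast h1)
      exact hk (Finset.mem_range.2 this)
    rw [indicator_of_notMem this, mul_zero]

variable {μ : Measure X} {H : Measure (frontier Ω)} {θ : ℝ}

theorem aestronglyMeasurable_setAverage_ballIn {ν : Measure Ω} [IsFiniteMeasure ν] {c : ℝ≥0}
    (hd : IsClosureDoubling ν c) [SFinite H] {u : Ω → ℝ} (hu : AEStronglyMeasurable u ν) (r : ℝ) :
    AEStronglyMeasurable (fun z : frontier Ω => ⨍ x in ballIn Ω (z : X) r, u x ∂ν) H := by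
  have := hd.secondCountableTopology
  have h1 : (fun z : frontier Ω => ⨍ x in ballIn Ω (z : X) r, u x ∂ν) = fun z : frontier Ω =>
      (ν (ballIn Ω (z : X) r)).toReal⁻¹ * ∫ x, ({q : frontier Ω × Ω | dist (q.2 : X) q.1 < r}.indicator
        (fun q => u q.2)) (z, x) ∂ν := by
    ext z
    rw [setAverage_eq, smul_eq_mul, Measure.real, ← integral_indicator (measurableSet_ballIn _ _)]
    rfl
  rw [h1]
  refine AEStronglyMeasurable.mul ?_ ?_
  · exact (measurable_measure_ballIn ν r).ennreal_toReal.inv.aestronglyMeasurable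
  · refine AEStronglyMeasurable.integral_prod_right' ?_
    exact AEStronglyMeasurable.indicator (hu.comp_snd) (measurableSet_dist_lt r)

/-- The `L^θ` norm of the sum of the oscillations over the dyadic scales is controlled by the
weighted energy: Hölder's inequality for the sum over scales, Tonelli's theorem, and the
codimension bound. -/
theorem HasCodimUpperBound.exists_lintegral_tsum_oscillation_le {ν : Measure Ω} [IsFiniteMeasure ν]
    {C c : ℝ≥0} (h : HasCodimUpperBound ν H θ C) (hd : IsClosureDoubling ν c)
    (hΩ : IsMetricDomain Ω) (hb : Bornology.IsBounded Ω) (hne : (frontier Ω).Nonempty)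
    (hθ : 1 ≤ θ) {M : ℝ} (hM : 1 ≤ M) [SFinite H] {ε : ℝ} (hε : 0 < ε) :
    ∃ K : ℝ≥0, ∀ g : Ω → ℝ≥0∞, Measurable g →
      ∫⁻ z : frontier Ω, (∑' k : ℕ, ENNReal.ofReal (Metric.diam Ω / 2 ^ k) *
        ((ν (ballIn Ω (z : X) (Metric.diam Ω / 2 ^ k)))⁻¹ *
          ∫⁻ x in ballIn Ω (z : X) (M * (Metric.diam Ω / 2 ^ k)), g x ^ θ ∂ν) ^ (1 / θ)) ^ θ ∂H ≤
      K * ∫⁻ x, g x ^ θ ∂(ν.withDensity fun x => ENNReal.ofReal (logWeight Ω (θ + ε) (x : X))) := by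
  have := hd.secondCountableTopology
  have hθ0 : 0 < θ := by linarith
  have hR : 0 < Metric.diam Ω := diam_pos_of_mem_frontier hΩ hb hne.choose_spec
  obtain ⟨K1, hK1⟩ := ENNReal.exists_tsum_rpow_le_tsum_weight hθ hε
  obtain ⟨K2, hK2⟩ := h.exists_lintegral_inv_le hd hθ0 hM
  obtain ⟨K3, hK3⟩ := exists_tsum_scales_le_logWeight hΩ hb hne hM
    (show 0 ≤ θ - 1 + ε by linarith)
  refine ⟨K1 * (K2 * K3), fun g hg => ?_⟩
  set R := Metric.diam Ω with hRdef
  set w : ℕ → ℝ≥0∞ := fun k => ENNReal.ofReal (((k : ℝ) + 1) ^ (θ - 1 + ε)) with hw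
  set N : ℕ → Set Ω := fun k => {x : Ω | Metric.infDist (x : X) (frontier Ω) < M * (R / 2 ^ k)}
    with hN
  have hNm : ∀ k, MeasurableSet (N k) := fun k =>
    (isOpen_lt ((Metric.continuous_infDist_pt _).comp continuous_subtype_val)
      continuous_const).measurableSet
  have hgm : Measurable fun x => g x ^ θ := hg.pow_const θ
  have hI : ∀ k : ℕ, Measurable fun z : frontier Ω =>
      ∫⁻ x in ballIn Ω (z : X) (M * (R / 2 ^ k)), g x ^ θ ∂ν :=
    fun k => measurable_setLIntegral_ballIn ν _ hgm
  have hB : ∀ k : ℕ, Measurable fun z : frontier Ω => (ν (ballIn Ω (z : X) (R / 2 ^ k)))⁻¹ :=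
    fun k => (measurable_measure_ballIn ν _).inv
  -- Tonelli's theorem and the codimension bound at a single scale
  have hone : ∀ k, ∫⁻ z : frontier Ω, w k * (ENNReal.ofReal (R / 2 ^ k) *
      ((ν (ballIn Ω (z : X) (R / 2 ^ k)))⁻¹ *
        ∫⁻ x in ballIn Ω (z : X) (M * (R / 2 ^ k)), g x ^ θ ∂ν) ^ (1 / θ)) ^ θ ∂H ≤
      ∫⁻ x, g x ^ θ * (K2 * (w k * (N k).indicator (fun _ => 1) x)) ∂ν := by
    intro k
    have hr : 0 < R / 2 ^ k := by positivity
    calc _ = w k * (ENNReal.ofReal ((R / 2 ^ k) ^ θ) * ∫⁻ z : frontier Ω,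
          (ν (ballIn Ω (z : X) (R / 2 ^ k)))⁻¹ *
            ∫⁻ x in ballIn Ω (z : X) (M * (R / 2 ^ k)), g x ^ θ ∂ν ∂H) := by
          rw [← lintegral_const_mul' _ _ ENNReal.ofReal_ne_top,
            ← lintegral_const_mul' _ _ ENNReal.ofReal_ne_top]
          refine lintegral_congr fun z => ?_
          rw [ENNReal.mul_rpow_of_nonneg _ _ hθ0.le, ← ENNReal.rpow_mul,
            one_div_mul_cancel hθ0.ne', ENNReal.rpow_one,
            ENNReal.ofReal_rpow_of_nonneg hr.le hθ0.le]
      _ = w k * (ENNReal.ofReal ((R / 2 ^ k) ^ θ) * ∫⁻ x, g x ^ θ *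
            ∫⁻ z in ((↑) : frontier Ω → X) ⁻¹' Metric.ball (x : X) (M * (R / 2 ^ k)),
              (ν (ballIn Ω (z : X) (R / 2 ^ k)))⁻¹ ∂H ∂ν) := by
          rw [lintegral_boundary_ballIn (hB k) hgm]
      _ ≤ ∫⁻ x, w k * (ENNReal.ofReal ((R / 2 ^ k) ^ θ) * (g x ^ θ *
            ∫⁻ z in ((↑) : frontier Ω → X) ⁻¹' Metric.ball (x : X) (M * (R / 2 ^ k)),
              (ν (ballIn Ω (z : X) (R / 2 ^ k)))⁻¹ ∂H)) ∂ν := by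
          rw [lintegral_const_mul' _ _ ENNReal.ofReal_ne_top,
            lintegral_const_mul' _ _ ENNReal.ofReal_ne_top]
      _ ≤ _ := by
          refine lintegral_mono fun x => ?_
          have h1 := hK2 (R / 2 ^ k) hr (div_le_self hR.le (one_le_pow₀ one_le_two)) x
          calc _ = g x ^ θ * (w k * (ENNReal.ofReal ((R / 2 ^ k) ^ θ) *
                ∫⁻ z in ((↑) : frontier Ω → X) ⁻¹' Metric.ball (x : X) (M * (R / 2 ^ k)),
                  (ν (ballIn Ω (z : X) (R / 2 ^ k)))⁻¹ ∂H)) := by ring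
            _ ≤ g x ^ θ * (w k * (N k).indicator (fun _ => (K2 : ℝ≥0∞)) x) := by gcongr
            _ = _ := by
                by_cases hx : x ∈ N k
                · simp only [indicator_of_mem hx]; ring
                · simp only [indicator_of_notMem hx]; ring
  have hmeas : ∀ k, AEMeasurable (fun x => g x ^ θ *
      (K2 * (w k * (N k).indicator (fun _ => 1) x))) ν := fun k =>
    (hgm.mul (((measurable_const.indicator (hNm k)).const_mul _).const_mul _)).aemeasurable
  have hmeas' : ∀ k, AEMeasurable (fun z : frontier Ω => w k * (ENNReal.ofReal (R / 2 ^ k) *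
      ((ν (ballIn Ω (z : X) (R / 2 ^ k)))⁻¹ *
        ∫⁻ x in ballIn Ω (z : X) (M * (R / 2 ^ k)), g x ^ θ ∂ν) ^ (1 / θ)) ^ θ) H := fun k =>
    ((((((hB k).mul (hI k)).pow_const _).const_mul _).pow_const _).const_mul _).aemeasurable
  calc _ ≤ ∫⁻ z : frontier Ω, K1 * ∑' k, w k * (ENNReal.ofReal (R / 2 ^ k) *
        ((ν (ballIn Ω (z : X) (R / 2 ^ k)))⁻¹ *
          ∫⁻ x in ballIn Ω (z : X) (M * (R / 2 ^ k)), g x ^ θ ∂ν) ^ (1 / θ)) ^ θ ∂H :=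
        lintegral_mono fun z => hK1 _
    _ = K1 * ∑' k, ∫⁻ z : frontier Ω, w k * (ENNReal.ofReal (R / 2 ^ k) *
        ((ν (ballIn Ω (z : X) (R / 2 ^ k)))⁻¹ *
          ∫⁻ x in ballIn Ω (z : X) (M * (R / 2 ^ k)), g x ^ θ ∂ν) ^ (1 / θ)) ^ θ ∂H := by
        rw [lintegral_const_mul' _ _ ENNReal.coe_ne_top, lintegral_tsum hmeas']
    _ ≤ K1 * ∑' k, ∫⁻ x, g x ^ θ * (K2 * (w k * (N k).indicator (fun _ => 1) x)) ∂ν := by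
        gcongr with k
        exact hone k
    _ = K1 * ∫⁻ x, ∑' k, g x ^ θ * (K2 * (w k * (N k).indicator (fun _ => 1) x)) ∂ν := by
        rw [lintegral_tsum hmeas]
    _ ≤ K1 * ∫⁻ x, (K2 * K3) * (ENNReal.ofReal (logWeight Ω (θ + ε) (x : X)) * g x ^ θ) ∂ν := by
        refine mul_le_mul_right (lintegral_mono fun x => ?_) _
        rw [ENNReal.tsum_mul_left, ENNReal.tsum_mul_left]
        calc _ ≤ g x ^ θ * (K2 * (K3 * ENNReal.ofReal (logWeight Ω (1 + (θ - 1 + ε)) x))) := by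
              gcongr
              exact hK3 x
          _ = _ := by rw [show 1 + (θ - 1 + ε) = θ + ε by ring]; ring
    _ = _ := by
        rw [lintegral_const_mul' _ _ (by finiteness), lintegral_withDensity_eq_lintegral_mul _
          ((measurable_logWeight _).ennreal_ofReal) hgm]
        simp only [Pi.mul_apply, ENNReal.coe_mul]
        ring

end TraceEstimate

/-! ### The trace operator -/

section TraceOperator

variable {X : Type*} [MetricSpace X] [MeasurableSpace X] [BorelSpace X] {Ω : Set X}
  {μ : Measure X} {H : Measure (frontier Ω)} {θ : ℝ}

omit [MeasurableSpace X] [BorelSpace X] in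
theorem ofReal_logWeight_lower (hΩ : IsMetricDomain Ω) (hb : Bornology.IsBounded Ω)
    (hne : (frontier Ω).Nonempty) {a : ℝ} (ha : 0 ≤ a) (x : Ω) :
    ENNReal.ofReal (Real.log 2 ^ a) ≤ ENNReal.ofReal (logWeight Ω a (x : X)) :=
  ENNReal.ofReal_le_ofReal (Real.rpow_le_rpow (Real.log_nonneg one_le_two)
    (log_two_le_log_diam_div hΩ hb hne x) ha)

theorem ofReal_log_two_rpow_ne_zero (a : ℝ) : ENNReal.ofReal (Real.log 2 ^ a) ≠ 0 := by
  simpa using Real.rpow_pos_of_pos (Real.log_pos one_lt_two) a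

theorem measureOn_absolutelyContinuous_logMeasureOn (hΩ : IsMetricDomain Ω)
    (hb : Bornology.IsBounded Ω) (hne : (frontier Ω).Nonempty) {a : ℝ} (ha : 0 ≤ a) :
    measureOn μ Ω ≪ logMeasureOn μ Ω a := by
  refine withDensity_absolutelyContinuous' (measurable_logWeight a).ennreal_ofReal.aemeasurable
    (Eventually.of_forall fun x => ?_)
  have := ofReal_logWeight_lower hΩ hb hne ha x
  exact ((pos_iff_ne_zero.2 (ofReal_log_two_rpow_ne_zero a)).trans_le this).ne'

theorem lintegral_measureOn_le_logMeasureOn (hΩ : IsMetricDomain Ω)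
    (hb : Bornology.IsBounded Ω) (hne : (frontier Ω).Nonempty) {a : ℝ} (ha : 0 ≤ a)
    (f : Ω → ℝ≥0∞) :
    ∫⁻ x, f x ∂(measureOn μ Ω) ≤
      (ENNReal.ofReal (Real.log 2 ^ a))⁻¹ * ∫⁻ x, f x ∂(logMeasureOn μ Ω a) := by
  have h0 := ofReal_log_two_rpow_ne_zero a
  rw [logMeasureOn, lintegral_withDensity_eq_lintegral_mul_non_measurable _
    (measurable_logWeight a).ennreal_ofReal (Eventually.of_forall fun _ => ENNReal.ofReal_lt_top),
    ← lintegral_const_mul' _ _ (ENNReal.inv_ne_top.2 h0)]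
  refine lintegral_mono fun x => ?_
  calc f x = (ENNReal.ofReal (Real.log 2 ^ a))⁻¹ * (ENNReal.ofReal (Real.log 2 ^ a) * f x) := by
        rw [← mul_assoc, ENNReal.inv_mul_cancel h0 ENNReal.ofReal_ne_top, one_mul]
    _ ≤ _ := by
        simp only [Pi.mul_apply]
        exact mul_le_mul_right (mul_le_mul_left (ofReal_logWeight_lower hΩ hb hne ha x) _) _

/-- Every function of the weighted Newtonian space has a trace, and the `L^θ` norm of the trace is
controlled by the function and any of its upper gradients. -/
theorem exists_hasTrace_lintegral_le (hΩ : IsMetricDomain Ω) (hb : Bornology.IsBounded Ω)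
    (hne : (frontier Ω).Nonempty) (hθ : 1 ≤ θ) [IsFiniteMeasure (measureOn μ Ω)] {c : ℝ≥0}
    (hc : 1 ≤ c) (hd : IsClosureDoubling (measureOn μ Ω) c) (hP : AdmitsPoincare θ (measureOn μ Ω))
    {C : ℝ≥0} (hH : HasCodimUpperBound (measureOn μ Ω) H θ C) {ε : ℝ} (hε : 0 < ε) :
    ∃ K : ℝ≥0, K ≠ 0 ∧ ∀ (u : Ω → ℝ) (g : Ω → ℝ≥0∞),
      AEStronglyMeasurable u (logMeasureOn μ Ω (θ + ε)) → IsUpperGradient u g →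
      (∫⁻ x, ‖u x‖ₑ ^ θ ∂(logMeasureOn μ Ω (θ + ε))) < ∞ →
      (∫⁻ x, g x ^ θ ∂(logMeasureOn μ Ω (θ + ε))) < ∞ →
      ∃ f : frontier Ω → ℝ, AEStronglyMeasurable f H ∧ HasTrace μ Ω H u f ∧
        ∫⁻ z, ‖f z‖ₑ ^ θ ∂H ≤ K * ((∫⁻ x, ‖u x‖ₑ ^ θ ∂(logMeasureOn μ Ω (θ + ε))) +
          ∫⁻ x, g x ^ θ ∂(logMeasureOn μ Ω (θ + ε))) := by
  have hHfin := hH.isFiniteMeasure hΩ hb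
  have := hd.secondCountableTopology
  have hθ0 : 0 < θ := by linarith
  have hR : 0 < Metric.diam Ω := diam_pos_of_mem_frontier hΩ hb hne.choose_spec
  obtain ⟨C1, M, hM, hPM⟩ := hP.exists_closure hθ hd
  obtain ⟨K1, hK1⟩ := hH.exists_lintegral_tsum_oscillation_le hd hΩ hb hne hθ hM hε
  obtain ⟨η, hη, hη'⟩ := hd.exists_lower_bound hb hΩ.2.nonempty hR
  set R := Metric.diam Ω with hRdef
  set ν := measureOn μ Ω with hν
  set νw := logMeasureOn μ Ω (θ + ε) with hνw
  set κ := ENNReal.ofReal (Real.log 2 ^ (θ + ε)) with hκ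
  have hκ0 : κ ≠ 0 := ofReal_log_two_rpow_ne_zero _
  have hκt : κ⁻¹ ≠ ∞ := ENNReal.inv_ne_top.2 hκ0
  have hη0 : (η : ℝ≥0∞) ≠ 0 := by exact_mod_cast hη.ne'
  have hle : ∀ f : Ω → ℝ≥0∞, ∫⁻ x, f x ∂ν ≤ κ⁻¹ * ∫⁻ x, f x ∂νw :=
    lintegral_measureOn_le_logMeasureOn hΩ hb hne (by linarith)
  set Ka : ℝ≥0∞ := 2 ^ (θ - 1) * (H univ * (η : ℝ≥0∞)⁻¹ * κ⁻¹) with hKa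
  set Kb : ℝ≥0∞ := 2 ^ (θ - 1) * (((1 + c) * C1 : ℝ≥0∞) ^ θ * K1) with hKb
  have h2t : (2 : ℝ≥0∞) ^ (θ - 1) ≠ ∞ := ENNReal.rpow_ne_top_of_nonneg (by linarith) (by simp)
  have hKat : Ka ≠ ∞ := ENNReal.mul_ne_top h2t (ENNReal.mul_ne_top
    (ENNReal.mul_ne_top (measure_ne_top _ _) (ENNReal.inv_ne_top.2 hη0)) hκt)
  have hKbt : Kb ≠ ∞ := ENNReal.mul_ne_top h2t (ENNReal.mul_ne_top
    (ENNReal.rpow_ne_top_of_nonneg hθ0.le (by finiteness)) ENNReal.coe_ne_top)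
  refine ⟨(Ka + Kb + 1).toNNReal, ?_, fun u g hu hg hu1 hg1 => ?_⟩
  · exact (ENNReal.toNNReal_pos (by simp) (by finiteness)).ne'
  have huν : AEStronglyMeasurable u ν :=
    hu.mono_ac (measureOn_absolutelyContinuous_logMeasureOn hΩ hb hne (by linarith))
  have huLp : MemLp u (ENNReal.ofReal θ) ν := by
    refine ⟨huν, ?_⟩
    rw [eLpNorm_lt_top_iff_lintegral_rpow_enorm_lt_top (by simpa using hθ0) ENNReal.ofReal_ne_top,
      ENNReal.toReal_ofReal hθ0.le]
    exact (hle _).trans_lt (ENNReal.mul_lt_top hκt.lt_top hu1)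
  have huI : Integrable u ν := huLp.integrable (by simpa using hθ)
  have hgf : ∀ᵐ x ∂ν, g x < ∞ := by
    have h1 : ∫⁻ x, g x ^ θ ∂ν ≠ ∞ :=
      ((hle _).trans_lt (ENNReal.mul_lt_top hκt.lt_top hg1)).ne
    filter_upwards [ae_lt_top (hg.1.pow_const θ) h1] with x hx
    exact (ENNReal.rpow_lt_top_iff_of_pos hθ0).1 hx
  -- the bound of the Poincaré inequality for the oscillation of `u` over the `k`-th ball about `z`
  set G : ℕ → frontier Ω → ℝ≥0∞ := fun k z => ENNReal.ofReal (R / 2 ^ k) *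
    ((ν (ballIn Ω (z : X) (R / 2 ^ k)))⁻¹ *
      ∫⁻ x in ballIn Ω (z : X) (M * (R / 2 ^ k)), g x ^ θ ∂ν) ^ (1 / θ) with hG
  have hGm : Measurable fun z => ∑' k, G k z := by
    refine Measurable.tsum fun k => ?_
    exact (((measurable_measure_ballIn ν _).inv.mul
      (measurable_setLIntegral_ballIn ν _ (hg.1.pow_const θ))).pow_const _).const_mul _
  have hsum : ∫⁻ z, (∑' k, G k z) ^ θ ∂H ≤ K1 * ∫⁻ x, g x ^ θ ∂νw := hK1 g hg.1
  have hae : ∀ᵐ z ∂H, ∑' k, G k z < ∞ := by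
    filter_upwards [ae_lt_top (hGm.pow_const θ)
      (hsum.trans_lt (ENNReal.mul_lt_top ENNReal.coe_lt_top hg1)).ne] with z hz
    exact (ENNReal.rpow_lt_top_iff_of_pos hθ0).1 hz
  have hpt : ∀ z : frontier Ω, ∑' k, G k z < ∞ → ∃ l : ℝ,
      Tendsto (fun k : ℕ => ⨍ x in ballIn Ω (z : X) (R / 2 ^ k), u x ∂ν) atTop (𝓝 l) ∧
      ‖l‖ₑ ≤ ‖⨍ x in ballIn Ω (z : X) R, u x ∂ν‖ₑ + (1 + c) * ∑' k, C1 * G k z ∧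
      HasTraceAt μ Ω u z l := by
    intro z hz
    refine exists_hasTraceAt_of_tsum_ne_top hc hd huI (frontier_subset_closure z.2) hR
      (fun k => ?_) ?_
    · exact hPM u g huI hg hgf z (frontier_subset_closure z.2) _ (by positivity)
    · rw [ENNReal.tsum_mul_left]
      exact ENNReal.mul_ne_top ENNReal.coe_ne_top hz.ne
  classical
  set f : frontier Ω → ℝ := fun z => if h : ∑' k, G k z < ∞ then (hpt z h).choose else 0 with hf
  have hfspec : ∀ᵐ z : frontier Ω ∂H,
      Tendsto (fun k : ℕ => ⨍ x in ballIn Ω (z : X) (R / 2 ^ k), u x ∂ν) atTop (𝓝 (f z)) ∧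
      ‖f z‖ₑ ≤ ‖⨍ x in ballIn Ω (z : X) R, u x ∂ν‖ₑ + (1 + c) * ∑' k, C1 * G k z ∧
      HasTraceAt μ Ω u z (f z) := by
    filter_upwards [hae] with z hz
    simp only [hf, hz, dif_pos]
    exact (hpt z hz).choose_spec
  refine ⟨f, ?_, ?_, ?_⟩
  · exact aestronglyMeasurable_of_tendsto_ae atTop
      (fun k : ℕ => aestronglyMeasurable_setAverage_ballIn hd huν (R / 2 ^ k))
      (hfspec.mono fun z hz => hz.1)
  · exact hfspec.mono fun z hz => hz.2.2
  · have hmean : ∀ z : frontier Ω, ‖⨍ x in ballIn Ω (z : X) R, u x ∂ν‖ₑ ^ θ ≤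
        (η : ℝ≥0∞)⁻¹ * (κ⁻¹ * ∫⁻ x, ‖u x‖ₑ ^ θ ∂νw) := by
      intro z
      have hz := frontier_subset_closure z.2
      refine (enorm_setAverage_rpow_le (hd.pos z hz R hR).ne' (measure_ne_top _ _) huν hθ).trans ?_
      gcongr
      · exact hη' z hz
      exact (setLIntegral_le_lintegral _ _).trans (hle _)
    calc ∫⁻ z, ‖f z‖ₑ ^ θ ∂H
        ≤ ∫⁻ z, (2 ^ (θ - 1) * ((η : ℝ≥0∞)⁻¹ * (κ⁻¹ * ∫⁻ x, ‖u x‖ₑ ^ θ ∂νw)) +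
            2 ^ (θ - 1) * (((1 + c) * C1 : ℝ≥0∞) ^ θ * (∑' k, G k z) ^ θ)) ∂H := by
          refine lintegral_mono_ae (hfspec.mono fun z hz => ?_)
          calc ‖f z‖ₑ ^ θ ≤ (‖⨍ x in ballIn Ω (z : X) R, u x ∂ν‖ₑ +
                ((1 + c) * C1 : ℝ≥0∞) * ∑' k, G k z) ^ θ := by
                refine ENNReal.rpow_le_rpow (hz.2.1.trans ?_) hθ0.le
                rw [ENNReal.tsum_mul_left, mul_assoc]
            _ ≤ _ := ENNReal.rpow_add_le_mul_rpow_add_rpow _ _ hθ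
            _ ≤ _ := by
                rw [mul_add, ENNReal.mul_rpow_of_nonneg _ _ hθ0.le]
                gcongr
                exact hmean z
      _ = Ka * (∫⁻ x, ‖u x‖ₑ ^ θ ∂νw) +
            2 ^ (θ - 1) * (((1 + c) * C1 : ℝ≥0∞) ^ θ * ∫⁻ z, (∑' k, G k z) ^ θ ∂H) := by
          rw [lintegral_add_left measurable_const, lintegral_const,
            lintegral_const_mul' _ _ h2t, lintegral_const_mul' _ _
              (ENNReal.rpow_ne_top_of_nonneg hθ0.le (by finiteness)), hKa]
          ring
      _ ≤ Ka * (∫⁻ x, ‖u x‖ₑ ^ θ ∂νw) +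
            2 ^ (θ - 1) * (((1 + c) * C1 : ℝ≥0∞) ^ θ * (K1 * ∫⁻ x, g x ^ θ ∂νw)) := by gcongr
      _ = Ka * (∫⁻ x, ‖u x‖ₑ ^ θ ∂νw) + Kb * ∫⁻ x, g x ^ θ ∂νw := by rw [hKb]; ring
      _ ≤ (Ka + Kb + 1) * (∫⁻ x, ‖u x‖ₑ ^ θ ∂νw) + (Ka + Kb + 1) * ∫⁻ x, g x ^ θ ∂νw := by
          gcongr
          · rw [add_assoc]; exact le_self_add
          · rw [add_right_comm]; exact le_add_self
      _ = _ := by rw [ENNReal.coe_toNNReal (by finiteness)]; ring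

omit [BorelSpace X] in
theorem HasTraceAt.add {u v : Ω → ℝ} {z : X} {a b : ℝ}
    (hu : AEStronglyMeasurable u (measureOn μ Ω)) (ha : HasTraceAt μ Ω u z a)
    (hb : HasTraceAt μ Ω v z b) : HasTraceAt μ Ω (u + v) z (a + b) := by
  have h := Tendsto.add ha hb
  rw [add_zero] at h
  refine tendsto_of_tendsto_of_tendsto_of_le_of_le tendsto_const_nhds h (fun _ => zero_le)
    fun r => ?_
  simp only [laverage]
  rw [← lintegral_add_left' (f := fun x => ‖u x - a‖ₑ)
    (((hu.sub aestronglyMeasurable_const).enorm.restrict).smul_measure _)]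
  refine lintegral_mono fun x => ?_
  calc ‖(u + v) x - (a + b)‖ₑ = ‖(u x - a) + (v x - b)‖ₑ := by
        simp only [Pi.add_apply]; congr 1; ring
    _ ≤ _ := enorm_add_le _ _

omit [BorelSpace X] in
theorem HasTraceAt.const_smul {u : Ω → ℝ} {z : X} {a : ℝ} (ha : HasTraceAt μ Ω u z a) (t : ℝ) :
    HasTraceAt μ Ω (t • u) z (t • a) := by
  have h := ENNReal.Tendsto.const_mul (a := ‖t‖ₑ) ha (Or.inr enorm_ne_top)
  rw [mul_zero] at h
  refine h.congr fun r => ?_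
  simp only [laverage]
  rw [← lintegral_const_mul' _ _ enorm_ne_top]
  refine lintegral_congr fun x => ?_
  rw [Pi.smul_apply, ← smul_sub, enorm_smul]

omit [BorelSpace X] in
theorem HasTrace.ae_eq {c : ℝ≥0} [IsFiniteMeasure (measureOn μ Ω)]
    (hd : IsClosureDoubling (measureOn μ Ω) c) {u : Ω → ℝ}
    (hu : AEStronglyMeasurable u (measureOn μ Ω)) {f f' : frontier Ω → ℝ}
    (hf : HasTrace μ Ω H u f) (hf' : HasTrace μ Ω H u f') : f =ᵐ[H] f' := by
  filter_upwards [hf, hf'] with z h h'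
  exact h.unique hd hu (frontier_subset_closure z.2) h'

omit [BorelSpace X] in
theorem HasTrace.congr {u : Ω → ℝ} {f f' : frontier Ω → ℝ} (hf : HasTrace μ Ω H u f)
    (h : f =ᵐ[H] f') : HasTrace μ Ω H u f' := by
  filter_upwards [hf, h] with z h1 h2
  rwa [← h2]

/-- The bounded linear trace operator on the weighted Newtonian space. -/
theorem exists_traceOperator (hΩ : IsMetricDomain Ω) (hb : Bornology.IsBounded Ω)
    (hθ : 1 ≤ θ) (hμ : IsDoublingOn μ Ω) (hP : AdmitsPoincare θ (measureOn μ Ω))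
    (hreg : IsCodimRegular μ Ω H θ) {ε : ℝ} (hε : 0 < ε) :
    ∃ (T : newtonian θ hθ (logMeasureOn μ Ω (θ + ε)) →ₗ[ℝ] Lp ℝ (ENNReal.ofReal θ) H)
      (C : ℝ≥0), ∀ u : newtonian θ hθ (logMeasureOn μ Ω (θ + ε)),
        eLpNorm (T u) (ENNReal.ofReal θ) H ≤
          C * newtonNorm θ (logMeasureOn μ Ω (θ + ε)) (u : Ω → ℝ) ∧
        HasTrace μ Ω H (u : Ω → ℝ) (T u) := by
  have hθ0 : 0 < θ := by linarith
  rcases (frontier Ω).eq_empty_or_nonempty with he | hne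
  · have : IsEmpty (frontier Ω) := isEmpty_coe_sort.2 he
    have hH0 : H = 0 := H.eq_zero_of_isEmpty
    subst hH0
    exact ⟨0, 0, fun u => ⟨by simp, by simp [HasTrace]⟩⟩
  have hfin := hμ.isFiniteMeasure hΩ hb
  obtain ⟨c, hc, hd⟩ := hμ.exists_isClosureDoubling hΩ.1
  obtain ⟨C, hC⟩ := hreg.exists_upperBound hΩ hb hθ0
  obtain ⟨K, hK0, hK⟩ := exists_hasTrace_lintegral_le hΩ hb hne hθ hc hd hP hC hε
  set νw := logMeasureOn μ Ω (θ + ε) with hνw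
  have hac : measureOn μ Ω ≪ νw :=
    measureOn_absolutelyContinuous_logMeasureOn hΩ hb hne (by linarith)
  have hpne : ENNReal.ofReal θ ≠ 0 := by simpa using hθ0
  have hex : ∀ u : newtonian θ hθ νw, ∃ F : Lp ℝ (ENNReal.ofReal θ) H,
      HasTrace μ Ω H (u : Ω → ℝ) F := by
    rintro ⟨u, hu, hu'⟩
    obtain ⟨hu1, g, hg, hg1⟩ := (newtonNorm_lt_top_iff hθ νw u).1 hu'
    obtain ⟨f, hfm, hft, hfb⟩ := hK u g hu hg hu1 hg1
    have hfLp : MemLp f (ENNReal.ofReal θ) H := by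
      refine ⟨hfm, ?_⟩
      rw [eLpNorm_lt_top_iff_lintegral_rpow_enorm_lt_top hpne ENNReal.ofReal_ne_top,
        ENNReal.toReal_ofReal hθ0.le]
      exact hfb.trans_lt (ENNReal.mul_lt_top ENNReal.coe_lt_top (ENNReal.add_lt_top.2 ⟨hu1, hg1⟩))
    exact ⟨hfLp.toLp f, hft.congr hfLp.coeFn_toLp.symm⟩
  choose T hT using hex
  have hum : ∀ u : newtonian θ hθ νw, AEStronglyMeasurable (u : Ω → ℝ) (measureOn μ Ω) :=
    fun u => u.2.1.mono_ac hac
  refine ⟨⟨⟨T, fun u v => ?_⟩, fun t u => ?_⟩, (K ^ (1 / θ)), fun u => ⟨?_, hT u⟩⟩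
  · refine Lp.ext ?_
    refine (HasTrace.ae_eq hd (hum (u + v)) (hT (u + v)) ?_).trans (Lp.coeFn_add _ _).symm
    filter_upwards [hT u, hT v] with z h1 h2
    exact h1.add (hum u) h2
  · refine Lp.ext ?_
    refine (HasTrace.ae_eq hd (hum (t • u)) (hT (t • u)) ?_).trans (Lp.coeFn_smul _ _).symm
    filter_upwards [hT u] with z h1
    exact h1.const_smul t
  · have hu1 := ((newtonNorm_lt_top_iff hθ νw u).1 u.2.2).1
    have hK0' : (K : ℝ≥0∞) ≠ 0 := by exact_mod_cast hK0
    -- the bound holds for each upper gradient, as traces are unique; take the infimum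
    have hbound : (K : ℝ≥0∞)⁻¹ * ∫⁻ z, ‖T u z‖ₑ ^ θ ∂H ≤ (∫⁻ x, ‖(u : Ω → ℝ) x‖ₑ ^ θ ∂νw) +
        ⨅ (g : Ω → ℝ≥0∞) (_ : IsUpperGradient (u : Ω → ℝ) g), ∫⁻ x, g x ^ θ ∂νw := by
      simp only [ENNReal.add_iInf]
      refine le_iInf₂ fun g hg => ?_
      rcases eq_or_ne (∫⁻ x, g x ^ θ ∂νw) ∞ with h | h
      · rw [h, add_top]; exact le_top
      · obtain ⟨f, -, hft, hfb⟩ := hK u g u.2.1 hg hu1 h.lt_top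
        rw [ENNReal.inv_mul_le_iff hK0' ENNReal.coe_ne_top]
        refine le_trans (le_of_eq (lintegral_congr_ae ?_)) hfb
        filter_upwards [(hT u).ae_eq hd (hum u) hft] with z hz
        rw [hz]
    rw [ENNReal.inv_mul_le_iff hK0' ENNReal.coe_ne_top] at hbound
    rw [eLpNorm_eq_lintegral_rpow_enorm_toReal hpne ENNReal.ofReal_ne_top,
      ENNReal.toReal_ofReal hθ0.le, newtonNorm, ENNReal.coe_rpow_of_nonneg _ (by positivity),
      ← ENNReal.mul_rpow_of_nonneg _ _ (by positivity)]
    exact ENNReal.rpow_le_rpow hbound (by positivity)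

end TraceOperator

/-! ### Boundary layers -/

section BoundaryLayer

variable {X : Type*} [MetricSpace X] [MeasurableSpace X] [BorelSpace X] {Ω : Set X}
  {H : Measure (frontier Ω)} {θ : ℝ}

/-- The part of `Ω` within distance `ρ` of the boundary. -/
def boundaryLayer (Ω : Set X) (ρ : ℝ) : Set Ω :=
  {x | Metric.infDist (x : X) (frontier Ω) ≤ ρ}

theorem measurableSet_boundaryLayer (ρ : ℝ) : MeasurableSet (boundaryLayer Ω ρ) :=
  (isClosed_le ((Metric.continuous_infDist_pt _).comp continuous_subtype_val)
    continuous_const).measurableSet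

/-- The lower codimension bound, for small radii. -/
def HasCodimLowerBound (ν : Measure Ω) (H : Measure (frontier Ω)) (θ : ℝ) (C : ℝ≥0) : Prop :=
  ∀ (z : frontier Ω) (r : ℝ), 0 < r → r < 2 * Metric.diam (frontier Ω) →
    ν (ballIn Ω (z : X) r) ≤ C * (ENNReal.ofReal (r ^ θ) * H (Metric.ball z r))

theorem IsCodimRegular.exists_lowerBound {μ : Measure X} (h : IsCodimRegular μ Ω H θ)
    (hΩ : IsOpen Ω) : ∃ C : ℝ≥0, HasCodimLowerBound (measureOn μ Ω) H θ C := by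
  obtain ⟨c, _, hc, hle, _⟩ := h
  refine ⟨c⁻¹, fun z r hr hr2 => ?_⟩
  have h1 := hle z r hr hr2
  have hc0 : (c : ℝ≥0∞) ≠ 0 := by exact_mod_cast hc.ne'
  have hr0 : ENNReal.ofReal (r ^ θ) ≠ 0 := by simpa using Real.rpow_pos_of_pos hr θ
  rw [measureOn_ballIn hΩ, ENNReal.coe_inv hc.ne']
  calc μ (Metric.ball (z : X) r ∩ Ω)
      = (c : ℝ≥0∞)⁻¹ * (ENNReal.ofReal (r ^ θ) *
          (c * (μ (Metric.ball (z : X) r ∩ Ω) / ENNReal.ofReal (r ^ θ)))) := by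
        rw [div_eq_mul_inv]
        calc _ = ((c : ℝ≥0∞)⁻¹ * c) * (ENNReal.ofReal (r ^ θ) * (ENNReal.ofReal (r ^ θ))⁻¹) *
              μ (Metric.ball (z : X) r ∩ Ω) := by
              rw [ENNReal.inv_mul_cancel hc0 ENNReal.coe_ne_top,
                ENNReal.mul_inv_cancel hr0 ENNReal.ofReal_ne_top, one_mul, one_mul]
          _ = _ := by ring
    _ ≤ _ := by gcongr

/-- The `L^θ` norm of a Lipschitz function over a boundary layer of width `ρ` is of the order of
`ρ` times its `L^θ` norm over the boundary. -/
theorem HasCodimLowerBound.exists_lintegral_boundaryLayer_le {ν : Measure Ω} [IsFiniteMeasure ν]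
    {C c : ℝ≥0} (h : HasCodimLowerBound ν H θ C) (hd : IsClosureDoubling ν c) [IsFiniteMeasure H]
    (hne : (frontier Ω).Nonempty) (hθ : 1 ≤ θ) :
    ∃ K : ℝ≥0, ∀ (F : X → ℝ) (L : ℝ≥0), LipschitzWith L F → ∀ ρ : ℝ, 0 < ρ →
      ρ < Metric.diam (frontier Ω) →
      ∫⁻ x in boundaryLayer Ω ρ, ‖F x‖ₑ ^ θ ∂ν ≤ K * (ENNReal.ofReal (ρ ^ θ) *
        ∫⁻ z, (‖F (z : X)‖ₑ ^ θ + ENNReal.ofReal (L * (4 * ρ)) ^ θ) ∂H) := by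
  have hsc := hd.secondCountableTopology
  have hθ0 : 0 < θ := by linarith
  obtain ⟨D, hD1, hD⟩ := hd.exists_le 5
  have hD0 : (D : ℝ≥0∞) ≠ 0 := by exact_mod_cast (zero_lt_one.trans_le hD1).ne'
  have h2t : (2 : ℝ≥0∞) ^ (θ - 1) ≠ ∞ := ENNReal.rpow_ne_top_of_nonneg (by linarith) (by simp)
  refine ⟨D * C * (ENNReal.ofReal (2 ^ θ)).toNNReal * ((2 : ℝ≥0∞) ^ (θ - 1)).toNNReal,
    fun F L hF ρ hρ hρd => ?_⟩
  set Φ : frontier Ω → ℝ≥0∞ := fun z => ‖F (z : X)‖ₑ ^ θ + ENNReal.ofReal (L * (4 * ρ)) ^ θ with hΦ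
  have hFm : Measurable F := hF.continuous.measurable
  have hΦm : Measurable Φ :=
    ((hFm.comp measurable_subtype_coe).enorm.pow_const θ).add measurable_const
  set V : frontier Ω → ℝ≥0∞ := fun z => ν (ballIn Ω (z : X) (4 * ρ)) with hV
  have hVm : Measurable V := measurable_measure_ballIn ν _
  have hV0 : ∀ z, V z ≠ 0 := fun z => (hd.pos _ (frontier_subset_closure z.2) _ (by linarith)).ne'
  have hVt : ∀ z, V z ≠ ∞ := fun z => measure_ne_top _ _
  set S : X → Set (frontier Ω) := fun x => ((↑) : frontier Ω → X) ⁻¹' Metric.ball x (4 * ρ) with hS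
  have hSm : ∀ x, MeasurableSet (S x) := fun x =>
    (Metric.isOpen_ball.preimage continuous_subtype_val).measurableSet
  -- the pointwise bound, by averaging over the boundary points near `x`
  have hpt : ∀ x ∈ boundaryLayer Ω ρ, ‖F x‖ₑ ^ θ ≤ (D * C * ENNReal.ofReal (2 ^ θ) * 2 ^ (θ - 1)) *
      (ENNReal.ofReal (ρ ^ θ) * ∫⁻ z in S x, Φ z * (V z)⁻¹ ∂H) := by
    intro x hx
    obtain ⟨z₀, hz₀, hxz⟩ := (Metric.infDist_lt_iff hne).1
      (lt_of_le_of_lt (show Metric.infDist (x : X) (frontier Ω) ≤ ρ from hx)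
        (show ρ < 2 * ρ by linarith))
    set A := ν (ballIn Ω z₀ (2 * ρ)) with hA
    have hA0 : A ≠ 0 := (hd.pos _ (frontier_subset_closure hz₀) _ (by linarith)).ne'
    have hAt : A ≠ ∞ := measure_ne_top _ _
    have hHA : A ≤ C * (ENNReal.ofReal ((2 * ρ) ^ θ) * H (S x)) := by
      refine (h ⟨z₀, hz₀⟩ (2 * ρ) (by linarith) (by linarith)).trans ?_
      gcongr
      intro w hw
      have hw' : dist (w : X) z₀ < 2 * ρ := hw
      have : dist (w : X) x < 4 * ρ := by
        have := dist_triangle (w : X) z₀ x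
        rw [dist_comm z₀] at this
        linarith
      exact this
    have h1 : ∀ z ∈ S x, ‖F x‖ₑ ^ θ * A⁻¹ ≤ D * 2 ^ (θ - 1) * (Φ z * (V z)⁻¹) := by
      intro z hz
      have hzx : dist (z : X) x < 4 * ρ := hz
      have hzz : dist (z : X) z₀ + 4 * ρ ≤ 5 * (2 * ρ) := by
        have := dist_triangle (z : X) x z₀
        linarith
      have h2 : V z ≤ D * A := hD z₀ (frontier_subset_closure hz₀) z (2 * ρ) (by linarith) _ hzz
      have h3 : A⁻¹ ≤ D * (V z)⁻¹ := by
        calc A⁻¹ = D * (D * A)⁻¹ := by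
              rw [ENNReal.mul_inv (Or.inl hD0) (Or.inl ENNReal.coe_ne_top), ← mul_assoc,
                ENNReal.mul_inv_cancel hD0 ENNReal.coe_ne_top, one_mul]
          _ ≤ _ := by gcongr
      have h4 : ‖F x‖ₑ ≤ ‖F z‖ₑ + ENNReal.ofReal (L * (4 * ρ)) := by
        calc ‖F x‖ₑ = ‖F z + (F x - F z)‖ₑ := by congr 1; ring
          _ ≤ ‖F z‖ₑ + ‖F x - F z‖ₑ := enorm_add_le _ _
          _ ≤ _ := by
            gcongr
            rw [Real.enorm_eq_ofReal_abs, ← Real.dist_eq]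
            refine ENNReal.ofReal_le_ofReal ((hF.dist_le_mul _ _).trans ?_)
            rw [dist_comm]
            gcongr
      calc ‖F x‖ₑ ^ θ * A⁻¹ ≤ (2 ^ (θ - 1) * Φ z) * (D * (V z)⁻¹) := by
            gcongr
            exact (ENNReal.rpow_le_rpow h4 hθ0.le).trans
              (ENNReal.rpow_add_le_mul_rpow_add_rpow _ _ hθ)
        _ = _ := by ring
    have h5 : ‖F x‖ₑ ^ θ * A⁻¹ * H (S x) ≤ D * 2 ^ (θ - 1) * ∫⁻ z in S x, Φ z * (V z)⁻¹ ∂H := by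
      rw [← setLIntegral_const, ← lintegral_const_mul' _ _ (by finiteness)]
      exact setLIntegral_mono' (hSm _) h1
    calc ‖F x‖ₑ ^ θ = ‖F x‖ₑ ^ θ * A⁻¹ * A := by
          rw [mul_assoc, ENNReal.inv_mul_cancel hA0 hAt, mul_one]
      _ ≤ ‖F x‖ₑ ^ θ * A⁻¹ * (C * (ENNReal.ofReal ((2 * ρ) ^ θ) * H (S x))) := by gcongr
      _ = C * ENNReal.ofReal ((2 * ρ) ^ θ) * (‖F x‖ₑ ^ θ * A⁻¹ * H (S x)) := by ring
      _ ≤ C * ENNReal.ofReal ((2 * ρ) ^ θ) *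
          (D * 2 ^ (θ - 1) * ∫⁻ z in S x, Φ z * (V z)⁻¹ ∂H) := by gcongr
      _ = _ := by
          rw [Real.mul_rpow (by norm_num) hρ.le, ENNReal.ofReal_mul (by positivity)]
          ring
  calc ∫⁻ x in boundaryLayer Ω ρ, ‖F x‖ₑ ^ θ ∂ν
      ≤ ∫⁻ x in boundaryLayer Ω ρ, (D * C * ENNReal.ofReal (2 ^ θ) * 2 ^ (θ - 1)) *
          (ENNReal.ofReal (ρ ^ θ) * ∫⁻ z in S x, Φ z * (V z)⁻¹ ∂H) ∂ν :=
        setLIntegral_mono' (measurableSet_boundaryLayer ρ) hpt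
    _ ≤ ∫⁻ x, (D * C * ENNReal.ofReal (2 ^ θ) * 2 ^ (θ - 1)) *
          (ENNReal.ofReal (ρ ^ θ) * ∫⁻ z in S x, Φ z * (V z)⁻¹ ∂H) ∂ν :=
        setLIntegral_le_lintegral _ _
    _ = (D * C * ENNReal.ofReal (2 ^ θ) * 2 ^ (θ - 1)) * (ENNReal.ofReal (ρ ^ θ) *
          ∫⁻ x : Ω, 1 * ∫⁻ z in S x, Φ z * (V z)⁻¹ ∂H ∂ν) := by
        rw [lintegral_const_mul' _ _ (by finiteness), lintegral_const_mul' _ _ (by finiteness)]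
        simp only [one_mul]
    _ = (D * C * ENNReal.ofReal (2 ^ θ) * 2 ^ (θ - 1)) * (ENNReal.ofReal (ρ ^ θ) *
          ∫⁻ z, (Φ z * (V z)⁻¹) * ∫⁻ x in ballIn Ω (z : X) (4 * ρ), 1 ∂ν ∂H) := by
        rw [lintegral_boundary_ballIn (φ := fun z => Φ z * (V z)⁻¹) (hΦm.mul hVm.inv)
          (ψ := fun _ => 1) measurable_const]
    _ = _ := by
        have : ∀ z, (Φ z * (V z)⁻¹) * ∫⁻ x in ballIn Ω (z : X) (4 * ρ), 1 ∂ν = Φ z := by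
          intro z
          rw [setLIntegral_one, mul_assoc, ENNReal.inv_mul_cancel (hV0 z) (hVt z), mul_one]
        simp only [this, ENNReal.coe_mul, ENNReal.coe_toNNReal h2t,
          ENNReal.coe_toNNReal ENNReal.ofReal_ne_top]

theorem tendsto_measure_boundaryLayer (hΩ : IsOpen Ω) (hne : (frontier Ω).Nonempty)
    (ν : Measure Ω) [IsFiniteMeasure ν] :
    Tendsto (fun ρ => ν (boundaryLayer Ω ρ)) (𝓝[>] 0) (𝓝 0) := by
  have h := tendsto_measure_biInter_gt (μ := ν) (s := boundaryLayer Ω) (a := (0 : ℝ))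
    (fun r _ => (measurableSet_boundaryLayer r).nullMeasurableSet)
    (fun i j _ hij x hx => le_trans (show _ ≤ i from hx) hij) ⟨1, one_pos, measure_ne_top _ _⟩
  have h0 : ⋂ r > (0 : ℝ), boundaryLayer Ω r = ∅ := by
    refine eq_empty_of_forall_notMem fun x hx => ?_
    simp only [mem_iInter] at hx
    have hpos := infDist_frontier_pos hΩ hne x.2
    have : Metric.infDist (x : X) (frontier Ω) ≤ _ := hx _ (half_pos hpos)
    linarith
  rwa [h0, measure_empty] at h

/-- The cutoff function that equals `1` within distance `ρ / 2` of the boundary and vanishes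
beyond distance `ρ`. -/
noncomputable def boundaryCutoff (Ω : Set X) (ρ : ℝ) (x : X) : ℝ :=
  max 0 (min 1 (2 - 2 / ρ * Metric.infDist x (frontier Ω)))

omit [MeasurableSpace X] [BorelSpace X] in
theorem boundaryCutoff_nonneg (ρ : ℝ) (x : X) : 0 ≤ boundaryCutoff Ω ρ x := le_max_left _ _

omit [MeasurableSpace X] [BorelSpace X] in
theorem boundaryCutoff_le_one (ρ : ℝ) (x : X) : boundaryCutoff Ω ρ x ≤ 1 :=
  max_le zero_le_one (min_le_left _ _)

omit [MeasurableSpace X] [BorelSpace X] in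
theorem boundaryCutoff_eq_one {ρ : ℝ} (hρ : 0 < ρ) {x : X}
    (hx : Metric.infDist x (frontier Ω) ≤ ρ / 2) : boundaryCutoff Ω ρ x = 1 := by
  have : 2 / ρ * Metric.infDist x (frontier Ω) ≤ 2 / ρ * (ρ / 2) := by gcongr
  have h2 : 2 / ρ * (ρ / 2) = 1 := by field_simp
  rw [boundaryCutoff, min_eq_left (by linarith), max_eq_right zero_le_one]

omit [MeasurableSpace X] [BorelSpace X] in
theorem boundaryCutoff_eq_zero {ρ : ℝ} (hρ : 0 < ρ) {x : X}
    (hx : ρ ≤ Metric.infDist x (frontier Ω)) : boundaryCutoff Ω ρ x = 0 := by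
  have : 2 / ρ * ρ ≤ 2 / ρ * Metric.infDist x (frontier Ω) := by gcongr
  have h2 : 2 / ρ * ρ = 2 := by field_simp
  rw [boundaryCutoff, max_eq_left]
  exact (min_le_right _ _).trans (by linarith)

omit [MeasurableSpace X] [BorelSpace X] in
theorem abs_boundaryCutoff_sub_le {ρ : ℝ} (hρ : 0 < ρ) (x y : X) :
    |boundaryCutoff Ω ρ y - boundaryCutoff Ω ρ x| ≤ 2 / ρ * dist y x := by
  have h1 : |Metric.infDist y (frontier Ω) - Metric.infDist x (frontier Ω)| ≤ dist y x := by
    rw [← Real.dist_eq]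
    simpa using (Metric.lipschitz_infDist_pt (frontier Ω)).dist_le_mul y x
  unfold boundaryCutoff
  refine (abs_max_sub_max_le_max _ _ _ _).trans (max_le ?_ ((abs_min_sub_min_le_max _ _ _ _).trans
    (max_le ?_ ?_)))
  · rw [sub_self, abs_zero]; positivity
  · rw [sub_self, abs_zero]; positivity
  rw [show 2 - 2 / ρ * Metric.infDist y (frontier Ω) - (2 - 2 / ρ * Metric.infDist x (frontier Ω))
    = -(2 / ρ * (Metric.infDist y (frontier Ω) - Metric.infDist x (frontier Ω))) by ring, abs_neg,
    abs_mul, abs_of_pos (by positivity)]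
  gcongr

omit [MeasurableSpace X] [BorelSpace X] in
theorem abs_mul_boundaryCutoff_sub_le {F : X → ℝ} {L : ℝ≥0} (hF : LipschitzWith L F)
    {ρ : ℝ} (hρ : 0 < ρ) (x y : X) :
    |F y * boundaryCutoff Ω ρ y - F x * boundaryCutoff Ω ρ x| ≤
      (2 / ρ * |F x| + L) * dist y x := by
  have h1 : |F y - F x| ≤ L * dist y x := by rw [← Real.dist_eq]; exact hF.dist_le_mul y x
  have h2 := abs_boundaryCutoff_sub_le (Ω := Ω) hρ x y
  calc |F y * boundaryCutoff Ω ρ y - F x * boundaryCutoff Ω ρ x|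
      = |(F y - F x) * boundaryCutoff Ω ρ y +
          F x * (boundaryCutoff Ω ρ y - boundaryCutoff Ω ρ x)| := by ring_nf
    _ ≤ |F y - F x| * |boundaryCutoff Ω ρ y| +
          |F x| * |boundaryCutoff Ω ρ y - boundaryCutoff Ω ρ x| := by
        rw [← abs_mul, ← abs_mul]; exact abs_add_le _ _
    _ ≤ L * dist y x * 1 + |F x| * (2 / ρ * dist y x) := by
        gcongr
        rw [abs_of_nonneg (boundaryCutoff_nonneg _ _)]
        exact boundaryCutoff_le_one _ _
    _ = _ := by ring

/-- The upper gradient of a Lipschitz function that is cut off outside a boundary layer. -/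
noncomputable def layerGradient (Ω : Set X) (F : X → ℝ) (L : ℝ≥0) (ρ : ℝ) : Ω → ℝ≥0∞ :=
  (boundaryLayer Ω ρ).indicator fun x => ENNReal.ofReal (2 / ρ) * ‖F x‖ₑ + L

theorem measurable_layerGradient {F : X → ℝ} {L : ℝ≥0} (hF : LipschitzWith L F) (ρ : ℝ) :
    Measurable (layerGradient Ω F L ρ) := by
  refine Measurable.indicator ?_ (measurableSet_boundaryLayer ρ)
  exact ((hF.continuous.measurable.comp measurable_subtype_coe).enorm.const_mul _).add_const _

theorem isUpperGradient_layerGradient {F : X → ℝ} {L : ℝ≥0} (hF : LipschitzWith L F)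
    {ρ : ℝ} (hρ : 0 < ρ) :
    IsUpperGradient (fun x : Ω => F x * boundaryCutoff Ω ρ x) (layerGradient Ω F L ρ) := by
  refine isUpperGradient_of_slope (measurable_layerGradient hF ρ) (fun S hS => ?_)
    fun x c hc => ?_
  · obtain ⟨B, hB⟩ := hS.exists_bound_of_continuousOn
      (f := fun x : Ω => F x) (hF.continuous.comp continuous_subtype_val).continuousOn
    refine ⟨(2 / ρ * B + L).toNNReal, LipschitzOnWith.of_dist_le_mul fun y hy x hx => ?_⟩
    rw [Real.dist_eq]
    refine (abs_mul_boundaryCutoff_sub_le hF hρ (x : X) y).trans ?_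
    refine mul_le_mul_of_nonneg_right (le_trans ?_ (Real.le_coe_toNNReal _)) dist_nonneg
    gcongr
    exact hB x hx
  · by_cases hx : x ∈ boundaryLayer Ω ρ
    · rw [layerGradient, indicator_of_mem hx, Real.enorm_eq_ofReal_abs,
        ← ENNReal.ofReal_mul (by positivity), ← ENNReal.ofReal_coe_nnreal,
        ← ENNReal.ofReal_add (by positivity) (by positivity), ← ENNReal.ofReal_coe_nnreal] at hc
      have hc' := (ENNReal.ofReal_lt_ofReal_iff_of_nonneg (by positivity)).1 hc
      refine Eventually.of_forall fun y => ?_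
      exact (abs_mul_boundaryCutoff_sub_le hF hρ (x : X) y).trans
        (mul_le_mul_of_nonneg_right hc'.le dist_nonneg)
    · have hx' : ρ < Metric.infDist (x : X) (frontier Ω) := not_le.1 hx
      have hcont : Continuous fun y : Ω => Metric.infDist (y : X) (frontier Ω) :=
        (Metric.continuous_infDist_pt _).comp continuous_subtype_val
      filter_upwards [hcont.continuousAt.eventually (lt_mem_nhds hx')] with y hy
      rw [boundaryCutoff_eq_zero hρ hy.le, boundaryCutoff_eq_zero hρ hx'.le]
      simp only [mul_zero, sub_self, abs_zero]
      positivity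

omit [MeasurableSpace X] [BorelSpace X] in
theorem enorm_mul_boundaryCutoff_le (F : X → ℝ) {ρ : ℝ} (hρ : 0 < ρ) (x : Ω) :
    ‖F x * boundaryCutoff Ω ρ x‖ₑ ≤ (boundaryLayer Ω ρ).indicator (fun x => ‖F x‖ₑ) x := by
  by_cases hx : x ∈ boundaryLayer Ω ρ
  · rw [indicator_of_mem hx, enorm_mul]
    refine mul_le_of_le_one_right zero_le ?_
    rw [Real.enorm_eq_ofReal_abs, abs_of_nonneg (boundaryCutoff_nonneg _ _), ENNReal.ofReal_le_one]
    exact boundaryCutoff_le_one _ _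
  · rw [boundaryCutoff_eq_zero hρ (not_le.1 hx).le]
    simp

/-- Cut off outside a sufficiently thin boundary layer, a Lipschitz function has `L^θ` norm and
energy controlled by its `L^θ` norm on the boundary. -/
theorem HasCodimLowerBound.exists_eventually_layer_le {ν : Measure Ω} [IsFiniteMeasure ν]
    {C c : ℝ≥0} (h : HasCodimLowerBound ν H θ C) (hd : IsClosureDoubling ν c) [IsFiniteMeasure H]
    (hΩ : IsOpen Ω) (hdiam : 0 < Metric.diam (frontier Ω)) (hθ : 1 ≤ θ) :
    ∃ K : ℝ≥0, ∀ (F : X → ℝ) (L : ℝ≥0), LipschitzWith L F → ∀ δ : ℝ≥0∞, δ ≠ 0 →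
      ∀ᶠ ρ in 𝓝[>] (0 : ℝ),
        ∫⁻ x : Ω, ‖F x * boundaryCutoff Ω ρ x‖ₑ ^ θ ∂ν ≤
          K * ((∫⁻ z : frontier Ω, ‖F z‖ₑ ^ θ ∂H) + δ) ∧
        ∫⁻ x, layerGradient Ω F L ρ x ^ θ ∂ν ≤
          K * ((∫⁻ z : frontier Ω, ‖F z‖ₑ ^ θ ∂H) + δ) := by
  have hθ0 : 0 < θ := by linarith
  have hne : (frontier Ω).Nonempty := by
    by_contra hcon
    rw [not_nonempty_iff_eq_empty] at hcon
    simp [hcon] at hdiam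
  obtain ⟨K, hK⟩ := h.exists_lintegral_boundaryLayer_le hd hne hθ
  have h2t : (2 : ℝ≥0∞) ^ (θ - 1) ≠ ∞ := ENNReal.rpow_ne_top_of_nonneg (by linarith) (by simp)
  have h2t' : (2 : ℝ≥0∞) ^ θ ≠ ∞ := ENNReal.rpow_ne_top_of_nonneg (by linarith) (by simp)
  set K' : ℝ≥0∞ := K + 2 ^ (θ - 1) * (2 ^ θ * K + 1) with hK'
  have hK't : K' ≠ ∞ := by finiteness
  refine ⟨K'.toNNReal, fun F L hF δ hδ => ?_⟩
  rw [ENNReal.coe_toNNReal hK't]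
  set A := ∫⁻ z : frontier Ω, ‖F z‖ₑ ^ θ ∂H with hA
  -- the two error terms
  have e1 : ∀ᶠ ρ in 𝓝[>] (0 : ℝ), ENNReal.ofReal (L * (4 * ρ)) ^ θ * H univ ≤ δ / 2 := by
    have h1 : Tendsto (fun ρ : ℝ => ENNReal.ofReal (L * (4 * ρ)) ^ θ * H univ) (𝓝 0) (𝓝 0) := by
      have hc : Continuous fun ρ : ℝ => ENNReal.ofReal (L * (4 * ρ)) ^ θ * H univ := by
        refine ENNReal.continuous_mul_const (measure_ne_top _ _) |>.comp ?_
        exact ENNReal.continuous_rpow_const.comp (ENNReal.continuous_ofReal.comp (by fun_prop))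
      simpa [hθ0] using hc.tendsto 0
    exact (ENNReal.tendsto_nhds_zero.1 (h1.mono_left nhdsWithin_le_nhds)) (δ / 2)
      (ENNReal.half_pos hδ)
  have e2 : ∀ᶠ ρ in 𝓝[>] (0 : ℝ), (L : ℝ≥0∞) ^ θ * ν (boundaryLayer Ω ρ) ≤ δ / 2 := by
    have h1 := ENNReal.Tendsto.const_mul (a := (L : ℝ≥0∞) ^ θ)
      (tendsto_measure_boundaryLayer hΩ hne ν)
      (Or.inr (ENNReal.rpow_ne_top_of_nonneg hθ0.le ENNReal.coe_ne_top))
    rw [mul_zero] at h1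
    exact (ENNReal.tendsto_nhds_zero.1 h1) (δ / 2) (ENNReal.half_pos hδ)
  have e3 : ∀ᶠ ρ in 𝓝[>] (0 : ℝ), ρ ∈ Ioo 0 (min 1 (Metric.diam (frontier Ω))) :=
    Ioo_mem_nhdsGT (lt_min one_pos hdiam)
  filter_upwards [e1, e2, e3] with ρ h1 h2 h3
  have hρ : 0 < ρ := h3.1
  have hρ1 : ρ ≤ 1 := (h3.2.trans_le (min_le_left _ _)).le
  have hδ2 : δ / 2 ≤ δ := ENNReal.half_le_self
  have hlayer := hK F L hF ρ hρ (h3.2.trans_le (min_le_right _ _))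
  rw [lintegral_add_right _ measurable_const, lintegral_const] at hlayer
  have hlayer' : ∫⁻ x in boundaryLayer Ω ρ, ‖F x‖ₑ ^ θ ∂ν ≤
      K * (ENNReal.ofReal (ρ ^ θ) * (A + δ / 2)) := by
    refine hlayer.trans ?_
    gcongr
  constructor
  · calc ∫⁻ x : Ω, ‖F x * boundaryCutoff Ω ρ x‖ₑ ^ θ ∂ν
        ≤ ∫⁻ x, (boundaryLayer Ω ρ).indicator (fun x => ‖F x‖ₑ ^ θ) x ∂ν := by
          refine lintegral_mono fun x => ?_
          refine (ENNReal.rpow_le_rpow (enorm_mul_boundaryCutoff_le F hρ x) hθ0.le).trans ?_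
          by_cases hx : x ∈ boundaryLayer Ω ρ
          · simp [hx]
          · simp [hx, hθ0]
      _ = ∫⁻ x in boundaryLayer Ω ρ, ‖F x‖ₑ ^ θ ∂ν :=
          lintegral_indicator (measurableSet_boundaryLayer ρ) _
      _ ≤ K * (1 * (A + δ)) := by
          refine hlayer'.trans ?_
          gcongr
          rw [ENNReal.ofReal_le_one]
          exact Real.rpow_le_one hρ.le hρ1 hθ0.le
      _ ≤ K' * (A + δ) := by
          rw [one_mul]
          gcongr
          exact le_self_add
  · have hscale : ENNReal.ofReal (2 / ρ) ^ θ * ENNReal.ofReal (ρ ^ θ) = 2 ^ θ := by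
      rw [← ENNReal.ofReal_rpow_of_pos hρ, ← ENNReal.mul_rpow_of_nonneg _ _ hθ0.le,
        ← ENNReal.ofReal_mul (by positivity), div_mul_cancel₀ _ hρ.ne']
      simp
    calc ∫⁻ x, layerGradient Ω F L ρ x ^ θ ∂ν
        = ∫⁻ x in boundaryLayer Ω ρ, (ENNReal.ofReal (2 / ρ) * ‖F x‖ₑ + L) ^ θ ∂ν := by
          rw [← lintegral_indicator (measurableSet_boundaryLayer ρ)]
          refine lintegral_congr fun x => ?_
          by_cases hx : x ∈ boundaryLayer Ω ρ
          · simp [layerGradient, hx]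
          · simp [layerGradient, hx, hθ0]
      _ ≤ ∫⁻ x in boundaryLayer Ω ρ,
            2 ^ (θ - 1) * (ENNReal.ofReal (2 / ρ) ^ θ * ‖F x‖ₑ ^ θ + (L : ℝ≥0∞) ^ θ) ∂ν := by
          refine lintegral_mono fun x => ?_
          rw [← ENNReal.mul_rpow_of_nonneg _ _ hθ0.le]
          exact ENNReal.rpow_add_le_mul_rpow_add_rpow _ _ hθ
      _ = 2 ^ (θ - 1) * (ENNReal.ofReal (2 / ρ) ^ θ * (∫⁻ x in boundaryLayer Ω ρ, ‖F x‖ₑ ^ θ ∂ν)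
            + (L : ℝ≥0∞) ^ θ * ν (boundaryLayer Ω ρ)) := by
          rw [lintegral_const_mul' _ _ h2t, lintegral_add_right _ measurable_const,
            lintegral_const_mul' _ _ (ENNReal.rpow_ne_top_of_nonneg hθ0.le ENNReal.ofReal_ne_top),
            setLIntegral_const]
      _ ≤ 2 ^ (θ - 1) * (ENNReal.ofReal (2 / ρ) ^ θ * (K * (ENNReal.ofReal (ρ ^ θ) * (A + δ)))
            + (A + δ)) := by
          gcongr
          · exact hlayer'.trans (by gcongr)
          · exact h2.trans (hδ2.trans le_add_self)
      _ = 2 ^ (θ - 1) * ((ENNReal.ofReal (2 / ρ) ^ θ * ENNReal.ofReal (ρ ^ θ)) * K + 1) *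
            (A + δ) := by ring
      _ ≤ K' * (A + δ) := by
          rw [hscale]
          gcongr
          exact le_add_self

end BoundaryLayer

/-! ### Approximation and the choice of the layer widths -/

theorem exists_lipschitzWith_extension {X : Type*} [PseudoMetricSpace X] {S : Set X} {K : ℝ≥0}
    {g : S → ℝ} (hg : LipschitzWith K g) :
    ∃ G : X → ℝ, LipschitzWith K G ∧ ∀ z : S, G z = g z := by
  classical
  have h : LipschitzOnWith K (fun x => if hx : x ∈ S then g ⟨x, hx⟩ else 0) S := by
    refine LipschitzOnWith.of_dist_le_mul fun x hx y hy => ?_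
    simp only [hx, hy, dif_pos]
    exact hg.dist_le_mul ⟨x, hx⟩ ⟨y, hy⟩
  obtain ⟨G, hG, hGS⟩ := h.extend_real
  refine ⟨G, hG, fun z => ?_⟩
  rw [← hGS z.2]
  simp

/-- Recursive choice of a sequence of small positive numbers. -/
theorem exists_seq_of_eventually {Q : ℕ → ℝ → ℝ → Prop}
    (h : ∀ (k : ℕ) (s : ℝ), 0 < s → ∀ᶠ ρ in 𝓝[>] (0 : ℝ), Q k s ρ) :
    ∃ ρ : ℕ → ℝ, (∀ k, 0 < ρ k) ∧ Q 0 1 (ρ 0) ∧ ∀ k, Q (k + 1) (ρ k) (ρ (k + 1)) := by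
  have h' : ∀ (k : ℕ) (s : {s : ℝ // 0 < s}), ∃ ρ : {s : ℝ // 0 < s}, Q k s ρ := by
    intro k s
    obtain ⟨ρ, hρ, hρ'⟩ := ((h k s s.2).and self_mem_nhdsWithin).exists
    exact ⟨⟨ρ, hρ'⟩, hρ⟩
  choose F hF using h'
  refine ⟨fun n => (Nat.rec (F 0 ⟨1, one_pos⟩) (fun k r => F (k + 1) r) n : {s : ℝ // 0 < s}),
    fun k => Subtype.prop _, hF 0 ⟨1, one_pos⟩, fun k => hF (k + 1) _⟩

theorem exists_between_of_tendsto_zero {ρ : ℕ → ℝ} (h0 : Tendsto ρ atTop (𝓝 0)) {r : ℝ}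
    (hr : 0 < r) {n : ℕ} (hn : r ≤ ρ n) : ∃ K, n ≤ K ∧ ρ (K + 1) < r ∧ r ≤ ρ K := by
  have hex : ∃ m, ρ (n + m) < r := by
    obtain ⟨m, hm⟩ := eventually_atTop.1 (h0.eventually (gt_mem_nhds hr))
    exact ⟨m, hm _ (Nat.le_add_left _ _)⟩
  classical
  obtain ⟨j, hj⟩ : ∃ j, Nat.find hex = j + 1 := by
    refine Nat.exists_eq_succ_of_ne_zero fun h => ?_
    have := Nat.find_spec hex
    rw [h, add_zero] at this
    linarith
  refine ⟨n + j, Nat.le_add_right _ _, ?_, ?_⟩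
  · have := Nat.find_spec hex
    rwa [hj] at this
  · exact not_lt.1 (Nat.find_min hex (by omega : j < Nat.find hex))

/-- A series of functions whose `L^p` norms decay like `8 ^ (-k)`. -/
theorem lintegral_tsum_rpow_le {Y : Type*} [MeasurableSpace Y] {ν : Measure Y} {p : ℝ}
    (hp : 1 ≤ p) {a : ℕ → Y → ℝ≥0∞} (ha : ∀ k, Measurable (a k)) {K N : ℝ≥0∞}
    (hK : ∀ k, ∫⁻ x, a k x ^ p ∂ν ≤ K * (N * (8 : ℝ≥0∞)⁻¹ ^ k) ^ p) :
    ∫⁻ x, (∑' k, a k x) ^ p ∂ν ≤ 2 ^ p * (1 - (4 : ℝ≥0∞)⁻¹)⁻¹ * K * N ^ p := by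
  have hp0 : 0 < p := by linarith
  have h2 : (2 : ℝ≥0∞) ^ p ≠ ∞ := ENNReal.rpow_ne_top_of_nonneg hp0.le (by simp)
  have h28 : ∀ k : ℕ, (2 : ℝ≥0∞) ^ k * (8 : ℝ≥0∞)⁻¹ ^ k = (4 : ℝ≥0∞)⁻¹ ^ k := by
    intro k
    rw [← mul_pow]
    congr 1
    rw [show (8 : ℝ≥0∞) = 2 * 4 by norm_num, ENNReal.mul_inv (by simp) (by simp), ← mul_assoc,
      ENNReal.mul_inv_cancel (by simp) (by simp), one_mul]
  have h4 : ∀ k : ℕ, ((4 : ℝ≥0∞)⁻¹ ^ k) ^ p ≤ (4 : ℝ≥0∞)⁻¹ ^ k := by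
    intro k
    refine ENNReal.rpow_le_self_of_le_one (pow_le_one₀ zero_le ?_) hp
    exact ENNReal.inv_le_one.2 (by norm_num)
  calc _ ≤ ∫⁻ x, 2 ^ p * ∑' k, (2 ^ k * a k x) ^ p ∂ν :=
        lintegral_mono fun x => ENNReal.tsum_rpow_le_tsum_two_pow_mul_rpow hp0 _
    _ = 2 ^ p * ∑' k, ∫⁻ x, (2 ^ k * a k x) ^ p ∂ν := by
        rw [lintegral_const_mul' _ _ h2, lintegral_tsum]
        exact fun k => (((ha k).const_mul _).pow_const _).aemeasurable
    _ ≤ 2 ^ p * ∑' k : ℕ, K * N ^ p * (4 : ℝ≥0∞)⁻¹ ^ k := by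
        refine mul_le_mul_right (ENNReal.tsum_le_tsum fun k => ?_) _
        calc ∫⁻ x, (2 ^ k * a k x) ^ p ∂ν = (2 ^ k) ^ p * ∫⁻ x, a k x ^ p ∂ν := by
              rw [← lintegral_const_mul _ ((ha k).pow_const _)]
              refine lintegral_congr fun x => ENNReal.mul_rpow_of_nonneg _ _ hp0.le
          _ ≤ (2 ^ k) ^ p * (K * (N * (8 : ℝ≥0∞)⁻¹ ^ k) ^ p) := by gcongr; exact hK k
          _ = K * N ^ p * ((2 : ℝ≥0∞) ^ k * (8 : ℝ≥0∞)⁻¹ ^ k) ^ p := by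
              rw [ENNReal.mul_rpow_of_nonneg _ _ hp0.le, ENNReal.mul_rpow_of_nonneg _ _ hp0.le]
              ring
          _ ≤ K * N ^ p * (4 : ℝ≥0∞)⁻¹ ^ k := by
              rw [h28]
              gcongr
              exact h4 k
    _ = _ := by rw [ENNReal.tsum_mul_left, ENNReal.tsum_geometric]; ring

section Extension

variable {X : Type*} [MetricSpace X] [MeasurableSpace X] [BorelSpace X] {Ω : Set X}
  {H : Measure (frontier Ω)} {θ : ℝ}

/-- Rapid approximation of a boundary function by restrictions of Lipschitz functions. -/
theorem exists_lipschitz_approx [IsFiniteMeasure H] (hθ : 1 ≤ θ) {f : frontier Ω → ℝ}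
    (hf : MemLp f (ENNReal.ofReal θ) H) (h0 : eLpNorm f (ENNReal.ofReal θ) H ≠ 0) :
    ∃ (φ : ℕ → X → ℝ) (L : ℕ → ℝ≥0), φ 0 = 0 ∧ (∀ k, LipschitzWith (L k) (φ k)) ∧
      ∀ k, eLpNorm (fun z : frontier Ω => f z - φ k z) (ENNReal.ofReal θ) H ≤
        eLpNorm f (ENNReal.ofReal θ) H * (8 : ℝ≥0∞)⁻¹ ^ k := by
  have h1 : ∀ k : ℕ, ∃ (φ : X → ℝ) (L : ℝ≥0), (k = 0 → φ = 0) ∧ LipschitzWith L φ ∧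
      eLpNorm (fun z : frontier Ω => f z - φ z) (ENNReal.ofReal θ) H ≤
        eLpNorm f (ENNReal.ofReal θ) H * (8 : ℝ≥0∞)⁻¹ ^ k := by
    intro k
    rcases Nat.eq_zero_or_pos k with rfl | hk
    · refine ⟨0, 0, fun _ => rfl, LipschitzWith.const _, ?_⟩
      simp
    · have hε : eLpNorm f (ENNReal.ofReal θ) H * (8 : ℝ≥0∞)⁻¹ ^ k ≠ 0 :=
        mul_ne_zero h0 (pow_ne_zero _ (ENNReal.inv_ne_zero.2 (by simp)))
      obtain ⟨g, hg, L, hL⟩ := hf.exists_lipschitz_eLpNorm_sub_le (by simpa using hθ)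
        ENNReal.ofReal_ne_top hε
      obtain ⟨G, hG, hGg⟩ := exists_lipschitzWith_extension hL
      refine ⟨G, L, fun h => absurd h hk.ne', hG, ?_⟩
      simp only [hGg]
      exact hg
  choose φ L h2 h3 h4 using h1
  exact ⟨φ, L, h2 0 rfl, h3, h4⟩

variable {μ : Measure X}

/-- The conditions on the width `ρ` of the `k`-th boundary layer, given the width `s` of the
preceding layer: both the energy of the `k`-th term and the influence of the `k`-th term on the
means over balls of radius at least `s` are small. -/
structure IsLayerWidth (ν : Measure Ω) (θ : ℝ) (K : ℝ≥0) (N : ℝ≥0∞) (φ : ℕ → X → ℝ) (L : ℕ → ℝ≥0)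
    (k : ℕ) (s ρ : ℝ) : Prop where
  le_half : ρ ≤ s / 2
  norm_le : ∫⁻ x : Ω, ‖(φ (k + 1) x - φ k x) * boundaryCutoff Ω ρ x‖ₑ ^ θ ∂ν ≤
    K * (N * (8 : ℝ≥0∞)⁻¹ ^ k) ^ θ
  energy_le : ∫⁻ x, layerGradient Ω (fun x => φ (k + 1) x - φ k x) (L (k + 1) + L k) ρ x ^ θ ∂ν ≤
    K * (N * (8 : ℝ≥0∞)⁻¹ ^ k) ^ θ
  lip_le : ((L k : ℝ) + L (k + 1) + L (k + 2)) * ρ ≤ (1 / 2) ^ k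
  mean_le : ∀ z ∈ closure Ω,
    ∫⁻ x : Ω, ‖(φ (k + 1) x - φ k x) * boundaryCutoff Ω ρ x‖ₑ ∂ν ≤
      ENNReal.ofReal ((1 / 2) ^ k) * ν (ballIn Ω z s)

theorem HasCodimLowerBound.exists_eventually_isLayerWidth {ν : Measure Ω} [IsFiniteMeasure ν]
    {C c : ℝ≥0} (h : HasCodimLowerBound ν H θ C) (hd : IsClosureDoubling ν c) [IsFiniteMeasure H]
    (hΩ : IsMetricDomain Ω) (hb : Bornology.IsBounded Ω)
    (hdiam : 0 < Metric.diam (frontier Ω)) (hθ : 1 ≤ θ) :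
    ∃ K : ℝ≥0, ∀ (f : frontier Ω → ℝ), MemLp f (ENNReal.ofReal θ) H →
      eLpNorm f (ENNReal.ofReal θ) H ≠ 0 → ∀ (φ : ℕ → X → ℝ) (L : ℕ → ℝ≥0),
      (∀ k, LipschitzWith (L k) (φ k)) →
      (∀ k, eLpNorm (fun z : frontier Ω => f z - φ k z) (ENNReal.ofReal θ) H ≤
        eLpNorm f (ENNReal.ofReal θ) H * (8 : ℝ≥0∞)⁻¹ ^ k) →
      ∀ (k : ℕ) (s : ℝ), 0 < s →
        ∀ᶠ ρ in 𝓝[>] (0 : ℝ),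
          IsLayerWidth ν θ K (eLpNorm f (ENNReal.ofReal θ) H) φ L k s ρ := by
  have hθ0 : 0 < θ := by linarith
  have hpne : ENNReal.ofReal θ ≠ 0 := by simpa using hθ0
  have hne : (frontier Ω).Nonempty := by
    by_contra hcon
    rw [not_nonempty_iff_eq_empty] at hcon
    simp [hcon] at hdiam
  obtain ⟨K, hK⟩ := h.exists_eventually_layer_le hd hΩ.1 hdiam hθ
  have h2t : (2 : ℝ≥0∞) ^ θ ≠ ∞ := ENNReal.rpow_ne_top_of_nonneg hθ0.le (by simp)
  refine ⟨K * ((2 : ℝ≥0∞) ^ θ + 1).toNNReal, fun f hf hf0 φ L hL happ k s hs => ?_⟩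
  set N := eLpNorm f (ENNReal.ofReal θ) H with hN
  set F : X → ℝ := fun x => φ (k + 1) x - φ k x with hF
  have hFL : LipschitzWith (L (k + 1) + L k) F := (hL (k + 1)).sub (hL k)
  set ε := N * (8 : ℝ≥0∞)⁻¹ ^ k with hε
  have hε0 : ε ^ θ ≠ 0 := by
    refine (ENNReal.rpow_pos (pos_iff_ne_zero.2 (mul_ne_zero hf0 ?_)) ?_).ne'
    · exact pow_ne_zero _ (ENNReal.inv_ne_zero.2 (by simp))
    · exact ENNReal.mul_ne_top hf.2.ne (by finiteness)
  have hFε : ∫⁻ z : frontier Ω, ‖F z‖ₑ ^ θ ∂H ≤ 2 ^ θ * ε ^ θ := by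
    have hm : ∀ j, AEStronglyMeasurable (fun z : frontier Ω => f z - φ j z) H := fun j =>
      hf.1.sub (((hL j).continuous.comp continuous_subtype_val).aestronglyMeasurable)
    have h1 : eLpNorm (fun z : frontier Ω => F z) (ENNReal.ofReal θ) H ≤ 2 * ε := by
      have e : (fun z : frontier Ω => F z) =
          (fun z : frontier Ω => f z - φ k z) - fun z : frontier Ω => f z - φ (k + 1) z := by
        ext z; simp [hF]
      rw [e, two_mul]
      refine (eLpNorm_sub_le (hm k) (hm (k + 1)) (by simpa using hθ)).trans
        (add_le_add (happ k) ((happ (k + 1)).trans ?_))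
      rw [hε, pow_succ]
      gcongr
      exact mul_le_of_le_one_right zero_le (ENNReal.inv_le_one.2 (by norm_num))
    rw [eLpNorm_eq_lintegral_rpow_enorm_toReal hpne ENNReal.ofReal_ne_top,
      ENNReal.toReal_ofReal hθ0.le, one_div, ENNReal.rpow_inv_le_iff hθ0,
      ENNReal.mul_rpow_of_nonneg _ _ hθ0.le] at h1
    exact h1
  have hKε : K * ((∫⁻ z : frontier Ω, ‖F z‖ₑ ^ θ ∂H) + ε ^ θ) ≤
      (K * ((2 : ℝ≥0∞) ^ θ + 1).toNNReal : ℝ≥0) * ε ^ θ := by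
    rw [ENNReal.coe_mul, ENNReal.coe_toNNReal (by finiteness), mul_assoc, add_mul, one_mul]
    gcongr
  obtain ⟨x₀, hx₀⟩ := hΩ.2.nonempty
  set B : ℝ := |F x₀| + (L (k + 1) + L k : ℝ≥0) * Metric.diam Ω with hB
  have hFB : ∀ x : Ω, ‖F x‖ₑ ≤ ENNReal.ofReal B := by
    intro x
    rw [Real.enorm_eq_ofReal_abs]
    refine ENNReal.ofReal_le_ofReal ?_
    have h1 : |F x - F x₀| ≤ (L (k + 1) + L k : ℝ≥0) * Metric.diam Ω := by
      rw [← Real.dist_eq]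
      refine (hFL.dist_le_mul _ _).trans ?_
      gcongr
      exact Metric.dist_le_diam_of_mem hb x.2 hx₀
    calc |F x| = |F x₀ + (F x - F x₀)| := by congr 1; ring
      _ ≤ |F x₀| + |F x - F x₀| := abs_add_le _ _
      _ ≤ B := by rw [hB]; gcongr
  obtain ⟨η, hη, hη'⟩ := hd.exists_lower_bound hb hΩ.2.nonempty hs
  have e1 : ∀ᶠ ρ in 𝓝[>] (0 : ℝ), ρ ∈ Ioo 0 (s / 2) := Ioo_mem_nhdsGT (half_pos hs)
  have e2 : ∀ᶠ ρ in 𝓝[>] (0 : ℝ), ((L k : ℝ) + L (k + 1) + L (k + 2)) * ρ ≤ (1 / 2) ^ k := by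
    have h1 : Tendsto (fun ρ : ℝ => ((L k : ℝ) + L (k + 1) + L (k + 2)) * ρ) (𝓝 0) (𝓝 0) := by
      have : Continuous fun ρ : ℝ => ((L k : ℝ) + L (k + 1) + L (k + 2)) * ρ := by fun_prop
      simpa using this.tendsto 0
    exact (h1.mono_left nhdsWithin_le_nhds).eventually (ge_mem_nhds (by positivity))
  have e3 : ∀ᶠ ρ : ℝ in 𝓝[>] (0 : ℝ), ENNReal.ofReal B * ν (boundaryLayer Ω ρ) ≤
      ENNReal.ofReal ((1 / 2) ^ k) * η := by
    have h1 := ENNReal.Tendsto.const_mul (a := ENNReal.ofReal B)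
      (tendsto_measure_boundaryLayer hΩ.1 hne ν) (Or.inr ENNReal.ofReal_ne_top)
    rw [mul_zero] at h1
    refine (ENNReal.tendsto_nhds_zero.1 h1) _ (ENNReal.mul_pos ?_ ?_)
    · simp
    · exact_mod_cast hη.ne'
  filter_upwards [e1, e2, e3, hK F _ hFL _ hε0] with ρ h1 h2 h3 h4
  refine ⟨h1.2.le, h4.1.trans hKε, h4.2.trans hKε, h2, fun z hz => ?_⟩
  calc ∫⁻ x : Ω, ‖F x * boundaryCutoff Ω ρ x‖ₑ ∂ν
      ≤ ∫⁻ x, (boundaryLayer Ω ρ).indicator (fun _ => ENNReal.ofReal B) x ∂ν := by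
        refine lintegral_mono fun x => (enorm_mul_boundaryCutoff_le F h1.1 x).trans ?_
        exact indicator_le_indicator (hFB x)
    _ = ENNReal.ofReal B * ν (boundaryLayer Ω ρ) := by
        rw [lintegral_indicator (measurableSet_boundaryLayer ρ), setLIntegral_const]
    _ ≤ ENNReal.ofReal ((1 / 2) ^ k) * η := h3
    _ ≤ _ := by gcongr; exact hη' z hz

end Extension

/-! ### The extension operator -/

section ExtensionOperator

variable {X : Type*} [MetricSpace X] [MeasurableSpace X] [BorelSpace X] {Ω : Set X}
  {H : Measure (frontier Ω)} {θ : ℝ} {μ : Measure X}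

omit [MeasurableSpace X] [BorelSpace X] in
theorem continuous_boundaryCutoff (ρ : ℝ) : Continuous (boundaryCutoff Ω ρ) := by
  unfold boundaryCutoff
  have := Metric.continuous_infDist_pt (frontier Ω)
  fun_prop

/-- The sum of the boundary layer terms extends the limit of `φ k` from the boundary, at every
boundary point where the approximation converges. No maximal function is needed: at a radius
between the widths of two consecutive layers, the outer terms telescope, the inner terms
have small mean, and two terms remain. -/
theorem hasTraceAt_tsum_layers {c : ℝ≥0} [IsFiniteMeasure (measureOn μ Ω)]
    (hd : IsClosureDoubling (measureOn μ Ω) c) (hΩ : IsOpen Ω)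
    {K : ℝ≥0} {N : ℝ≥0∞} {φ : ℕ → X → ℝ} {L : ℕ → ℝ≥0} (hφ0 : φ 0 = 0)
    (hL : ∀ k, LipschitzWith (L k) (φ k)) {ρ : ℕ → ℝ} (hρ : ∀ k, 0 < ρ k)
    (hQ : ∀ k, IsLayerWidth (measureOn μ Ω) θ K N φ L (k + 1) (ρ k) (ρ (k + 1)))
    (hρ0 : Tendsto ρ atTop (𝓝 0))
    (hlip : ∀ k, ((L k : ℝ) + L (k + 1) + L (k + 2)) * ρ k ≤ (1 / 2) ^ k)
    {z : X} (hz : z ∈ frontier Ω) {b : ℝ} (hb : Tendsto (fun k => φ k z) atTop (𝓝 b)) :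
    HasTraceAt μ Ω (fun x => ∑' k, (φ (k + 1) x - φ k x) * boundaryCutoff Ω (ρ k) x) z b := by
  set ν := measureOn μ Ω with hν
  have hzc := frontier_subset_closure hz
  set h : ℕ → Ω → ℝ := fun k x => (φ (k + 1) x - φ k x) * boundaryCutoff Ω (ρ k) x with hh
  have hhm : ∀ k, Measurable (h k) := fun k =>
    ((((hL (k + 1)).continuous.sub (hL k).continuous).mul
      (continuous_boundaryCutoff (ρ k))).comp continuous_subtype_val).measurable
  have hanti : Antitone ρ := antitone_nat_of_succ_le fun k =>
    (hQ k).le_half.trans (by linarith [hρ k])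
  have hhalf : ∀ {k K : ℕ}, k < K → ρ K ≤ ρ k / 2 := fun {k K} hkK =>
    (hanti (Nat.succ_le_of_lt hkK)).trans (hQ k).le_half
  have hsummable : ∀ x, Summable fun k => h k x := by
    intro x
    have hpos := infDist_frontier_pos hΩ ⟨z, hz⟩ x.2
    obtain ⟨n, hn⟩ := eventually_atTop.1 (hρ0.eventually (gt_mem_nhds hpos))
    refine summable_of_ne_finset_zero (s := Finset.range n) fun k hk => ?_
    have : n ≤ k := by simpa using hk
    simp only [hh]
    rw [boundaryCutoff_eq_zero (hρ k) (hn k this).le, mul_zero]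
  set δ : ℕ → ℝ≥0∞ := fun k => ENNReal.ofReal ((1 / 2) ^ k) with hδ
  have hδsum : ∑' k, δ k ≠ ∞ := summable_geometric_two.tsum_ofReal_ne_top
  set a : ℕ → ℝ≥0∞ := fun k => ‖φ k z - b‖ₑ with ha
  set e : ℕ → ℝ≥0∞ := fun n =>
    (δ n + a n) + ((a (n + 1) + a n) + δ n) + ((a (n + 2) + a (n + 1)) + δ n) +
      ∑' j, δ (j + (n + 2)) with he
  have hbound : ∀ (n : ℕ) (r : ℝ), ρ (n + 1) < r → r ≤ ρ n →
      ⨍⁻ x in ballIn Ω z r, ‖(∑' k, h k x) - b‖ₑ ∂ν ≤ e n := by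
    intro n r hr1 hr2
    have hr : 0 < r := (hρ _).trans hr1
    have h0 : ν (ballIn Ω z r) ≠ 0 := (hd.pos z hzc r hr).ne'
    have ht : ν (ballIn Ω z r) ≠ ∞ := measure_ne_top _ _
    have hlipn : ∀ (M : ℝ≥0), (M : ℝ) ≤ L n + L (n + 1) + L (n + 2) → ∀ (F : X → ℝ),
        LipschitzWith M F → ∀ x ∈ ballIn Ω z r, ‖F x - F z‖ₑ ≤ δ n := by
      intro M hM F hF x hx
      have hxz : dist (x : X) z < r := hx
      rw [Real.enorm_eq_ofReal_abs, ← Real.dist_eq]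
      refine ENNReal.ofReal_le_ofReal ((hF.dist_le_mul _ _).trans (le_trans ?_ (hlip n)))
      exact mul_le_mul hM (hxz.le.trans hr2) dist_nonneg (by positivity)
    -- the two terms at whose cutoffs nothing is known at this radius
    have htwo : ∀ k, (k = n ∨ k = n + 1) → ∀ x ∈ ballIn Ω z r,
        ‖h k x‖ₑ ≤ (a (k + 1) + a k) + δ n := by
      intro k hk x hx
      have h1 := hlipn (L (k + 1) + L k) (by
        rcases hk with rfl | rfl
        · push_cast; linarith [(L (k + 2)).2]
        · push_cast; linarith [(L n).2]) _ ((hL (k + 1)).sub (hL k)) x hx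
      calc ‖h k x‖ₑ ≤ ‖φ (k + 1) x - φ k x‖ₑ := by
            refine (enorm_mul_boundaryCutoff_le (fun x => φ (k + 1) x - φ k x) (hρ k) x).trans ?_
            exact indicator_le_self' (fun _ _ => zero_le) _
        _ = ‖((φ (k + 1) z - b) + -(φ k z - b)) + ((φ (k + 1) x - φ k x) -
              (φ (k + 1) z - φ k z))‖ₑ := by congr 1; ring
        _ ≤ ‖φ (k + 1) z - b‖ₑ + ‖-(φ k z - b)‖ₑ + ‖(φ (k + 1) x - φ k x) -
              (φ (k + 1) z - φ k z)‖ₑ :=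
            (enorm_add_le _ _).trans (add_le_add_left (enorm_add_le _ _) _)
        _ ≤ _ := by rw [enorm_neg]; exact add_le_add_right h1 _
    have hpt : ∀ x ∈ ballIn Ω z r, ‖(∑' k, h k x) - b‖ₑ ≤
        ((δ n + a n) + ((a (n + 1) + a n) + δ n) + ((a (n + 2) + a (n + 1)) + δ n)) +
          ∑' j, ‖h (j + (n + 2)) x‖ₑ := by
      intro x hx
      have hxz : dist (x : X) z < r := hx
      have hxd : Metric.infDist (x : X) (frontier Ω) ≤ ρ n :=
        (Metric.infDist_le_dist_of_mem hz).trans (hxz.le.trans hr2)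
      -- the cutoffs of the outer terms equal `1` on the ball
      have hone : ∀ k ∈ Finset.range n, h k x = φ (k + 1) x - φ k x := by
        intro k hk
        simp only [hh]
        rw [boundaryCutoff_eq_one (hρ k) (hxd.trans (hhalf (Finset.mem_range.1 hk))), mul_one]
      have hsplit : (∑' k, h k x) - b = ((φ n x - φ n z) + (φ n z - b)) + h n x + h (n + 1) x +
          ∑' j, h (j + (n + 2)) x := by
        rw [← (hsummable x).sum_add_tsum_nat_add (n + 2), Finset.sum_range_succ,
          Finset.sum_range_succ, Finset.sum_congr rfl hone,
          Finset.sum_range_sub (fun k => φ k x), hφ0]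
        simp only [Pi.zero_apply]
        ring
      rw [hsplit]
      refine (enorm_add_le _ _).trans (add_le_add ?_ enorm_tsum_le_tsum_enorm)
      refine (enorm_add_le _ _).trans (add_le_add ?_ (htwo (n + 1) (Or.inr rfl) x hx))
      refine (enorm_add_le _ _).trans (add_le_add ?_ (htwo n (Or.inl rfl) x hx))
      refine (enorm_add_le _ _).trans (add_le_add ?_ le_rfl)
      exact hlipn (L n) (by linarith [(L (n + 1)).2, (L (n + 2)).2]) _ (hL n) x hx
    -- the inner terms have been chosen with small means over balls of radius at least `ρ (n + 1)`
    have hmean : ∀ j, (ν (ballIn Ω z r))⁻¹ * ∫⁻ x in ballIn Ω z r, ‖h (j + (n + 2)) x‖ₑ ∂ν ≤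
        δ (j + (n + 2)) := by
      intro j
      rw [mul_comm, ← div_eq_mul_inv]
      refine ENNReal.div_le_of_le_mul ((setLIntegral_le_lintegral _ _).trans
        (((hQ (j + n + 1)).mean_le z hzc).trans ?_))
      refine mul_le_mul_right (measure_mono (ballIn_subset ?_)) _
      rw [dist_self, zero_add]
      exact (hanti (by omega)).trans hr1.le
    have hprob := isProbabilityMeasure_normalized h0 ht
    calc ⨍⁻ x in ballIn Ω z r, ‖(∑' k, h k x) - b‖ₑ ∂ν
        ≤ ⨍⁻ x in ballIn Ω z r, (((δ n + a n) + ((a (n + 1) + a n) + δ n) +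
            ((a (n + 2) + a (n + 1)) + δ n)) + ∑' j, ‖h (j + (n + 2)) x‖ₑ) ∂ν := by
          rw [setLAverage_eq, setLAverage_eq]
          gcongr ?_ / _
          exact setLIntegral_mono' (measurableSet_ballIn _ _) hpt
      _ = ((δ n + a n) + ((a (n + 1) + a n) + δ n) + ((a (n + 2) + a (n + 1)) + δ n)) +
            ∑' j, (ν (ballIn Ω z r))⁻¹ * ∫⁻ x in ballIn Ω z r, ‖h (j + (n + 2)) x‖ₑ ∂ν := by
          rw [laverage, lintegral_add_left measurable_const, lintegral_const, hprob.measure_univ,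
            mul_one, lintegral_tsum fun j => (hhm _).enorm.aemeasurable]
          simp only [lintegral_smul_measure, Measure.restrict_apply_univ, smul_eq_mul]
      _ ≤ e n := add_le_add_right (ENNReal.tsum_le_tsum hmean) _
  have hδ0 : Tendsto δ atTop (𝓝 0) := ENNReal.tendsto_atTop_zero_of_tsum_ne_top hδsum
  have ha0 : Tendsto a atTop (𝓝 0) := by
    simpa only [ha, ← edist_eq_enorm_sub] using tendsto_iff_edist_tendsto_0.1 hb
  have he0 : Tendsto e atTop (𝓝 0) := by
    have ha1 := ha0.comp (tendsto_add_atTop_nat 1)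
    have ha2 := ha0.comp (tendsto_add_atTop_nat 2)
    have ht := (ENNReal.tendsto_sum_nat_add δ hδsum).comp (tendsto_add_atTop_nat 2)
    have := (((hδ0.add ha0).add ((ha1.add ha0).add hδ0)).add ((ha2.add ha1).add hδ0)).add ht
    simpa using this
  rw [HasTraceAt, ENNReal.tendsto_nhds_zero]
  intro κ hκ
  obtain ⟨n, hn⟩ := eventually_atTop.1 (ENNReal.tendsto_nhds_zero.1 he0 κ hκ)
  have hev : ∀ᶠ r in 𝓝[>] (0 : ℝ), r ∈ Ioo 0 (ρ n) := Ioo_mem_nhdsGT (hρ n)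
  filter_upwards [hev] with r hr
  obtain ⟨m, hnm, hm1, hm2⟩ := exists_between_of_tendsto_zero hρ0 hr.1 hr.2.le
  exact (hbound m r hm1 hm2).trans (hn m hnm)

/-- The hypothesis on `γ` only serves to exchange the sum and the line integral. -/
theorem isUpperGradient_tsum {Y : Type*} [MetricSpace Y] [MeasurableSpace Y] {h : ℕ → Y → ℝ}
    {g : ℕ → Y → ℝ≥0∞} (hg : ∀ k, IsUpperGradient (h k) (g k))
    (hs : ∀ x, Summable fun k => h k x) (hγ : ∀ (l : ℝ) (γ : ℝ → Y), HasUnitSpeedOn γ (Icc 0 l) →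
      ∀ k, AEMeasurable (fun t => g k (γ t)) (volume.restrict (Icc 0 l))) :
    IsUpperGradient (fun x => ∑' k, h k x) (fun x => ∑' k, g k x) := by
  refine ⟨Measurable.tsum fun k => (hg k).1, fun l γ hl hγ' => ?_⟩
  rw [lintegral_tsum (hγ l γ hγ')]
  rw [← (hs _).tsum_sub (hs _), ← Real.enorm_eq_ofReal_abs]
  refine enorm_tsum_le_tsum_enorm.trans (ENNReal.tsum_le_tsum fun k => ?_)
  rw [Real.enorm_eq_ofReal_abs]
  exact (hg k).2 l γ hl hγ'

/-- Every nonzero boundary function has an extension, with norm controlled by its `L^θ` norm. -/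
theorem HasCodimLowerBound.exists_extension [IsFiniteMeasure (measureOn μ Ω)]
    {C c : ℝ≥0} (h : HasCodimLowerBound (measureOn μ Ω) H θ C)
    (hd : IsClosureDoubling (measureOn μ Ω) c) [IsFiniteMeasure H]
    (hΩ : IsMetricDomain Ω) (hb : Bornology.IsBounded Ω)
    (hdiam : 0 < Metric.diam (frontier Ω)) (hθ : 1 ≤ θ) :
    ∃ K : ℝ≥0, ∀ (f : frontier Ω → ℝ), MemLp f (ENNReal.ofReal θ) H →
      eLpNorm f (ENNReal.ofReal θ) H ≠ 0 → ∃ (u : Ω → ℝ) (g : Ω → ℝ≥0∞), Measurable u ∧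
        IsUpperGradient u g ∧ HasTrace μ Ω H u f ∧
        ∫⁻ x, ‖u x‖ₑ ^ θ ∂(measureOn μ Ω) ≤ K * eLpNorm f (ENNReal.ofReal θ) H ^ θ ∧
        ∫⁻ x, g x ^ θ ∂(measureOn μ Ω) ≤ K * eLpNorm f (ENNReal.ofReal θ) H ^ θ := by
  have hθ0 : 0 < θ := by linarith
  have hpne : ENNReal.ofReal θ ≠ 0 := by simpa using hθ0
  have hne : (frontier Ω).Nonempty := by
    by_contra hcon
    rw [not_nonempty_iff_eq_empty] at hcon
    simp [hcon] at hdiam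
  obtain ⟨K, hK⟩ := h.exists_eventually_isLayerWidth hd hΩ hb hdiam hθ
  have h2t : (2 : ℝ≥0∞) ^ θ ≠ ∞ := ENNReal.rpow_ne_top_of_nonneg hθ0.le (by simp)
  have h4t : (1 - (4 : ℝ≥0∞)⁻¹)⁻¹ ≠ ∞ := by
    refine ENNReal.inv_ne_top.2 (tsub_pos_of_lt ?_).ne'
    exact ENNReal.inv_lt_one.2 (by norm_num)
  refine ⟨((2 : ℝ≥0∞) ^ θ * (1 - (4 : ℝ≥0∞)⁻¹)⁻¹ * K).toNNReal, fun f hf hf0 => ?_⟩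
  rw [ENNReal.coe_toNNReal (by finiteness)]
  set ν := measureOn μ Ω with hν
  set N := eLpNorm f (ENNReal.ofReal θ) H with hN
  obtain ⟨φ, L, hφ0, hL, happ⟩ := exists_lipschitz_approx hθ hf hf0
  obtain ⟨ρ, hρ, hQ0, hQ⟩ := exists_seq_of_eventually (hK f hf hf0 φ L hL happ)
  have hQk : ∀ k, ∃ s, IsLayerWidth ν θ K N φ L k s (ρ k) := by
    rintro (_ | k)
    exacts [⟨1, hQ0⟩, ⟨ρ k, hQ k⟩]
  have hlip : ∀ k, ((L k : ℝ) + L (k + 1) + L (k + 2)) * ρ k ≤ (1 / 2) ^ k := fun k =>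
    (hQk k).choose_spec.lip_le
  have hρle : ∀ k, ρ k ≤ (1 / 2) ^ k := by
    intro k
    induction k with
    | zero => linarith [hQ0.le_half]
    | succ k ih => rw [pow_succ]; linarith [(hQ k).le_half]
  have hρ0 : Tendsto ρ atTop (𝓝 0) := squeeze_zero (fun k => (hρ k).le) hρle
    (tendsto_pow_atTop_nhds_zero_of_lt_one (by norm_num) (by norm_num))
  set w : ℕ → Ω → ℝ := fun k x => (φ (k + 1) x - φ k x) * boundaryCutoff Ω (ρ k) x with hw
  have hwm : ∀ k, Measurable (w k) := fun k =>
    ((((hL (k + 1)).continuous.sub (hL k).continuous).mul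
      (continuous_boundaryCutoff (ρ k))).comp continuous_subtype_val).measurable
  have hsummable : ∀ x, Summable fun k => w k x := by
    intro x
    have hpos := infDist_frontier_pos hΩ.1 hne x.2
    obtain ⟨n, hn⟩ := eventually_atTop.1 (hρ0.eventually (gt_mem_nhds hpos))
    refine summable_of_ne_finset_zero (s := Finset.range n) fun k hk => ?_
    have : n ≤ k := by simpa using hk
    simp only [hw]
    rw [boundaryCutoff_eq_zero (hρ k) (hn k this).le, mul_zero]
  set G : ℕ → Ω → ℝ≥0∞ := fun k =>
    layerGradient Ω (fun x => φ (k + 1) x - φ k x) (L (k + 1) + L k) (ρ k) with hG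
  have hFL : ∀ k, LipschitzWith (L (k + 1) + L k) fun x => φ (k + 1) x - φ k x := fun k =>
    (hL (k + 1)).sub (hL k)
  have hGm : ∀ k, Measurable (G k) := fun k => measurable_layerGradient (hFL k) (ρ k)
  refine ⟨fun x => ∑' k, w k x, fun x => ∑' k, G k x, ?_, ?_, ?_, ?_, ?_⟩
  · refine measurable_of_tendsto_metrizable (f := fun n x => ∑ k ∈ Finset.range n, w k x)
      (fun n => Finset.measurable_sum _ fun k _ => hwm k) ?_
    exact tendsto_pi_nhds.2 fun x => (hsummable x).hasSum.tendsto_sum_nat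
  · refine isUpperGradient_tsum (fun k => isUpperGradient_layerGradient (hFL k) (hρ k)) hsummable
      fun l γ hγ k => ?_
    exact (hGm k).comp_aemeasurable
      ((HasUnitSpeedOn.lipschitzOnWith hγ).continuousOn.aemeasurable measurableSet_Icc)
  · have hm : ∀ k, AEMeasurable (fun z : frontier Ω => ‖f z - φ k z‖ₑ ^ θ) H := fun k =>
      ((hf.1.sub (((hL k).continuous.comp continuous_subtype_val).aestronglyMeasurable)).enorm
        ).pow_const θ
    have h1 : ∀ k, ∫⁻ z : frontier Ω, ‖f z - φ k z‖ₑ ^ θ ∂H ≤ N ^ θ * (8 : ℝ≥0∞)⁻¹ ^ k := by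
      intro k
      have h2 := happ k
      rw [eLpNorm_eq_lintegral_rpow_enorm_toReal hpne ENNReal.ofReal_ne_top,
        ENNReal.toReal_ofReal hθ0.le, one_div, ENNReal.rpow_inv_le_iff hθ0,
        ENNReal.mul_rpow_of_nonneg _ _ hθ0.le] at h2
      refine h2.trans (mul_le_mul_right (ENNReal.rpow_le_self_of_le_one ?_ hθ) _)
      exact pow_le_one₀ zero_le (ENNReal.inv_le_one.2 (by norm_num))
    have h2 : ∫⁻ z : frontier Ω, ∑' k, ‖f z - φ k z‖ₑ ^ θ ∂H ≠ ∞ := by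
      rw [lintegral_tsum hm]
      refine ne_top_of_le_ne_top ?_ (ENNReal.tsum_le_tsum h1)
      rw [ENNReal.tsum_mul_left, ENNReal.tsum_geometric]
      refine ENNReal.mul_ne_top (ENNReal.rpow_ne_top_of_nonneg hθ0.le hf.2.ne) ?_
      refine ENNReal.inv_ne_top.2 (tsub_pos_of_lt ?_).ne'
      exact ENNReal.inv_lt_one.2 (by norm_num)
    -- where the sum of the errors is finite, `φ k z` converges to `f z`
    filter_upwards [ae_lt_top' (AEMeasurable.tsum hm) h2] with z hz
    refine hasTraceAt_tsum_layers hd hΩ.1 hφ0 hL hρ hQ hρ0 hlip z.2 ?_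
    have h3 := ENNReal.tendsto_atTop_zero_of_tsum_ne_top hz.ne
    have h4 : Tendsto (fun k => ‖f z - φ k z‖ₑ) atTop (𝓝 0) := by
      have h5 := (ENNReal.continuous_rpow_const (y := θ⁻¹)).continuousAt.tendsto.comp h3
      simpa only [Function.comp_def, ← ENNReal.rpow_mul, mul_inv_cancel₀ hθ0.ne', ENNReal.rpow_one,
        ENNReal.zero_rpow_of_pos (inv_pos.2 hθ0)] using h5
    rw [tendsto_iff_edist_tendsto_0]
    simpa only [edist_comm _ (f z), edist_eq_enorm_sub] using h4
  · refine (lintegral_mono fun x => ENNReal.rpow_le_rpow enorm_tsum_le_tsum_enorm hθ0.le).trans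
      (lintegral_tsum_rpow_le hθ (fun k => (hwm k).enorm) fun k => ?_)
    exact (hQk k).choose_spec.norm_le
  · exact lintegral_tsum_rpow_le hθ hGm fun k => (hQk k).choose_spec.energy_le

omit [BorelSpace X] in
theorem hasTraceAt_const (z : X) (b : ℝ) : HasTraceAt μ Ω (fun _ => b) z b := by
  simp [HasTraceAt, laverage]

/-- The bounded (nonlinear) extension operator, a right inverse of the trace. -/
theorem exists_extensionOperator (hΩ : IsMetricDomain Ω) (hb : Bornology.IsBounded Ω)
    (hθ : 1 ≤ θ) (hμ : IsDoublingOn μ Ω) (hreg : IsCodimRegular μ Ω H θ) :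
    ∃ (E : Lp ℝ (ENNReal.ofReal θ) H → newtonian θ hθ (measureOn μ Ω)) (C : ℝ≥0),
      ∀ f : Lp ℝ (ENNReal.ofReal θ) H,
        newtonNorm θ (measureOn μ Ω) (E f : Ω → ℝ) ≤ C * eLpNorm f (ENNReal.ofReal θ) H ∧
        HasTrace μ Ω H (E f : Ω → ℝ) f := by
  have hθ0 : 0 < θ := by linarith
  have hpne : ENNReal.ofReal θ ≠ 0 := by simpa using hθ0
  have hfin := hμ.isFiniteMeasure hΩ hb
  obtain ⟨c, hc, hd⟩ := hμ.exists_isClosureDoubling hΩ.1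
  obtain ⟨_, hCU⟩ := hreg.exists_upperBound hΩ hb hθ0
  have hHfin := hCU.isFiniteMeasure hΩ hb
  obtain ⟨_, hCL⟩ := hreg.exists_lowerBound hΩ.1
  set ν := measureOn μ Ω with hν
  -- it suffices to treat one nonzero function at a time
  suffices key : ∃ K : ℝ≥0, ∀ f : frontier Ω → ℝ, MemLp f (ENNReal.ofReal θ) H →
      eLpNorm f (ENNReal.ofReal θ) H ≠ 0 → ∃ (u : Ω → ℝ) (g : Ω → ℝ≥0∞), Measurable u ∧
        IsUpperGradient u g ∧ HasTrace μ Ω H u f ∧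
        ∫⁻ x, ‖u x‖ₑ ^ θ ∂ν ≤ K * eLpNorm f (ENNReal.ofReal θ) H ^ θ ∧
        ∫⁻ x, g x ^ θ ∂ν ≤ K * eLpNorm f (ENNReal.ofReal θ) H ^ θ by
    obtain ⟨K, hK⟩ := key
    have hex : ∀ f : Lp ℝ (ENNReal.ofReal θ) H, ∃ u : newtonian θ hθ ν,
        newtonNorm θ ν (u : Ω → ℝ) ≤ ((2 * K) ^ (1 / θ) : ℝ≥0) * eLpNorm f (ENNReal.ofReal θ) H ∧
        HasTrace μ Ω H (u : Ω → ℝ) f := by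
      intro f
      rcases eq_or_ne (eLpNorm f (ENNReal.ofReal θ) H) 0 with h0 | h0
      · refine ⟨0, ?_, ?_⟩
        · have hg : IsUpperGradient (0 : Ω → ℝ) 0 := ⟨measurable_zero, fun l γ _ _ => by simp⟩
          have : newtonNorm θ ν (0 : Ω → ℝ) = 0 := by
            have h1 : (⨅ (g : Ω → ℝ≥0∞) (_ : IsUpperGradient (0 : Ω → ℝ) g), ∫⁻ x, g x ^ θ ∂ν) ≤ 0 :=
              (iInf₂_le _ hg).trans (by simp [hθ0])
            rw [newtonNorm, le_zero_iff.1 h1]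
            simp [hθ0]
          simp [this]
        · have h1 := (eLpNorm_eq_zero_iff (Lp.aestronglyMeasurable f) hpne).1 h0
          filter_upwards [h1] with z hz
          rw [hz]
          exact hasTraceAt_const _ _
      · obtain ⟨u, g, hu, hg, ht, hu1, hg1⟩ := hK f (Lp.memLp f) h0
        have hNt : eLpNorm f (ENNReal.ofReal θ) H ^ θ < ∞ :=
          ENNReal.rpow_lt_top_of_nonneg hθ0.le (Lp.memLp f).2.ne
        have hKN : K * eLpNorm f (ENNReal.ofReal θ) H ^ θ < ∞ :=
          ENNReal.mul_lt_top ENNReal.coe_lt_top hNt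
        refine ⟨⟨u, hu.aestronglyMeasurable, (newtonNorm_lt_top_iff hθ ν u).2
          ⟨hu1.trans_lt hKN, g, hg, hg1.trans_lt hKN⟩⟩, ?_, ht⟩
        calc newtonNorm θ ν u ≤ (K * eLpNorm f (ENNReal.ofReal θ) H ^ θ +
              K * eLpNorm f (ENNReal.ofReal θ) H ^ θ) ^ (1 / θ) := by
              refine ENNReal.rpow_le_rpow (add_le_add hu1 ?_) (by positivity)
              exact (iInf₂_le g hg).trans hg1
          _ = _ := by
              rw [← two_mul, ← mul_assoc, ENNReal.mul_rpow_of_nonneg _ _ (by positivity),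
                ← ENNReal.rpow_mul, mul_one_div_cancel hθ0.ne', ENNReal.rpow_one,
                ENNReal.coe_rpow_of_nonneg _ (by positivity)]
              simp
    choose E hE using hex
    exact ⟨E, _, hE⟩
  rcases (Metric.diam_nonneg (s := frontier Ω)).eq_or_lt with hdiam | hdiam
  · -- the boundary has at most one point, and constant functions are extended by constants
    have hsub : ∀ z w : frontier Ω, z = w := fun z w => by
      have hbd : Bornology.IsBounded (frontier Ω) := hb.closure.subset frontier_subset_closure
      have := Metric.dist_le_diam_of_mem hbd z.2 w.2
      rw [← hdiam] at this
      exact Subtype.ext (dist_le_zero.1 this)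
    refine ⟨(ν univ / H univ).toNNReal, fun f hf hf0 => ?_⟩
    have hH0 : H univ ≠ 0 := by
      intro h0
      rw [Measure.measure_univ_eq_zero] at h0
      simp [h0] at hf0
    obtain ⟨z₀⟩ : Nonempty (frontier Ω) := by
      by_contra hcon
      rw [not_nonempty_iff] at hcon
      simp [H.eq_zero_of_isEmpty] at hH0
    have hfz : f = fun _ => f z₀ := funext fun z => by rw [hsub z z₀]
    have hNorm : eLpNorm f (ENNReal.ofReal θ) H ^ θ = ‖f z₀‖ₑ ^ θ * H univ := by
      rw [eLpNorm_eq_lintegral_rpow_enorm_toReal hpne ENNReal.ofReal_ne_top,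
        ENNReal.toReal_ofReal hθ0.le, ← ENNReal.rpow_mul, one_div_mul_cancel hθ0.ne',
        ENNReal.rpow_one, hfz, lintegral_const]
    refine ⟨fun _ => f z₀, 0, measurable_const, ⟨measurable_zero, fun l γ _ _ => by simp⟩, ?_, ?_, ?_⟩
    · refine Eventually.of_forall fun z => ?_
      rw [hsub z z₀]
      exact hasTraceAt_const _ _
    · rw [hNorm, lintegral_const, ENNReal.coe_toNNReal (ENNReal.div_ne_top (measure_ne_top _ _) hH0)]
      refine le_of_eq ?_
      rw [mul_left_comm, ENNReal.div_mul_cancel hH0 (measure_ne_top _ _)]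
    · simp [hθ0]
  · exact hCL.exists_extension hd hΩ hb hdiam hθ

end ExtensionOperator

/-! ### The weighted disk: basic geometry, ball measures and doubling -/

theorem mem_unitDisk {x : EuclideanSpace ℝ (Fin 2)} : x ∈ unitDisk ↔ ‖x‖ < 1 := by
  simp [unitDisk]

theorem isOpen_unitDisk : IsOpen unitDisk := Metric.isOpen_ball

theorem convex_unitDisk : Convex ℝ unitDisk := convex_ball _ _

theorem isBounded_unitDisk : Bornology.IsBounded unitDisk := Metric.isBounded_ball

theorem closure_unitDisk : closure unitDisk = Metric.closedBall 0 1 :=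
  closure_ball _ one_ne_zero

theorem frontier_unitDisk : frontier unitDisk = Metric.sphere 0 1 :=
  frontier_ball _ one_ne_zero

theorem diam_unitDisk : Metric.diam unitDisk = 2 := by
  rw [unitDisk, Metric.diam_ball_eq _ zero_le_one]; norm_num

theorem isMetricDomain_unitDisk : IsMetricDomain unitDisk :=
  ⟨isOpen_unitDisk, ⟨0, by simp [mem_unitDisk]⟩, convex_unitDisk.isPreconnected⟩

theorem exists_unit_vector_eq_norm_smul (x : EuclideanSpace ℝ (Fin 2)) :
    ∃ e : EuclideanSpace ℝ (Fin 2), ‖e‖ = 1 ∧ x = ‖x‖ • e := by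
  rcases eq_or_ne x 0 with rfl | hx
  · exact ⟨EuclideanSpace.single 0 1, by simp, by simp⟩
  · have h : ‖x‖ ≠ 0 := norm_ne_zero_iff.2 hx
    refine ⟨‖x‖⁻¹ • x, ?_, ?_⟩
    · rw [norm_smul, norm_inv, norm_norm, inv_mul_cancel₀ h]
    · rw [smul_smul, mul_inv_cancel₀ h, one_smul]

theorem infDist_eq_one_sub_norm {x : EuclideanSpace ℝ (Fin 2)} (hx : ‖x‖ ≤ 1)
    {s : Set (EuclideanSpace ℝ (Fin 2))} (hs : Metric.sphere 0 1 ⊆ s)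
    (hs' : ∀ y ∈ s, 1 ≤ ‖y‖) : Metric.infDist x s = 1 - ‖x‖ := by
  obtain ⟨e, he, hxe⟩ := exists_unit_vector_eq_norm_smul x
  have hes : e ∈ s := hs (by simp [he])
  refine le_antisymm ?_ ?_
  · refine (Metric.infDist_le_dist_of_mem hes).trans_eq ?_
    have : x - e = (‖x‖ - 1) • e := by rw [sub_smul, one_smul, ← hxe]
    rw [dist_eq_norm, this, norm_smul, he, Real.norm_eq_abs, abs_of_nonpos (by linarith)]
    ring
  · refine (Metric.le_infDist ⟨e, hes⟩).2 fun y hy => ?_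
    have h1 := hs' y hy
    have h2 := norm_sub_norm_le y x
    rw [dist_eq_norm, norm_sub_rev]
    linarith

theorem infDist_compl_unitDisk {x : EuclideanSpace ℝ (Fin 2)} (hx : ‖x‖ ≤ 1) :
    Metric.infDist x unitDiskᶜ = 1 - ‖x‖ :=
  infDist_eq_one_sub_norm hx
    (fun y hy => by simp only [mem_sphere_zero_iff_norm] at hy; simp [mem_unitDisk, hy])
    fun y hy => by simpa [mem_unitDisk] using hy

theorem infDist_frontier_unitDisk {x : EuclideanSpace ℝ (Fin 2)} (hx : ‖x‖ ≤ 1) :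
    Metric.infDist x (frontier unitDisk) = 1 - ‖x‖ := by
  rw [frontier_unitDisk]
  exact infDist_eq_one_sub_norm hx subset_rfl
    fun y hy => (mem_sphere_zero_iff_norm.1 hy).ge

theorem logWeight_unitDisk (a : ℝ) {x : EuclideanSpace ℝ (Fin 2)} (hx : ‖x‖ ≤ 1) :
    logWeight unitDisk a x = Real.log (4 / (1 - ‖x‖)) ^ a := by
  rw [logWeight, diam_unitDisk, infDist_frontier_unitDisk hx]
  norm_num

open Classical in
theorem measurable_diskDensity (θ : ℝ) : Measurable fun x : EuclideanSpace ℝ (Fin 2) =>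
    if x ∈ unitDisk then ENNReal.ofReal (Metric.infDist x unitDiskᶜ ^ (θ - 1)) else 1 := by
  refine Measurable.ite isOpen_unitDisk.measurableSet ?_ measurable_const
  exact ((Metric.continuous_infDist_pt _).measurable.pow_const _).ennreal_ofReal

/-- Inside the disk the measure has density `(1 - ‖x‖)^(θ - 1)`. -/
theorem setLIntegral_diskMeasure (θ : ℝ) {s : Set (EuclideanSpace ℝ (Fin 2))}
    (hs : MeasurableSet s) (hsD : s ⊆ unitDisk) (f : EuclideanSpace ℝ (Fin 2) → ℝ≥0∞) :
    ∫⁻ x in s, f x ∂diskMeasure θ =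
      ∫⁻ x in s, ENNReal.ofReal ((1 - ‖x‖) ^ (θ - 1)) * f x := by
  rw [diskMeasure, setLIntegral_withDensity_eq_setLIntegral_mul_non_measurable _
    (measurable_diskDensity θ) f hs]
  · refine setLIntegral_congr_fun hs fun x hx => ?_
    simp only [Pi.mul_apply, hsD hx, if_true]
    rw [infDist_compl_unitDisk (mem_unitDisk.1 (hsD hx)).le]
  · refine Eventually.of_forall fun x => ?_
    split_ifs <;> simp

theorem diskMeasure_apply (θ : ℝ) {s : Set (EuclideanSpace ℝ (Fin 2))}
    (hs : MeasurableSet s) (hsD : s ⊆ unitDisk) :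
    diskMeasure θ s = ∫⁻ x in s, ENNReal.ofReal ((1 - ‖x‖) ^ (θ - 1)) := by
  have := setLIntegral_diskMeasure θ hs hsD 1
  simpa using this

theorem lintegral_measureOn_unitDisk (θ : ℝ) (f : EuclideanSpace ℝ (Fin 2) → ℝ≥0∞) :
    ∫⁻ x : unitDisk, f x ∂(measureOn (diskMeasure θ) unitDisk) =
      ∫⁻ x in unitDisk, ENNReal.ofReal ((1 - ‖x‖) ^ (θ - 1)) * f x := by
  rw [measureOn, lintegral_subtype_comap isOpen_unitDisk.measurableSet,
    setLIntegral_diskMeasure θ isOpen_unitDisk.measurableSet subset_rfl]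

theorem diskMeasure_le_volume {θ : ℝ} (hθ : 1 ≤ θ) : diskMeasure θ ≤ volume := by
  refine Measure.le_iff.2 fun s hs => ?_
  rw [diskMeasure, withDensity_apply _ hs]
  refine (lintegral_mono (g := fun _ => 1) fun x => ?_).trans_eq (by simp)
  dsimp only
  split_ifs with hx
  · rw [infDist_compl_unitDisk (mem_unitDisk.1 hx).le]
    refine ENNReal.ofReal_le_one.2 (Real.rpow_le_one ?_ ?_ (by linarith))
    · have := mem_unitDisk.1 hx; linarith
    · have := norm_nonneg x; linarith
  · exact le_rfl

theorem volume_absolutelyContinuous_diskMeasure (θ : ℝ) : volume ≪ diskMeasure θ := by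
  refine withDensity_absolutelyContinuous' (measurable_diskDensity θ).aemeasurable
    (Eventually.of_forall fun x => ?_)
  split_ifs with hx
  · have := mem_unitDisk.1 hx
    rw [infDist_compl_unitDisk this.le]
    exact (ENNReal.ofReal_pos.2 (Real.rpow_pos_of_pos (by linarith) _)).ne'
  · exact one_ne_zero

theorem ballsPosFinite_diskMeasure {θ : ℝ} (hθ : 1 ≤ θ) : BallsPosFinite (diskMeasure θ) := by
  intro x r hr
  refine ⟨pos_iff_ne_zero.2 fun h => ?_,
    (diskMeasure_le_volume hθ _).trans_lt measure_ball_lt_top⟩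
  exact (Metric.measure_ball_pos volume x hr).ne' (volume_absolutelyContinuous_diskMeasure θ h)

theorem volume_ball_plane (x : EuclideanSpace ℝ (Fin 2)) {r : ℝ} (hr : 0 ≤ r) :
    volume (Metric.ball x r) = ENNReal.ofReal (Real.pi * r ^ 2) := by
  rw [EuclideanSpace.volume_ball_fin_two, ← ENNReal.ofReal_pow hr,
    ← ENNReal.ofReal_mul (by positivity), mul_comm]

theorem diskMeasure_ball_inter_le {θ : ℝ} (hθ : 1 ≤ θ) {x : EuclideanSpace ℝ (Fin 2)}
    (hx : ‖x‖ ≤ 1) {r : ℝ} (hr : 0 ≤ r) :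
    diskMeasure θ (Metric.ball x r ∩ unitDisk) ≤
      ENNReal.ofReal ((1 - ‖x‖ + r) ^ (θ - 1) * (Real.pi * r ^ 2)) := by
  have hm : MeasurableSet (Metric.ball x r ∩ unitDisk) :=
    Metric.isOpen_ball.measurableSet.inter isOpen_unitDisk.measurableSet
  rw [diskMeasure_apply θ hm inter_subset_right]
  calc ∫⁻ y in Metric.ball x r ∩ unitDisk, ENNReal.ofReal ((1 - ‖y‖) ^ (θ - 1))
      ≤ ∫⁻ _ in Metric.ball x r ∩ unitDisk, ENNReal.ofReal ((1 - ‖x‖ + r) ^ (θ - 1)) := by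
        refine setLIntegral_mono' hm fun y hy => ENNReal.ofReal_le_ofReal ?_
        have h1 := mem_unitDisk.1 hy.2
        have h2 := mem_ball_iff_norm'.1 hy.1
        have h3 := norm_sub_norm_le x y
        exact Real.rpow_le_rpow (by linarith) (by linarith) (by linarith)
    _ ≤ ENNReal.ofReal ((1 - ‖x‖ + r) ^ (θ - 1)) * volume (Metric.ball x r) := by
        rw [setLIntegral_const]
        gcongr
        exact inter_subset_left
    _ = _ := by
        rw [volume_ball_plane x hr, ← ENNReal.ofReal_mul]
        exact Real.rpow_nonneg (by linarith) _

/-- The ball of radius `r / 4` about `(1 - r / 2) x` lies in `ball x r` at depth at least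
`(1 - ‖x‖ + r) / 4`. -/
theorem le_diskMeasure_ball_inter {θ : ℝ} (hθ : 1 ≤ θ) {x : EuclideanSpace ℝ (Fin 2)}
    (hx : ‖x‖ ≤ 1) {r : ℝ} (hr : 0 < r) (hr1 : r ≤ 1) :
    ENNReal.ofReal (((1 - ‖x‖ + r) / 4) ^ (θ - 1) * (Real.pi * (r / 4) ^ 2)) ≤
      diskMeasure θ (Metric.ball x r ∩ unitDisk) := by
  set x' : EuclideanSpace ℝ (Fin 2) := (1 - r / 2) • x
  have hx0 := norm_nonneg x
  have hx' : ‖x'‖ = (1 - r / 2) * ‖x‖ := by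
    rw [norm_smul, Real.norm_eq_abs, abs_of_nonneg (by linarith)]
  have hxx' : ‖x' - x‖ = r / 2 * ‖x‖ := by
    have : x' - x = (-(r / 2)) • x := by
      simp only [x', sub_smul, one_smul, neg_smul]; abel
    rw [this, norm_smul, norm_neg, Real.norm_eq_abs, abs_of_nonneg (by linarith)]
  have hdepth : ∀ y ∈ Metric.ball x' (r / 4), (1 - ‖x‖ + r) / 4 ≤ 1 - ‖y‖ := by
    intro y hy
    have h1 := mem_ball_iff_norm.1 hy
    have h2 := norm_sub_norm_le y x'
    nlinarith
  have hsub : Metric.ball x' (r / 4) ⊆ Metric.ball x r ∩ unitDisk := by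
    intro y hy
    refine ⟨mem_ball_iff_norm.2 ?_, mem_unitDisk.2 ?_⟩
    · have h1 := mem_ball_iff_norm.1 hy
      have h2 := norm_sub_le_norm_sub_add_norm_sub y x' x
      nlinarith
    · have := hdepth y hy
      linarith
  refine le_trans ?_ (measure_mono hsub)
  rw [diskMeasure_apply θ Metric.isOpen_ball.measurableSet (hsub.trans inter_subset_right),
    ENNReal.ofReal_mul (Real.rpow_nonneg (by linarith) _), ← volume_ball_plane x' (by linarith),
    ← setLIntegral_const]
  refine setLIntegral_mono' Metric.isOpen_ball.measurableSet fun y hy => ENNReal.ofReal_le_ofReal ?_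
  exact Real.rpow_le_rpow (by linarith) (hdepth y hy) (by linarith)

theorem isDoublingOn_diskMeasure {θ : ℝ} (hθ : 1 ≤ θ) :
    IsDoublingOn (diskMeasure θ) unitDisk := by
  refine ⟨Real.toNNReal (64 * 8 ^ (θ - 1)), fun x hx r hr => ?_⟩
  rw [closure_unitDisk, mem_closedBall_zero_iff] at hx
  have hlow : ∀ s : ℝ, 0 < s → 0 < diskMeasure θ (Metric.ball x s ∩ unitDisk) := by
    intro s hs
    have h1 : 0 < min s 1 := lt_min hs one_pos
    refine lt_of_lt_of_le ?_ ((le_diskMeasure_ball_inter hθ hx h1 (min_le_right _ _)).trans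
      (measure_mono (inter_subset_inter_left _ (Metric.ball_subset_ball (min_le_left _ _)))))
    have : 0 < (1 - ‖x‖ + min s 1) / 4 := by linarith
    exact ENNReal.ofReal_pos.2 (by positivity)
  refine ⟨hlow _ (by linarith), ?_, ?_⟩
  · set s := min r 1
    have hs : 0 < s := lt_min hr one_pos
    have hsub : Metric.ball x (2 * r) ∩ unitDisk ⊆ Metric.ball x (2 * s) ∩ unitDisk := by
      rintro y ⟨hy, hyD⟩
      refine ⟨mem_ball_iff_norm.2 ?_, hyD⟩
      have h1 := mem_ball_iff_norm.1 hy
      have h2 := norm_sub_le y x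
      have h3 := mem_unitDisk.1 hyD
      rcases le_total r 1 with h | h
      · simpa only [s, min_eq_left h] using h1
      · simp only [s, min_eq_right h]; linarith
    calc diskMeasure θ (Metric.ball x (2 * r) ∩ unitDisk)
        ≤ diskMeasure θ (Metric.ball x (2 * s) ∩ unitDisk) := measure_mono hsub
      _ ≤ ENNReal.ofReal ((1 - ‖x‖ + 2 * s) ^ (θ - 1) * (Real.pi * (2 * s) ^ 2)) :=
          diskMeasure_ball_inter_le hθ hx (by linarith)
      _ ≤ ENNReal.ofReal ((64 * 8 ^ (θ - 1)) *
            (((1 - ‖x‖ + s) / 4) ^ (θ - 1) * (Real.pi * (s / 4) ^ 2))) := by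
          refine ENNReal.ofReal_le_ofReal ?_
          have h1 : (1 - ‖x‖ + 2 * s) ^ (θ - 1) ≤
              8 ^ (θ - 1) * ((1 - ‖x‖ + s) / 4) ^ (θ - 1) := by
            rw [← Real.mul_rpow (by norm_num) (by linarith)]
            exact Real.rpow_le_rpow (by linarith) (by linarith) (by linarith)
          have h2 : 0 ≤ Real.pi * (2 * s) ^ 2 := by positivity
          calc _ ≤ 8 ^ (θ - 1) * ((1 - ‖x‖ + s) / 4) ^ (θ - 1) * (Real.pi * (2 * s) ^ 2) :=
                mul_le_mul_of_nonneg_right h1 h2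
            _ = _ := by ring
      _ ≤ _ := by
          rw [ENNReal.ofReal_mul (by positivity)]
          refine mul_le_mul' le_rfl ((le_diskMeasure_ball_inter hθ hx hs (min_le_right _ _)).trans
            (measure_mono (inter_subset_inter_left _
              (Metric.ball_subset_ball (min_le_left _ _)))))
  · exact (measure_mono inter_subset_left).trans_lt (ballsPosFinite_diskMeasure hθ x r hr).2

/-! ### The disk is a uniform domain -/

/-- A curve that preserves distances on `S` has unit speed there. -/
theorem HasUnitSpeedOn.of_dist_eq {Y : Type*} [PseudoMetricSpace Y] {γ : ℝ → Y} {S : Set ℝ}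
    (h : ∀ s ∈ S, ∀ t ∈ S, s ≤ t → dist (γ s) (γ t) = t - s) : HasUnitSpeedOn γ S := by
  refine hasConstantSpeedOnWith_iff_ordered.2 fun x hx y hy hxy => ?_
  have hlip : LipschitzOnWith 1 γ S := by
    refine LipschitzOnWith.of_dist_le_mul fun s hs t ht => ?_
    rw [NNReal.coe_one, one_mul]
    rcases le_total s t with hst | hst
    · rw [h s hs t ht hst, dist_comm, Real.dist_eq, abs_of_nonneg (sub_nonneg.2 hst)]
    · rw [dist_comm, h t ht s hs hst, Real.dist_eq, abs_of_nonneg (sub_nonneg.2 hst)]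
  rw [NNReal.coe_one, one_mul]
  refine le_antisymm ?_ ?_
  · calc eVariationOn γ (S ∩ Icc x y) = eVariationOn (γ ∘ id) (S ∩ Icc x y) := rfl
      _ ≤ (1 : ℝ≥0) * eVariationOn id (S ∩ Icc x y) :=
          hlip.comp_eVariationOn_le fun t ht => ht.1
      _ ≤ ENNReal.ofReal (y - x) := by
          rw [ENNReal.coe_one, one_mul]
          exact ((monotone_id.monotoneOn S).eVariationOn_eq hx hy).le
  · rw [← h x hx y hy hxy, ← edist_dist]
    exact eVariationOn.edist_le γ ⟨hx, le_rfl, hxy⟩ ⟨hy, hxy, le_rfl⟩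

theorem HasUnitSpeedOn.of_eq_add_smul {F : Type*} [NormedAddCommGroup F] [NormedSpace ℝ F]
    {γ : ℝ → F} {S : Set ℝ} {p v : F} (hv : ‖v‖ = 1) (h : ∀ t ∈ S, γ t = p + t • v) :
    HasUnitSpeedOn γ S := by
  refine .of_dist_eq fun s hs t ht hst => ?_
  rw [h s hs, h t ht, dist_add_left, dist_comm, dist_eq_norm, ← sub_smul, norm_smul, hv, mul_one,
    Real.norm_eq_abs, abs_of_nonneg (sub_nonneg.2 hst)]

/-- Two points `x`, `y` of the disk at distance `d` are joined by the segments through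
`(1 - d / 2) x` and `(1 - d / 2) y`. -/
theorem isUniformDomain_unitDisk : IsUniformDomain unitDisk := by
  refine ⟨isMetricDomain_unitDisk, 1 / 2, by norm_num, by norm_num, fun x hx y hy hxy => ?_⟩
  rw [mem_unitDisk] at hx hy
  obtain ⟨e, he, hxe⟩ := exists_unit_vector_eq_norm_smul x
  obtain ⟨f, hf, hyf⟩ := exists_unit_vector_eq_norm_smul y
  set d := dist x y with hd
  have hd0 : 0 < d := dist_pos.2 hxy
  have hd2 : d ≤ 2 := by
    have := norm_sub_le x y
    rw [hd, dist_eq_norm]; linarith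
  have hx0 := norm_nonneg x
  have hy0 := norm_nonneg y
  set l₁ := ‖x‖ * d / 2 with hl₁
  set l₂ := (1 - d / 2) * d with hl₂
  set l₃ := ‖y‖ * d / 2 with hl₃
  have h1 : 0 ≤ l₁ := by positivity
  have h2 : 0 ≤ l₂ := mul_nonneg (by linarith) hd0.le
  have h3 : 0 ≤ l₃ := by positivity
  set v := d⁻¹ • (y - x) with hv
  have hdv : d • v = y - x := by rw [hv, smul_smul, mul_inv_cancel₀ hd0.ne', one_smul]
  have hv1 : ‖v‖ = 1 := by
    rw [hv, norm_smul, norm_inv, ← dist_eq_norm, dist_comm y x, ← hd, Real.norm_eq_abs,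
      abs_of_pos hd0, inv_mul_cancel₀ hd0.ne']
  set γ : ℝ → EuclideanSpace ℝ (Fin 2) := fun t =>
    x - min t l₁ • e + max 0 (min (t - l₁) l₂) • v + max (t - l₁ - l₂) 0 • f with hγ
  have leg1 : ∀ t ∈ Icc 0 l₁, γ t = x + t • (-e) := by
    rintro t ⟨ht0, ht⟩
    have a : min (t - l₁) l₂ ≤ 0 := (min_le_left _ _).trans (by linarith)
    simp only [hγ]
    rw [min_eq_left ht, max_eq_left a, max_eq_right (by linarith)]
    simp [sub_eq_add_neg]
  have leg2 : ∀ t ∈ Icc l₁ (l₁ + l₂), γ t = (x - l₁ • e - l₁ • v) + t • v := by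
    rintro t ⟨ht0, ht⟩
    simp only [hγ]
    rw [min_eq_right ht0, min_eq_left (by linarith), max_eq_right (by linarith),
      max_eq_right (by linarith), sub_smul]
    simp only [zero_smul]
    abel
  have leg3 : ∀ t ∈ Icc (l₁ + l₂) (l₁ + l₂ + l₃),
      γ t = (x - l₁ • e + l₂ • v - (l₁ + l₂) • f) + t • f := by
    rintro t ⟨ht0, ht⟩
    simp only [hγ]
    rw [min_eq_right (by linarith), min_eq_right (by linarith), max_eq_right h2,
      max_eq_left (by linarith), sub_sub, sub_smul]
    abel
  have hxl : x - l₁ • e = (1 - d / 2) • x := by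
    have : l₁ • e = (d / 2) • x := by
      conv_rhs => rw [hxe, smul_smul]
      rw [hl₁]; congr 1; ring
    rw [this, sub_smul, one_smul]
  have hyl : x - l₁ • e + l₂ • v = (1 - d / 2) • y := by
    rw [hxl, hl₂, mul_smul, hdv, ← smul_add, add_sub_cancel]
  -- on the first leg the depth is at least `t`, on the second at least `d / 2`, on the third at
  -- least the remaining length
  have depth1 : ∀ t ∈ Icc 0 l₁, ‖γ t‖ ≤ ‖x‖ - t := by
    intro t ht
    have htx : t ≤ ‖x‖ := ht.2.trans (by rw [hl₁]; nlinarith)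
    have : γ t = (‖x‖ - t) • e := by
      rw [leg1 t ht, sub_smul, ← hxe, smul_neg, sub_eq_add_neg]
    rw [this, norm_smul, he, mul_one, Real.norm_eq_abs, abs_of_nonneg (by linarith)]
  have depth2 : ∀ t ∈ Icc l₁ (l₁ + l₂), ‖γ t‖ ≤ 1 - d / 2 := by
    rintro t ⟨ht0, ht⟩
    have e1 : γ t = (1 - d / 2) • x + (t - l₁) • v := by
      rw [leg2 t ⟨ht0, ht⟩, ← hxl, sub_smul]; abel
    rcases h2.eq_or_lt with h | h
    · have : t = l₁ := by linarith
      rw [e1, this, sub_self, zero_smul, add_zero, norm_smul, Real.norm_eq_abs,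
        abs_of_nonneg (by linarith)]
      nlinarith
    · set σ := (t - l₁) / l₂ with hσ
      have hσ0 : 0 ≤ σ := div_nonneg (by linarith) h2
      have hσ1 : σ ≤ 1 := (div_le_one h).2 (by linarith)
      have e2 : γ t = (1 - d / 2) • ((1 - σ) • x + σ • y) := by
        have : t - l₁ = (1 - d / 2) * σ * d := by
          have : σ * l₂ = t - l₁ := div_mul_cancel₀ _ h.ne'
          rw [← this, hl₂]; ring
        rw [e1, this, mul_smul, hdv, mul_smul, ← smul_add]
        congr 1
        rw [sub_smul, smul_sub, one_smul]; abel
      have e3 : ‖(1 - σ) • x + σ • y‖ ≤ 1 := by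
        refine (norm_add_le _ _).trans ?_
        rw [norm_smul, norm_smul, Real.norm_eq_abs, Real.norm_eq_abs, abs_of_nonneg hσ0,
          abs_of_nonneg (by linarith)]
        nlinarith
      rw [e2, norm_smul, Real.norm_eq_abs, abs_of_nonneg (by linarith)]
      nlinarith
  have depth3 : ∀ t ∈ Icc (l₁ + l₂) (l₁ + l₂ + l₃), ‖γ t‖ ≤ ‖y‖ - (l₁ + l₂ + l₃ - t) := by
    rintro t ⟨ht0, ht⟩
    have e1 : γ t = ((1 - d / 2) * ‖y‖ + (t - l₁ - l₂)) • f := by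
      rw [leg3 t ⟨ht0, ht⟩, hyl, add_smul ((1 - d / 2) * ‖y‖), mul_smul (1 - d / 2) ‖y‖, ← hyf,
        sub_sub t, sub_smul t]
      abel
    have e2 : 0 ≤ (1 - d / 2) * ‖y‖ := mul_nonneg (by linarith) hy0
    rw [e1, norm_smul, hf, mul_one, Real.norm_eq_abs, abs_of_nonneg (by linarith), hl₃]
    linarith
  have hcases : ∀ t ∈ Icc 0 (l₁ + l₂ + l₃), t ∈ Icc 0 l₁ ∨ t ∈ Icc l₁ (l₁ + l₂) ∨
      t ∈ Icc (l₁ + l₂) (l₁ + l₂ + l₃) := by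
    rintro t ⟨ht0, ht⟩
    rcases le_total t l₁ with h | h
    · exact Or.inl ⟨ht0, h⟩
    rcases le_total t (l₁ + l₂) with h' | h'
    · exact Or.inr (Or.inl ⟨h, h'⟩)
    · exact Or.inr (Or.inr ⟨h', ht⟩)
  have hl : l₁ + l₂ + l₃ ≤ 2 * d := by rw [hl₁, hl₂, hl₃]; nlinarith
  have hmaps : ∀ t ∈ Icc 0 (l₁ + l₂ + l₃), ‖γ t‖ < 1 := by
    intro t ht
    rcases hcases t ht with h | h | h
    · have := depth1 t h; have := h.1; linarith
    · have := depth2 t h; linarith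
    · have := depth3 t h; have := h.2; linarith
  refine ⟨l₁ + l₂ + l₃, γ, by linarith, ?_, fun t ht => mem_unitDisk.2 (hmaps t ht), ?_, ?_, ?_, ?_⟩
  · exact ((HasUnitSpeedOn.of_eq_add_smul (by rwa [norm_neg]) leg1).Icc_Icc
      (.of_eq_add_smul hv1 leg2)).Icc_Icc (.of_eq_add_smul hf leg3)
  · rw [leg1 0 ⟨le_rfl, h1⟩]; simp
  · rw [leg3 _ ⟨by linarith, le_rfl⟩, hyl, ← sub_eq_zero]
    have : l₃ • f = (d / 2) • y := by
      conv_rhs => rw [hyf, smul_smul]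
      rw [hl₃]; congr 1; ring
    rw [add_smul (l₁ + l₂) l₃ f, this, sub_smul, one_smul]
    abel
  · rw [one_div, inv_inv]; exact hl
  · intro t ht
    rw [infDist_compl_unitDisk (hmaps t ht).le]
    have m1 := min_le_left t (l₁ + l₂ + l₃ - t)
    have m2 := min_le_right t (l₁ + l₂ + l₃ - t)
    have m0 : 0 ≤ min t (l₁ + l₂ + l₃ - t) := le_min ht.1 (by linarith [ht.2])
    rcases hcases t ht with h | h | h
    · have := depth1 t h; linarith
    · have := depth2 t h; linarith
    · have := depth3 t h; linarith

/-! ### The 1-Poincaré inequality on the disk -/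

theorem lintegral_comp_smul_add {F : Type*} [NormedAddCommGroup F] [NormedSpace ℝ F]
    [FiniteDimensional ℝ F] [MeasurableSpace F] [BorelSpace F] (μ : Measure F)
    [μ.IsAddHaarMeasure] (f : F → ℝ≥0∞) {r : ℝ} (hr : r ≠ 0) (b : F) :
    ∫⁻ x, f (r • x + b) ∂μ =
      ENNReal.ofReal |(r ^ Module.finrank ℝ F)⁻¹| * ∫⁻ x, f x ∂μ := by
  have h := (Homeomorph.smulOfNeZero r hr : F ≃ₜ F).measurableEmbedding.lintegral_map (μ := μ)
    (fun x => f (x + b))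
  rw [show (⇑(Homeomorph.smulOfNeZero r hr : F ≃ₜ F)) = (r • ·) from rfl,
    Measure.map_addHaar_smul μ hr, lintegral_smul_measure,
    lintegral_add_right_eq_self (μ := μ) f b] at h
  exact h.symm

/-- In a convex set an upper gradient is tested on the segment from `z` to `y`. -/
theorem IsUpperGradient.ofReal_abs_sub_le {F : Type*} [NormedAddCommGroup F] [NormedSpace ℝ F]
    [MeasurableSpace F] {Ω : Set F} (hΩ : Convex ℝ Ω) {u : Ω → ℝ} {g : Ω → ℝ≥0∞}
    (h : IsUpperGradient u g) (y z : Ω) :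
    ENNReal.ofReal |u y - u z| ≤ ENNReal.ofReal (dist y z) *
      ∫⁻ t in Icc (0 : ℝ) 1, Function.extend Subtype.val g 0 ((z : F) + t • ((y : F) - z)) := by
  classical
  set l := dist y z with hl
  rcases eq_or_ne y z with rfl | hyz
  · simp
  have hl0 : 0 < l := dist_pos.2 hyz
  set v : F := l⁻¹ • ((y : F) - z) with hv
  have hv1 : ‖v‖ = 1 := by
    rw [hv, norm_smul, norm_inv, ← dist_eq_norm, ← Subtype.dist_eq, ← hl, Real.norm_eq_abs,
      abs_of_pos hl0, inv_mul_cancel₀ hl0.ne']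
  have hmem : ∀ t ∈ Icc 0 l, (z : F) + t • v ∈ Ω := by
    rintro t ⟨ht0, ht⟩
    rw [hv, smul_smul]
    refine hΩ.add_smul_sub_mem z.2 y.2 ⟨by positivity, ?_⟩
    rw [← div_eq_mul_inv]
    exact (div_le_one hl0).2 ht
  set γ : ℝ → Ω := fun t => if ht : (z : F) + t • v ∈ Ω then ⟨_, ht⟩ else z with hγ
  have hγt : ∀ (t : ℝ) (ht : t ∈ Icc 0 l), γ t = ⟨(z : F) + t • v, hmem t ht⟩ := fun t ht => by
    simp only [hγ]; rw [dif_pos (hmem t ht)]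
  have hγ1 : HasUnitSpeedOn γ (Icc 0 l) := by
    refine .of_dist_eq fun s hs t ht hst => ?_
    rw [hγt s hs, hγt t ht, Subtype.dist_eq, dist_add_left, dist_comm, dist_eq_norm, ← sub_smul,
      norm_smul, hv1, mul_one, Real.norm_eq_abs, abs_of_nonneg (sub_nonneg.2 hst)]
  have h0 : γ 0 = z := by rw [hγt 0 ⟨le_rfl, hl0.le⟩]; ext; simp
  have h1 : γ l = y := by
    rw [hγt l ⟨hl0.le, le_rfl⟩]; ext
    simp only [hv]
    rw [smul_smul, mul_inv_cancel₀ hl0.ne', one_smul, add_sub_cancel]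
  have key := h.2 l γ hl0.le hγ1
  rw [h0, h1] at key
  refine key.trans_eq ?_
  set G := Function.extend Subtype.val g 0 with hG
  have e1 : ∫⁻ t in Icc 0 l, g (γ t) = ∫⁻ t in Icc 0 l, G ((z : F) + t • v) := by
    refine setLIntegral_congr_fun measurableSet_Icc fun t ht => ?_
    simp only [hγt t ht, hG]
    exact (Subtype.val_injective.extend_apply g 0 ⟨(z : F) + t • v, hmem t ht⟩).symm
  rw [e1, ← lintegral_indicator measurableSet_Icc, ← lintegral_indicator measurableSet_Icc]
  have e2 := lintegral_comp_smul_add volume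
    ((Icc 0 l).indicator fun t => G ((z : F) + t • v)) hl0.ne' 0
  have e3 : ∀ t : ℝ, (Icc 0 l).indicator (fun t => G ((z : F) + t • v)) (l • t + 0) =
      (Icc (0 : ℝ) 1).indicator (fun t => G ((z : F) + t • ((y : F) - z))) t := by
    intro t
    have : l • t + 0 ∈ Icc 0 l ↔ t ∈ Icc (0 : ℝ) 1 := by
      simp only [smul_eq_mul, add_zero, mem_Icc]
      constructor
      · rintro ⟨a, b⟩
        exact ⟨nonneg_of_mul_nonneg_right a hl0, by nlinarith⟩
      · rintro ⟨a, b⟩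
        exact ⟨by positivity, by nlinarith⟩
    by_cases ht : t ∈ Icc (0 : ℝ) 1
    · rw [indicator_of_mem ht, indicator_of_mem (this.2 ht)]
      congr 2
      rw [hv, smul_smul, add_zero, smul_eq_mul, mul_right_comm, mul_inv_cancel₀ hl0.ne', one_mul]
    · rw [indicator_of_notMem ht, indicator_of_notMem (fun h => ht (this.1 h))]
  simp_rw [e3] at e2
  rw [e2, ← mul_assoc, ← ENNReal.ofReal_mul hl0.le, Module.finrank_self, pow_one,
    abs_of_pos (inv_pos.2 hl0), mul_inv_cancel₀ hl0.ne', ENNReal.ofReal_one, one_mul]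

/-- Contracting a convex subset of the disk towards one of its points by a factor at least `1 / 2`
distorts the measure by a bounded factor, as the depth `1 - ‖·‖` is a concave function. -/
theorem lintegral_contraction_le {θ : ℝ} (hθ : 1 ≤ θ) {B : Set (EuclideanSpace ℝ (Fin 2))}
    (hB : MeasurableSet B) (hc : Convex ℝ B) (hBD : B ⊆ unitDisk)
    {G : EuclideanSpace ℝ (Fin 2) → ℝ≥0∞} {t : ℝ} (ht0 : 0 ≤ t) (ht : t ≤ 1 / 2)
    {y : EuclideanSpace ℝ (Fin 2)} (hy : y ∈ B) :
    ∫⁻ z in B, G (z + t • (y - z)) ∂diskMeasure θ ≤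
      ENNReal.ofReal (4 * 2 ^ (θ - 1)) * ∫⁻ z in B, G z ∂diskMeasure θ := by
  rw [setLIntegral_diskMeasure θ hB hBD, setLIntegral_diskMeasure θ hB hBD]
  set F := B.indicator fun z => ENNReal.ofReal ((1 - ‖z‖) ^ (θ - 1)) * G z with hF
  have h1t : 0 < 1 - t := by linarith
  have hpt : ∀ z, z + t • (y - z) = (1 - t) • z + t • y := fun z => by
    rw [smul_sub, sub_smul, one_smul]; abel
  calc ∫⁻ z in B, ENNReal.ofReal ((1 - ‖z‖) ^ (θ - 1)) * G (z + t • (y - z))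
      ≤ ∫⁻ z in B, ENNReal.ofReal (2 ^ (θ - 1)) * F ((1 - t) • z + t • y) := by
        refine setLIntegral_mono' hB fun z hz => ?_
        have hp : (1 - t) • z + t • y ∈ B := hc hz hy h1t.le ht0 (by ring)
        rw [hpt, hF, indicator_of_mem hp, ← mul_assoc, ← ENNReal.ofReal_mul (by positivity)]
        refine mul_le_mul' (ENNReal.ofReal_le_ofReal ?_) le_rfl
        have hz1 := mem_unitDisk.1 (hBD hz)
        have hy1 := mem_unitDisk.1 (hBD hy)
        have hp1 : ‖(1 - t) • z + t • y‖ ≤ (1 - t) * ‖z‖ + t * ‖y‖ := by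
          refine (norm_add_le _ _).trans_eq ?_
          rw [norm_smul, norm_smul, Real.norm_eq_abs, Real.norm_eq_abs, abs_of_pos h1t,
            abs_of_nonneg ht0]
        have hz0 := norm_nonneg z
        rw [← Real.mul_rpow (by norm_num) (by nlinarith)]
        exact Real.rpow_le_rpow (by linarith) (by nlinarith) (by linarith)
    _ ≤ ∫⁻ z, ENNReal.ofReal (2 ^ (θ - 1)) * F ((1 - t) • z + t • y) := setLIntegral_le_lintegral _ _
    _ = ENNReal.ofReal (2 ^ (θ - 1)) * (ENNReal.ofReal |((1 - t) ^ 2)⁻¹| * ∫⁻ z, F z) := by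
        rw [lintegral_const_mul' _ _ ENNReal.ofReal_ne_top,
          lintegral_comp_smul_add volume F h1t.ne', finrank_euclideanSpace_fin]
    _ ≤ ENNReal.ofReal (2 ^ (θ - 1)) * (ENNReal.ofReal 4 * ∫⁻ z, F z) := by
        gcongr
        rw [abs_of_pos (by positivity)]
        refine inv_le_of_inv_le₀ (by norm_num) ?_
        nlinarith
    _ = _ := by
        rw [hF, lintegral_indicator hB, ← mul_assoc, ← ENNReal.ofReal_mul (by positivity), mul_comm 4]

/-- Integrating the bound along segments over all pairs of points; each segment is contracted
towards the end point that is further away. -/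
theorem lintegral_lintegral_abs_sub_le {θ : ℝ} (hθ : 1 ≤ θ)
    {B : Set (EuclideanSpace ℝ (Fin 2))} (hB : MeasurableSet B) (hc : Convex ℝ B)
    (hBD : B ⊆ unitDisk) {d : ℝ} (hd : ∀ y ∈ B, ∀ z ∈ B, dist y z ≤ d) {u : unitDisk → ℝ}
    {g : unitDisk → ℝ≥0∞} (h : IsUpperGradient u g) :
    ∫⁻ y in Subtype.val ⁻¹' B, (∫⁻ z in Subtype.val ⁻¹' B, ‖u y - u z‖ₑ
        ∂measureOn (diskMeasure θ) unitDisk) ∂measureOn (diskMeasure θ) unitDisk ≤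
      ENNReal.ofReal d * (ENNReal.ofReal (4 * 2 ^ (θ - 1)) * diskMeasure θ B *
        ∫⁻ z in Subtype.val ⁻¹' B, g z ∂measureOn (diskMeasure θ) unitDisk) := by
  set m := (diskMeasure θ).restrict B with hm
  set ν := (measureOn (diskMeasure θ) unitDisk).restrict (Subtype.val ⁻¹' B) with hν
  have hemb := MeasurableEmbedding.subtype_coe isOpen_unitDisk.measurableSet
  have hfin : IsFiniteMeasure m := ⟨by
    rw [hm, Measure.restrict_apply_univ]
    exact ((measure_mono hBD).trans (diskMeasure_le_volume hθ _)).trans_lt measure_ball_lt_top⟩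
  have hmap : ν.map Subtype.val = m := by
    rw [hν, ← hemb.restrict_map, measureOn, hemb.map_comap, Subtype.range_coe,
      Measure.restrict_restrict hB, inter_eq_left.2 hBD, hm]
  have hint : ∀ f : EuclideanSpace ℝ (Fin 2) → ℝ≥0∞, ∫⁻ y, f y ∂m = ∫⁻ y, f y ∂ν := fun f => by
    rw [← hmap, hemb.lintegral_map]
  set G := Function.extend (Subtype.val : unitDisk → EuclideanSpace ℝ (Fin 2)) g 0 with hG
  have hGm : Measurable G := hemb.measurable_extend h.1 measurable_zero
  have hgG : ∫⁻ z, g z ∂ν = ∫⁻ z, G z ∂m := by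
    rw [hint]
    simp only [hG, Subtype.val_injective.extend_apply]
  have hseg : ∀ t ∈ Icc (0 : ℝ) 1, ∫⁻ y, ∫⁻ z, G (z + t • (y - z)) ∂m ∂m ≤
      ENNReal.ofReal (4 * 2 ^ (θ - 1)) * diskMeasure θ B * ∫⁻ z, G z ∂m := by
    have hhalf : ∀ t : ℝ, 0 ≤ t → t ≤ 1 / 2 → ∫⁻ y, ∫⁻ z, G (z + t • (y - z)) ∂m ∂m ≤
        ENNReal.ofReal (4 * 2 ^ (θ - 1)) * diskMeasure θ B * ∫⁻ z, G z ∂m := by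
      intro t ht0 ht
      calc ∫⁻ y, ∫⁻ z, G (z + t • (y - z)) ∂m ∂m
          ≤ ∫⁻ _ in B, ENNReal.ofReal (4 * 2 ^ (θ - 1)) * ∫⁻ z, G z ∂m ∂diskMeasure θ :=
            setLIntegral_mono' hB fun y hy => lintegral_contraction_le hθ hB hc hBD ht0 ht hy
        _ = _ := by rw [setLIntegral_const]; ring
    rintro t ⟨ht0, ht1⟩
    rcases le_total t (1 / 2) with ht | ht
    · exact hhalf t ht0 ht
    · rw [lintegral_lintegral_swap (by fun_prop)]
      refine le_trans (le_of_eq ?_) (hhalf (1 - t) (by linarith) (by linarith))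
      refine lintegral_congr fun z => lintegral_congr fun y => ?_
      congr 1
      rw [smul_sub, smul_sub, sub_smul, sub_smul, one_smul, one_smul]; abel
  have hBae : ∀ᵐ y : unitDisk ∂ν, (y : EuclideanSpace ℝ (Fin 2)) ∈ B :=
    ae_restrict_mem (hB.preimage measurable_subtype_coe)
  calc ∫⁻ y, ∫⁻ z, ‖u y - u z‖ₑ ∂ν ∂ν
      ≤ ∫⁻ y, ∫⁻ z, ENNReal.ofReal d * (∫⁻ t in Icc (0 : ℝ) 1,
          G ((z : EuclideanSpace ℝ (Fin 2)) + t • ((y : EuclideanSpace ℝ (Fin 2)) - z))) ∂ν ∂ν := by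
        refine lintegral_mono_ae (hBae.mono fun y hy => lintegral_mono_ae (hBae.mono fun z hz => ?_))
        rw [Real.enorm_eq_ofReal_abs]
        refine (h.ofReal_abs_sub_le convex_unitDisk y z).trans ?_
        exact mul_le_mul' (ENNReal.ofReal_le_ofReal (hd _ hy _ hz)) le_rfl
    _ = ∫⁻ y, ∫⁻ z, ENNReal.ofReal d * (∫⁻ t in Icc (0 : ℝ) 1, G (z + t • (y - z))) ∂m ∂m := by
        rw [hint]
        exact lintegral_congr fun y => (hint fun z => ENNReal.ofReal d *
          ∫⁻ t in Icc (0 : ℝ) 1, G (z + t • ((y : EuclideanSpace ℝ (Fin 2)) - z))).symm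
    _ = ENNReal.ofReal d * ∫⁻ y, ∫⁻ z, (∫⁻ t in Icc (0 : ℝ) 1, G (z + t • (y - z))) ∂m ∂m := by
        simp_rw [lintegral_const_mul' _ _ ENNReal.ofReal_ne_top]
    _ = ENNReal.ofReal d * ∫⁻ t in Icc (0 : ℝ) 1, ∫⁻ y, ∫⁻ z, G (z + t • (y - z)) ∂m ∂m := by
        congr 1
        refine (lintegral_congr fun y => lintegral_lintegral_swap (by fun_prop)).trans
          (lintegral_lintegral_swap (Measurable.aemeasurable ?_))
        refine Measurable.lintegral_prod_right' (f := fun q : (EuclideanSpace ℝ (Fin 2) × ℝ) ×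
          EuclideanSpace ℝ (Fin 2) => G (q.2 + q.1.2 • (q.1.1 - q.2))) ?_
        fun_prop
    _ ≤ ENNReal.ofReal d * ∫⁻ _ in Icc (0 : ℝ) 1,
          ENNReal.ofReal (4 * 2 ^ (θ - 1)) * diskMeasure θ B * ∫⁻ z, G z ∂m := by
        gcongr 1
        exact setLIntegral_mono' measurableSet_Icc hseg
    _ = _ := by rw [setLIntegral_const, hgG]; simp

theorem admitsPoincare_measureOn_unitDisk {θ : ℝ} (hθ : 1 ≤ θ) :
    AdmitsPoincare 1 (measureOn (diskMeasure θ) unitDisk) := by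
  refine ⟨2 * (4 * 2 ^ (θ - 1)), 1, by positivity, le_rfl, fun u g hu hg _ x r hr => ?_⟩
  simp only [one_mul, ENNReal.rpow_one, div_one]
  set ν := measureOn (diskMeasure θ) unitDisk with hν
  set B : Set (EuclideanSpace ℝ (Fin 2)) := Metric.ball (x : EuclideanSpace ℝ (Fin 2)) r ∩ unitDisk
    with hBdef
  have hB : MeasurableSet B :=
    Metric.isOpen_ball.measurableSet.inter isOpen_unitDisk.measurableSet
  have hpre : Metric.ball x r = Subtype.val ⁻¹' B := by
    ext y
    simp [hBdef, Subtype.dist_eq]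
  have hνB : ν (Metric.ball x r) = diskMeasure θ B := by
    rw [hν, measureOn, hpre, comap_subtype_coe_apply isOpen_unitDisk.measurableSet,
      Subtype.image_preimage_coe, inter_eq_right.2 (inter_subset_right : B ⊆ unitDisk)]
  have h0 : ν (Metric.ball x r) ≠ 0 := by
    obtain ⟨_, hc⟩ := isDoublingOn_diskMeasure hθ
    have := (hc x (subset_closure x.2) (r / 2) (by linarith)).1
    rw [mul_div_cancel₀ r two_ne_zero] at this
    rw [hνB]; exact this.ne'
  have h1 : ν (Metric.ball x r) ≠ ∞ := by
    rw [hνB]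
    exact ((measure_mono inter_subset_left).trans_lt (ballsPosFinite_diskMeasure hθ x r hr).2).ne
  have key := lintegral_lintegral_abs_sub_le hθ hB
    ((convex_ball _ _).inter convex_unitDisk) inter_subset_right (d := 2 * r) (fun y hy z hz => by
      have a := Metric.mem_ball.1 hy.1
      have b := Metric.mem_ball'.1 hz.1
      have := dist_triangle y x z
      linarith) hg
  rw [← hpre, ← hν, ← hνB] at key
  have hC : ENNReal.ofReal (2 * (4 * 2 ^ (θ - 1)) * r) =
      ENNReal.ofReal (2 * r) * ENNReal.ofReal (4 * 2 ^ (θ - 1)) := by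
    rw [← ENNReal.ofReal_mul (by positivity)]; congr 1; ring
  rcases eq_or_ne (∫⁻ z in Metric.ball x r, g z ∂ν) ∞ with htop | htop
  · rw [setLAverage_eq _ g, htop, ENNReal.top_div_of_ne_top h1, ENNReal.mul_top]
    · exact le_top
    · exact (ENNReal.ofReal_pos.2 (by positivity)).ne'
  -- `u` is only locally integrable; finiteness of the double integral makes it integrable on the ball
  have hfin : ∫⁻ y in Metric.ball x r, (∫⁻ z in Metric.ball x r, ‖u y - u z‖ₑ ∂ν) ∂ν < ∞ := by
    refine key.trans_lt (ENNReal.mul_lt_top ENNReal.ofReal_lt_top (ENNReal.mul_lt_top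
      (ENNReal.mul_lt_top ENNReal.ofReal_lt_top h1.lt_top) htop.lt_top))
  have hint : IntegrableOn u (Metric.ball x r) ν := by
    obtain ⟨y, hy⟩ : ∃ y, ∫⁻ z in Metric.ball x r, ‖u y - u z‖ₑ ∂ν < ∞ := by
      by_contra! hcon
      refine hfin.ne (top_le_iff.1 ?_)
      calc ∞ = ∫⁻ _ in Metric.ball x r, ∞ ∂ν := by
            rw [setLIntegral_const, ENNReal.top_mul h0]
        _ ≤ _ := lintegral_mono fun y => hcon y
    have hum : AEStronglyMeasurable u (ν.restrict (Metric.ball x r)) :=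
      hu.aestronglyMeasurable.restrict
    have hc : IntegrableOn (fun _ => u y) (Metric.ball x r) ν := integrableOn_const h1
    have hd : IntegrableOn (fun z => u y - u z) (Metric.ball x r) ν :=
      ⟨aestronglyMeasurable_const.sub hum, hy⟩
    exact (hc.sub hd).congr (Eventually.of_forall fun z => by simp)
  calc ⨍⁻ y in Metric.ball x r, ‖u y - ⨍ a in Metric.ball x r, u a ∂ν‖ₑ ∂ν
      ≤ ⨍⁻ y in Metric.ball x r, (⨍⁻ z in Metric.ball x r, ‖u y - u z‖ₑ ∂ν) ∂ν := by
        refine lintegral_mono fun y => ?_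
        rw [← enorm_neg, neg_sub]
        refine (enorm_setAverage_sub_le h0 h1 hint (u y)).trans_eq ?_
        refine lintegral_congr fun z => ?_
        rw [← enorm_neg, neg_sub]
    _ = (ν (Metric.ball x r))⁻¹ * ((ν (Metric.ball x r))⁻¹ *
          ∫⁻ y in Metric.ball x r, (∫⁻ z in Metric.ball x r, ‖u y - u z‖ₑ ∂ν) ∂ν) := by
        simp_rw [setLAverage_eq, ENNReal.div_eq_inv_mul]
        rw [lintegral_const_mul' _ _ (ENNReal.inv_ne_top.2 h0)]
    _ ≤ (ν (Metric.ball x r))⁻¹ * ((ν (Metric.ball x r))⁻¹ * (ENNReal.ofReal (2 * r) *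
          (ENNReal.ofReal (4 * 2 ^ (θ - 1)) * ν (Metric.ball x r) *
            ∫⁻ z in Metric.ball x r, g z ∂ν))) := by gcongr
    _ = ((ν (Metric.ball x r))⁻¹ * ν (Metric.ball x r)) *
          (ENNReal.ofReal (2 * (4 * 2 ^ (θ - 1)) * r) *
            ((ν (Metric.ball x r))⁻¹ * ∫⁻ z in Metric.ball x r, g z ∂ν)) := by
        rw [hC]; ring
    _ = _ := by
        rw [ENNReal.inv_mul_cancel h0 h1, one_mul, setLAverage_eq, ENNReal.div_eq_inv_mul]

/-! ### Arc length of the circle and codimension regularity -/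

theorem norm_sq_plane (v : EuclideanSpace ℝ (Fin 2)) : ‖v‖ ^ 2 = v 0 ^ 2 + v 1 ^ 2 := by
  rw [EuclideanSpace.real_norm_sq_eq, Fin.sum_univ_two]

theorem norm_eq_one_of_mem_frontier {z : EuclideanSpace ℝ (Fin 2)}
    (hz : z ∈ frontier unitDisk) : ‖z‖ = 1 := by
  rwa [frontier_unitDisk, mem_sphere_zero_iff_norm] at hz

theorem circleLength_ball (z : frontier unitDisk) (r : ℝ) :
    circleLength (Metric.ball z r) =
      Measure.hausdorffMeasure 1 (Metric.sphere 0 1 ∩ Metric.ball (z : EuclideanSpace ℝ (Fin 2)) r) := by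
  have h := (isometry_subtype_coe : Isometry (Subtype.val : frontier unitDisk → _)).hausdorffMeasure_image
    (d := 1) (Or.inl zero_le_one) (Metric.ball z r)
  rw [circleLength, ← h]
  congr 1
  ext w
  simp only [← frontier_unitDisk, mem_image, mem_inter_iff, Metric.mem_ball, Subtype.exists,
    Subtype.dist_eq, exists_and_right, exists_eq_right]
  constructor
  · rintro ⟨a, b⟩; exact ⟨a, b⟩
  · rintro ⟨a, b⟩; exact ⟨a, b⟩

/-- The angular parametrization from `z` is 1-Lipschitz, and the chord of an angle `t ∈ [-π, π]`
has length at least `2 |t| / π`. -/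
theorem circleLength_ball_le (z : frontier unitDisk) {r : ℝ} (hr : 0 < r) :
    circleLength (Metric.ball z r) ≤ ENNReal.ofReal (Real.pi * r) := by
  have hz : ‖(z : EuclideanSpace ℝ (Fin 2))‖ = 1 :=
    norm_eq_one_of_mem_frontier z.2
  have hab := norm_sq_plane z
  rw [hz] at hab
  set a := (z : EuclideanSpace ℝ (Fin 2)) 0
  set b := (z : EuclideanSpace ℝ (Fin 2)) 1
  set ψ : ℝ → EuclideanSpace ℝ (Fin 2) := fun t =>
    !₂[a * Real.cos t - b * Real.sin t, b * Real.cos t + a * Real.sin t] with hψ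
  have hψlip : LipschitzOnWith 1 ψ (Icc (-(Real.pi * r / 2)) (Real.pi * r / 2)) := by
    refine LipschitzWith.lipschitzOnWith (LipschitzWith.of_dist_le_mul fun s t => ?_)
    rw [NNReal.coe_one, one_mul, Real.dist_eq, dist_eq_norm]
    refine abs_le_of_sq_le_sq' ?_ (abs_nonneg _) |>.2
    rw [sq_abs, norm_sq_plane]
    have h1 := Real.one_sub_sq_div_two_le_cos (x := s - t)
    rw [Real.cos_sub] at h1
    have hs := Real.sin_sq_add_cos_sq s
    have ht := Real.sin_sq_add_cos_sq t
    simp only [hψ, PiLp.sub_apply, Matrix.cons_val_zero, Matrix.cons_val_one]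
    calc _ = (a ^ 2 + b ^ 2) * ((Real.cos s - Real.cos t) ^ 2 + (Real.sin s - Real.sin t) ^ 2) := by
          ring
      _ ≤ (s - t) ^ 2 := by rw [← hab]; nlinarith
  have hcover : Metric.sphere 0 1 ∩ Metric.ball (z : EuclideanSpace ℝ (Fin 2)) r ⊆
      ψ '' Icc (-(Real.pi * r / 2)) (Real.pi * r / 2) := by
    rintro w ⟨hw, hwz⟩
    have hw1 := norm_sq_plane w
    rw [mem_sphere_zero_iff_norm.1 hw] at hw1
    set ζ : ℂ := ⟨a * w 0 + b * w 1, a * w 1 - b * w 0⟩ with hζ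
    have hζn : ‖ζ‖ = 1 := by
      rw [← sq_eq_sq₀ (norm_nonneg _) zero_le_one, Complex.sq_norm, Complex.normSq_apply]
      simp only [hζ]
      calc _ = (a ^ 2 + b ^ 2) * (w 0 ^ 2 + w 1 ^ 2) := by ring
        _ = 1 ^ 2 := by rw [← hab, ← hw1]; norm_num
    have hζ0 : ζ ≠ 0 := norm_ne_zero_iff.1 (by rw [hζn]; exact one_ne_zero)
    have hcos : Real.cos ζ.arg = a * w 0 + b * w 1 := by rw [Complex.cos_arg hζ0, hζn, div_one]
    have hsin : Real.sin ζ.arg = a * w 1 - b * w 0 := by rw [Complex.sin_arg, hζn, div_one]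
    refine ⟨ζ.arg, ?_, ?_⟩
    · have h1 := Real.cos_le_one_sub_mul_cos_sq (Complex.abs_arg_le_pi ζ)
      have h2 := norm_sq_plane (w - z)
      have h3 := mem_ball_iff_norm.1 hwz
      have h4 : ‖w - z‖ ^ 2 < r ^ 2 := by gcongr
      simp only [PiLp.sub_apply] at h2
      rw [hcos] at h1
      have h5 : 4 / Real.pi ^ 2 * ζ.arg ^ 2 ≤ r ^ 2 := by
        have e : 4 / Real.pi ^ 2 * ζ.arg ^ 2 = 2 * (2 / Real.pi ^ 2 * ζ.arg ^ 2) := by ring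
        rw [e]
        change ‖w - z‖ ^ 2 = (w 0 - a) ^ 2 + (w 1 - b) ^ 2 at h2
        nlinarith
      have h6 : ζ.arg ^ 2 ≤ (Real.pi * r / 2) ^ 2 := by
        have hpi : (0 : ℝ) < Real.pi ^ 2 := by positivity
        calc ζ.arg ^ 2 = Real.pi ^ 2 / 4 * (4 / Real.pi ^ 2 * ζ.arg ^ 2) := by field_simp
          _ ≤ Real.pi ^ 2 / 4 * r ^ 2 := by gcongr
          _ = _ := by ring
      exact abs_le.1 (abs_le_of_sq_le_sq h6 (by positivity))
    · ext i
      fin_cases i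
      · simp only [hψ, hcos, hsin, Fin.zero_eta, Matrix.cons_val_zero]
        linear_combination (-(w 0)) * hab
      · simp only [hψ, hcos, hsin, Fin.mk_one, Matrix.cons_val_one,
          Matrix.cons_val_zero]
        linear_combination (-(w 1)) * hab
  rw [circleLength_ball]
  calc _ ≤ Measure.hausdorffMeasure 1 (ψ '' Icc (-(Real.pi * r / 2)) (Real.pi * r / 2)) :=
        measure_mono hcover
    _ ≤ ((1 : ℝ≥0) : ℝ≥0∞) ^ (1 : ℝ) *
          Measure.hausdorffMeasure 1 (Icc (-(Real.pi * r / 2)) (Real.pi * r / 2)) :=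
        hψlip.hausdorffMeasure_image_le zero_le_one
    _ = _ := by
        rw [hausdorffMeasure_real, Real.volume_Icc]
        simp only [ENNReal.coe_one, ENNReal.one_rpow, one_mul]
        congr 1; ring

/-- The orthogonal projection to the tangent line at `z` maps the arc about `z` onto a segment of
length `r`. -/
theorem le_circleLength_ball (z : frontier unitDisk) {r : ℝ} (hr1 : r ≤ 1) :
    ENNReal.ofReal r ≤ circleLength (Metric.ball z r) := by
  have hz : ‖(z : EuclideanSpace ℝ (Fin 2))‖ = 1 :=
    norm_eq_one_of_mem_frontier z.2
  have hab := norm_sq_plane z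
  rw [hz] at hab
  set a := (z : EuclideanSpace ℝ (Fin 2)) 0
  set b := (z : EuclideanSpace ℝ (Fin 2)) 1
  set p : EuclideanSpace ℝ (Fin 2) → ℝ := fun w => a * w 1 - b * w 0 with hp
  have hplip : LipschitzOnWith 1 p
      (Metric.sphere 0 1 ∩ Metric.ball (z : EuclideanSpace ℝ (Fin 2)) r) := by
    refine LipschitzWith.lipschitzOnWith (LipschitzWith.of_dist_le_mul fun s t => ?_)
    rw [NNReal.coe_one, one_mul, Real.dist_eq, dist_eq_norm]
    refine abs_le_of_sq_le_sq ?_ (norm_nonneg _)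
    rw [norm_sq_plane]
    simp only [hp, PiLp.sub_apply]
    have := sq_nonneg (a * (s 0 - t 0) + b * (s 1 - t 1))
    calc _ ≤ (a * s 1 - b * s 0 - (a * t 1 - b * t 0)) ^ 2 +
          (a * (s 0 - t 0) + b * (s 1 - t 1)) ^ 2 := by linarith
      _ = (a ^ 2 + b ^ 2) * ((s 0 - t 0) ^ 2 + (s 1 - t 1) ^ 2) := by ring
      _ = _ := by rw [← hab]; ring
  have hcover : Ioo (-(r / 2)) (r / 2) ⊆
      p '' (Metric.sphere 0 1 ∩ Metric.ball (z : EuclideanSpace ℝ (Fin 2)) r) := by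
    intro τ hτ
    have hτr : τ ^ 2 < (r / 2) ^ 2 := sq_lt_sq' hτ.1 hτ.2
    have hr : 0 < r := by linarith [hτ.1, hτ.2]
    have hτ1 : 0 ≤ 1 - τ ^ 2 := by nlinarith
    set σ := Real.sqrt (1 - τ ^ 2) with hσ
    have hσ2 : σ ^ 2 = 1 - τ ^ 2 := Real.sq_sqrt hτ1
    have hσ0 : 0 ≤ σ := Real.sqrt_nonneg _
    have hσ1 : σ ≤ 1 := Real.sqrt_le_one.2 (by nlinarith)
    refine ⟨!₂[a * σ - b * τ, b * σ + a * τ], ⟨?_, ?_⟩, ?_⟩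
    · rw [mem_sphere_zero_iff_norm, ← sq_eq_sq₀ (norm_nonneg _) zero_le_one, norm_sq_plane]
      simp only [Matrix.cons_val_zero, Matrix.cons_val_one]
      calc _ = (a ^ 2 + b ^ 2) * (σ ^ 2 + τ ^ 2) := by ring
        _ = _ := by rw [← hab, hσ2]; ring
    · rw [mem_ball_iff_norm, ← sq_lt_sq₀ (norm_nonneg _) hr.le, norm_sq_plane]
      simp only [PiLp.sub_apply, Matrix.cons_val_zero, Matrix.cons_val_one]
      calc _ = (a ^ 2 + b ^ 2) * ((σ - 1) ^ 2 + τ ^ 2) := by ring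
        _ < r ^ 2 := by rw [← hab]; nlinarith
    · simp only [hp, Matrix.cons_val_zero, Matrix.cons_val_one]
      linear_combination (-τ) * hab
  rw [circleLength_ball]
  calc ENNReal.ofReal r = volume (Ioo (-(r / 2)) (r / 2)) := by
        rw [Real.volume_Ioo]; congr 1; ring
    _ = Measure.hausdorffMeasure 1 (Ioo (-(r / 2)) (r / 2)) := by rw [hausdorffMeasure_real]
    _ ≤ _ := measure_mono hcover
    _ ≤ ((1 : ℝ≥0) : ℝ≥0∞) ^ (1 : ℝ) * _ := hplip.hausdorffMeasure_image_le zero_le_one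
    _ = _ := by simp

theorem isCodimRegular_circleLength {θ : ℝ} (hθ : 1 ≤ θ) :
    IsCodimRegular (diskMeasure θ) unitDisk circleLength θ := by
  have hnorm : ∀ z : frontier unitDisk, ‖(z : EuclideanSpace ℝ (Fin 2))‖ = 1 := fun z =>
    norm_eq_one_of_mem_frontier z.2
  refine ⟨Real.toNNReal (1 / (4 * Real.pi)), Real.toNNReal (16 ^ (θ + 1)),
    Real.toNNReal_pos.2 (by positivity), fun z r hr hr4 => ?_, fun z r hr hr4 => ?_⟩
  · have hr4' : r < 4 := by
      have := Metric.diam_mono (Metric.sphere_subset_closedBall (x := (0 : EuclideanSpace ℝ (Fin 2)))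
        (ε := 1)) Metric.isBounded_closedBall
      have h2 := Metric.diam_closedBall (x := (0 : EuclideanSpace ℝ (Fin 2))) zero_le_one
      rw [frontier_unitDisk] at hr4
      linarith
    have h1 := diskMeasure_ball_inter_le hθ (hnorm z).le hr.le
    rw [hnorm z, sub_self, zero_add] at h1
    calc _ ≤ ENNReal.ofReal (1 / (4 * Real.pi)) *
          (ENNReal.ofReal (r ^ (θ - 1) * (Real.pi * r ^ 2)) / ENNReal.ofReal (r ^ θ)) := by
          gcongr
          exact le_rfl
      _ = ENNReal.ofReal (r / 4) := by
          rw [← ENNReal.ofReal_div_of_pos (by positivity), ← ENNReal.ofReal_mul (by positivity)]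
          congr 1
          rw [Real.rpow_sub hr, Real.rpow_one]
          field_simp
      _ ≤ circleLength (Metric.ball z (r / 4)) := le_circleLength_ball z (by linarith)
      _ ≤ _ := measure_mono (Metric.ball_subset_ball (by linarith))
  · rw [diam_unitDisk] at hr4
    have h1 := le_diskMeasure_ball_inter hθ (hnorm z).le (r := r / 4) (by linarith) (by linarith)
    rw [hnorm z, sub_self, zero_add] at h1
    calc circleLength (Metric.ball z r) ≤ ENNReal.ofReal (Real.pi * r) := circleLength_ball_le z hr
      _ = ENNReal.ofReal (16 ^ (θ + 1)) *
          (ENNReal.ofReal ((r / 4 / 4) ^ (θ - 1) * (Real.pi * (r / 4 / 4) ^ 2)) /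
            ENNReal.ofReal (r ^ θ)) := by
          rw [← ENNReal.ofReal_div_of_pos (by positivity), ← ENNReal.ofReal_mul (by positivity)]
          congr 1
          have e : r / 4 / 4 = r / 16 := by ring
          rw [e, Real.rpow_sub (by positivity), Real.rpow_one, Real.div_rpow hr.le (by norm_num),
            Real.rpow_add (by norm_num), Real.rpow_one]
          field_simp
      _ ≤ _ := by
          gcongr
          · exact le_rfl
          · exact h1.trans (measure_mono (inter_subset_inter_left _
              (Metric.ball_subset_ball (by linarith))))

/-! ### An iterated logarithm without trace -/

/-- The function `log log (4 / dist(x, ∂Ω))` on the unit disk `Ω`, whose diameter is `2`. -/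
noncomputable def logLogDepth (x : unitDisk) : ℝ :=
  Real.log (Real.log (4 / (1 - ‖(x : EuclideanSpace ℝ (Fin 2))‖)))

/-- The modulus of the radial derivative of `logLogDepth`. -/
noncomputable def logLogDepthSlope (x : unitDisk) : ℝ :=
  ((1 - ‖(x : EuclideanSpace ℝ (Fin 2))‖) *
    Real.log (4 / (1 - ‖(x : EuclideanSpace ℝ (Fin 2))‖)))⁻¹

theorem one_lt_log_four_div {δ : ℝ} (h0 : 0 < δ) (h1 : δ ≤ 1) : 1 < Real.log (4 / δ) := by
  rw [Real.lt_log_iff_exp_lt (by positivity), lt_div_iff₀ h0]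
  have := Real.exp_one_lt_d9
  nlinarith [Real.exp_pos 1]

theorem depth_mem_Ioc (x : unitDisk) : 1 - ‖(x : EuclideanSpace ℝ (Fin 2))‖ ∈ Ioc (0 : ℝ) 1 :=
  ⟨by linarith [mem_unitDisk.1 x.2], by linarith [norm_nonneg (x : EuclideanSpace ℝ (Fin 2))]⟩

theorem one_lt_log_depth (x : unitDisk) :
    1 < Real.log (4 / (1 - ‖(x : EuclideanSpace ℝ (Fin 2))‖)) :=
  one_lt_log_four_div (depth_mem_Ioc x).1 (depth_mem_Ioc x).2

theorem logLogDepthSlope_nonneg (x : unitDisk) : 0 ≤ logLogDepthSlope x :=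
  inv_nonneg.2 (mul_nonneg (depth_mem_Ioc x).1.le (by linarith [one_lt_log_depth x]))

theorem hasDerivAt_log_four_div {ξ : ℝ} (h0 : 0 < ξ) :
    HasDerivAt (fun ξ => Real.log (4 / ξ)) (-ξ⁻¹) ξ := by
  have h : HasDerivAt (fun ξ => Real.log 4 - Real.log ξ) (-ξ⁻¹) ξ := by
    simpa using (Real.hasDerivAt_log h0.ne').const_sub (Real.log 4)
  refine h.congr_of_eventuallyEq ?_
  filter_upwards [lt_mem_nhds h0] with t ht
  rw [Real.log_div (by norm_num) ht.ne']

/-- The derivative of `log log (4 / ξ)` decreases in modulus, so on `[a, b]` it is largest at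
`a`. -/
theorem abs_log_log_sub_le {a b : ℝ} (ha : 0 < a) (hab : a ≤ b) (hb : b ≤ 1) :
    |Real.log (Real.log (4 / b)) - Real.log (Real.log (4 / a))| ≤
      (a * Real.log (4 / a))⁻¹ * (b - a) := by
  have hlog : ∀ ξ ∈ Icc a b, 1 < Real.log (4 / ξ) := fun ξ hξ =>
    one_lt_log_four_div (ha.trans_le hξ.1) (hξ.2.trans hb)
  have key := Convex.norm_image_sub_le_of_norm_hasDerivWithin_le (s := Icc a b)
    (f := fun ξ => Real.log (Real.log (4 / ξ))) (f' := fun ξ => -ξ⁻¹ / Real.log (4 / ξ))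
    (C := (a * Real.log (4 / a))⁻¹)
    (fun ξ hξ => ((hasDerivAt_log_four_div (ha.trans_le hξ.1)).log
      (by linarith [hlog ξ hξ])).hasDerivWithinAt)
    (fun ξ hξ => ?_) (convex_Icc a b) (left_mem_Icc.2 hab) (right_mem_Icc.2 hab)
  · rwa [Real.norm_eq_abs, Real.norm_eq_abs, abs_of_nonneg (sub_nonneg.2 hab)] at key
  · have hξ0 : 0 < ξ := ha.trans_le hξ.1
    have h1 := hlog ξ hξ
    have h2 := hlog a (left_mem_Icc.2 hab)
    rw [Real.norm_eq_abs, abs_div, abs_neg, abs_of_pos (inv_pos.2 hξ0), abs_of_pos (by linarith),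
      inv_div_left, ← mul_comm ξ]
    refine inv_anti₀ (by positivity) ?_
    have h3 : Real.log (4 / a) = Real.log (4 / ξ) + Real.log (ξ / a) := by
      rw [← Real.log_mul (by positivity) (by positivity)]
      congr 1
      field_simp
    have h4 : a * Real.log (ξ / a) ≤ ξ - a := by
      have := mul_le_mul_of_nonneg_left (Real.log_le_sub_one_of_pos (div_pos hξ0 ha)) ha.le
      rwa [mul_sub, mul_one, mul_div_cancel₀ _ ha.ne'] at this
    have h5 : ξ - a ≤ (ξ - a) * Real.log (4 / ξ) :=
      le_mul_of_one_le_right (sub_nonneg.2 hξ.1) h1.le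
    rw [h3]
    linarith

theorem abs_logLogDepth_sub_le (x y : unitDisk) :
    |logLogDepth x - logLogDepth y| ≤
      max (logLogDepthSlope x) (logLogDepthSlope y) * dist x y := by
  wlog h : ‖(y : EuclideanSpace ℝ (Fin 2))‖ ≤ ‖(x : EuclideanSpace ℝ (Fin 2))‖ generalizing x y
  · rw [abs_sub_comm, max_comm, dist_comm]
    exact this y x (le_of_not_ge h)
  have key := abs_log_log_sub_le (depth_mem_Ioc x).1 (sub_le_sub_left h 1) (depth_mem_Ioc y).2
  rw [abs_sub_comm]
  refine key.trans (mul_le_mul (le_max_left _ _) ?_ (by linarith)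
    ((logLogDepthSlope_nonneg x).trans (le_max_left _ _)))
  have := norm_sub_norm_le (x : EuclideanSpace ℝ (Fin 2)) y
  rw [Subtype.dist_eq, dist_eq_norm]
  linarith

theorem continuous_logLogDepthSlope : Continuous logLogDepthSlope := by
  have h1 : Continuous fun x : unitDisk => 1 - ‖(x : EuclideanSpace ℝ (Fin 2))‖ := by fun_prop
  have h2 : ∀ x : unitDisk, 1 - ‖(x : EuclideanSpace ℝ (Fin 2))‖ ≠ 0 :=
    fun x => (depth_mem_Ioc x).1.ne'
  refine (h1.mul ((continuous_const.div h1 h2).log fun x => div_ne_zero (by norm_num) (h2 x))).inv₀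
    fun x => mul_ne_zero (h2 x) (ne_of_gt ?_)
  exact one_pos.trans (one_lt_log_depth x)

theorem measurable_logLogDepth : Measurable logLogDepth := by
  unfold logLogDepth
  fun_prop

theorem isHajlaszGradient_logLogDepth (ν : Measure unitDisk) :
    IsHajlaszGradient ν logLogDepth fun x => ENNReal.ofReal (logLogDepthSlope x) := by
  refine ⟨continuous_logLogDepthSlope.measurable.ennreal_ofReal, ∅, measure_empty,
    fun x _ y _ => ?_⟩
  have hx := logLogDepthSlope_nonneg x
  have hy := logLogDepthSlope_nonneg y
  rw [← ENNReal.ofReal_add hx hy, ← ENNReal.ofReal_mul dist_nonneg, mul_comm]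
  refine ENNReal.ofReal_le_ofReal ((abs_logLogDepth_sub_le x y).trans ?_)
  exact mul_le_mul_of_nonneg_right (max_le (by linarith) (by linarith)) dist_nonneg

theorem isUpperGradient_logLogDepth :
    IsUpperGradient logLogDepth fun x => ENNReal.ofReal (logLogDepthSlope x) := by
  refine isUpperGradient_of_slope continuous_logLogDepthSlope.measurable.ennreal_ofReal
    (fun S hS => ?_) fun x c hc => ?_
  · obtain ⟨K, hK⟩ := hS.bddAbove_image continuous_logLogDepthSlope.continuousOn
    refine ⟨K.toNNReal, LipschitzOnWith.of_dist_le_mul fun x hx y hy => ?_⟩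
    rw [Real.dist_eq]
    refine (abs_logLogDepth_sub_le x y).trans (mul_le_mul_of_nonneg_right ?_ dist_nonneg)
    exact (max_le (hK (mem_image_of_mem _ hx)) (hK (mem_image_of_mem _ hy))).trans
      (Real.le_coe_toNNReal K)
  · have hc' : logLogDepthSlope x < c := by
      rwa [ENNReal.ofReal_lt_coe_iff (logLogDepthSlope_nonneg x)] at hc
    filter_upwards [continuous_logLogDepthSlope.continuousAt.eventually_lt_const hc'] with y hy
    exact (abs_logLogDepth_sub_le y x).trans
      (mul_le_mul_of_nonneg_right (max_le hy.le hc'.le) dist_nonneg)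

/-- In polar coordinates the integrand is dominated by the derivative of
`-2 (log (4 / (1 - y))) ^ (-1/2)`, which is bounded on `(0, 1)`. -/
theorem integrableOn_inv_depth_mul_log_rpow :
    IntegrableOn (fun x : EuclideanSpace ℝ (Fin 2) =>
      (1 - ‖x‖)⁻¹ * Real.log (4 / (1 - ‖x‖)) ^ (-(3 / 2) : ℝ)) unitDisk := by
  set f : ℝ → ℝ := fun y => (1 - y)⁻¹ * Real.log (4 / (1 - y)) ^ (-(3 / 2) : ℝ) with hf
  have hlog : ∀ y ∈ Ico (0 : ℝ) 1, 1 < Real.log (4 / (1 - y)) := fun y hy =>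
    one_lt_log_four_div (by linarith [hy.2]) (by linarith [hy.1])
  have hderiv : ∀ y ∈ Ico (0 : ℝ) 1, HasDerivAt
      (fun y : ℝ => -2 * Real.log (4 / (1 - y)) ^ (-(1 / 2) : ℝ)) (f y) y := by
    intro y hy
    have h0 : 0 < 1 - y := by linarith [hy.2]
    have h1 : HasDerivAt (fun y : ℝ => Real.log (4 / (1 - y))) ((1 - y)⁻¹) y := by
      have := (hasDerivAt_log_four_div h0).comp y ((hasDerivAt_id y).const_sub 1)
      simpa [Function.comp_def] using this
    have h2 := (h1.rpow_const (p := (-(1 / 2) : ℝ))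
      (Or.inl (by linarith [hlog y hy]))).const_mul (-2)
    refine h2.congr_deriv ?_
    simp only [hf]
    norm_num
    ring
  have hf0 : ∀ y ∈ Ioo (0 : ℝ) 1, 0 ≤ f y := fun y hy =>
    mul_nonneg (inv_nonneg.2 (by linarith [hy.2]))
      (Real.rpow_nonneg (by linarith [hlog y ⟨hy.1.le, hy.2⟩]) _)
  have hcont : ContinuousOn (fun y : ℝ => -2 * Real.log (4 / (1 - y)) ^ (-(1 / 2) : ℝ))
      (Icc 0 1) := by
    intro y hy
    rcases hy.2.lt_or_eq with h | rfl
    · exact (hderiv y ⟨hy.1, h⟩).continuousAt.continuousWithinAt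
    · -- at `1` the value is `0`, by the conventions for `4 / 0`, `log 0` and `0 ^ (-1/2)`
      rw [← Ico_insert_right (zero_le_one' ℝ), continuousWithinAt_insert_self]
      have e : -2 * Real.log (4 / (1 - 1)) ^ (-(1 / 2) : ℝ) = 0 := by
        rw [sub_self, div_zero, Real.log_zero, Real.zero_rpow (by norm_num), mul_zero]
      rw [ContinuousWithinAt, e]
      have h1 : Tendsto (fun y : ℝ => 1 - y) (𝓝[Ico 0 1] 1) (𝓝[>] 0) := by
        refine tendsto_nhdsWithin_iff.2 ⟨?_, ?_⟩
        · have : ContinuousAt (fun y : ℝ => 1 - y) 1 := by fun_prop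
          have h := this.tendsto
          simp only [sub_self] at h
          exact h.mono_left nhdsWithin_le_nhds
        · filter_upwards [self_mem_nhdsWithin] with y hy
          exact sub_pos.2 hy.2
      have h2 : Tendsto (fun y : ℝ => Real.log (4 / (1 - y))) (𝓝[Ico 0 1] 1) atTop := by
        refine Real.tendsto_log_atTop.comp ?_
        simp_rw [div_eq_mul_inv]
        exact (tendsto_inv_nhdsGT_zero.comp h1).const_mul_atTop (by norm_num)
      have h3 := ((tendsto_rpow_neg_atTop (by norm_num : (0 : ℝ) < 1 / 2)).comp h2).const_mul (-2)
      simpa [Function.comp_def] using h3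
  have hint : IntegrableOn f (Ioc 0 1) :=
    intervalIntegral.integrableOn_deriv_of_nonneg hcont
      (fun y hy => hderiv y ⟨hy.1.le, hy.2⟩) hf0
  refine (integrableOn_fun_norm_addHaar (μ := volume) (f := f)).2 ?_
  rw [finrank_euclideanSpace_fin]
  have hm : Measurable fun y : ℝ => y ^ (2 - 1) • f y := by simp only [hf]; fun_prop
  refine (hint.mono_set Ioo_subset_Ioc_self).mono' hm.aestronglyMeasurable ?_
  refine (ae_restrict_mem measurableSet_Ioo).mono fun y hy => ?_
  have := hf0 y hy
  rw [pow_one, smul_eq_mul, Real.norm_eq_abs, abs_of_nonneg (mul_nonneg hy.1.le this)]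
  exact mul_le_of_le_one_left this hy.2.le

theorem lintegral_logMeasureOn_unitDisk (θ a : ℝ) (f : EuclideanSpace ℝ (Fin 2) → ℝ≥0∞) :
    ∫⁻ x : unitDisk, f x ∂(logMeasureOn (diskMeasure θ) unitDisk a) =
      ∫⁻ x in unitDisk, ENNReal.ofReal ((1 - ‖x‖) ^ (θ - 1)) *
        (ENNReal.ofReal (Real.log (4 / (1 - ‖x‖)) ^ a) * f x) := by
  rw [logMeasureOn, lintegral_withDensity_eq_lintegral_mul_non_measurable _
    (measurable_logWeight a).ennreal_ofReal (Eventually.of_forall fun _ => ENNReal.ofReal_lt_top),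
    ← lintegral_measureOn_unitDisk]
  refine lintegral_congr fun x => ?_
  simp only [Pi.mul_apply]
  rw [logWeight_unitDisk a (mem_unitDisk.1 x.2).le]

/-- With the weight `L^a`, the integrand is `L^(a - θ) / dist(x, ∂Ω)`. -/
theorem lintegral_logLogDepthSlope_rpow_lt_top {θ a : ℝ} (ha : a ≤ θ - 3 / 2) :
    ∫⁻ x, ENNReal.ofReal (logLogDepthSlope x) ^ θ
      ∂(logMeasureOn (diskMeasure θ) unitDisk a) < ∞ := by
  have h1 := lintegral_logMeasureOn_unitDisk θ a fun x =>
    ENNReal.ofReal (((1 - ‖x‖) * Real.log (4 / (1 - ‖x‖)))⁻¹) ^ θ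
  refine lt_of_eq_of_lt h1 (lt_of_le_of_lt ?_ integrableOn_inv_depth_mul_log_rpow.lintegral_lt_top)
  refine setLIntegral_mono' isOpen_unitDisk.measurableSet fun x hx => ?_
  obtain ⟨hδ0, -⟩ := depth_mem_Ioc ⟨x, hx⟩
  have hL := one_lt_log_depth ⟨x, hx⟩
  simp only at hδ0 hL
  set δ := 1 - ‖x‖
  set L := Real.log (4 / δ)
  have hL0 : 0 < L := by linarith
  rw [ENNReal.ofReal_rpow_of_pos (by positivity), ← ENNReal.ofReal_mul (by positivity),
    ← ENNReal.ofReal_mul (by positivity)]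
  refine ENNReal.ofReal_le_ofReal ?_
  have e : δ ^ (θ - 1) * (L ^ a * ((δ * L)⁻¹) ^ θ) = δ⁻¹ * L ^ (a - θ) := by
    rw [Real.inv_rpow (by positivity), Real.mul_rpow hδ0.le hL0.le, Real.rpow_sub hδ0,
      Real.rpow_sub hL0, Real.rpow_one]
    have := Real.rpow_pos_of_pos hδ0 θ
    have := Real.rpow_pos_of_pos hL0 θ
    field_simp
  rw [e]
  gcongr
  · exact hL.le
  · linarith

/-- The logarithms are absorbed by the factor `dist(x, ∂Ω)^(θ - 1)` in the measure. -/
theorem lintegral_logLogDepth_rpow_lt_top {θ a : ℝ} (hθ : 1 < θ) (ha : 0 ≤ a) :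
    ∫⁻ x, ‖logLogDepth x‖ₑ ^ θ ∂(logMeasureOn (diskMeasure θ) unitDisk a) < ∞ := by
  have h1 := lintegral_logMeasureOn_unitDisk θ a fun x =>
    ‖Real.log (Real.log (4 / (1 - ‖x‖)))‖ₑ ^ θ
  have hη : 0 < (θ - 1) / (θ + a) := div_pos (by linarith) (by linarith)
  set η := (θ - 1) / (θ + a) with hηdef
  refine lt_of_eq_of_lt h1 (lt_of_le_of_lt (setLIntegral_mono'
    (g := fun _ => ENNReal.ofReal (4 ^ (θ - 1) / η ^ (θ + a)))
    isOpen_unitDisk.measurableSet fun x hx => ?_) ?_)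
  · obtain ⟨hδ0, -⟩ := depth_mem_Ioc ⟨x, hx⟩
    have hL := one_lt_log_depth ⟨x, hx⟩
    set δ := 1 - ‖x‖
    change 0 < δ at hδ0
    change 1 < Real.log (4 / δ) at hL
    have hLη : Real.log (4 / δ) ≤ (4 / δ) ^ η / η := Real.log_le_rpow_div (by positivity) hη
    set L := Real.log (4 / δ)
    have hL0 : 0 < L := by linarith
    have hlogL : 0 ≤ Real.log L := Real.log_nonneg hL.le
    have hlogL' : Real.log L ≤ L := by linarith [Real.log_le_sub_one_of_pos hL0]
    rw [Real.enorm_eq_ofReal_abs, abs_of_nonneg hlogL,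
      ENNReal.ofReal_rpow_of_nonneg hlogL (by linarith), ← ENNReal.ofReal_mul (by positivity),
      ← ENNReal.ofReal_mul (by positivity)]
    refine ENNReal.ofReal_le_ofReal ?_
    calc δ ^ (θ - 1) * (L ^ a * Real.log L ^ θ) ≤ δ ^ (θ - 1) * (L ^ a * L ^ θ) := by gcongr
      _ = δ ^ (θ - 1) * L ^ (θ + a) := by rw [← Real.rpow_add hL0, add_comm]
      _ ≤ δ ^ (θ - 1) * ((4 / δ) ^ η / η) ^ (θ + a) := by gcongr
      _ = 4 ^ (θ - 1) / η ^ (θ + a) := by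
          rw [Real.div_rpow (by positivity) hη.le, ← Real.rpow_mul (by positivity), hηdef,
            div_mul_cancel₀ _ (by linarith : θ + a ≠ 0), Real.div_rpow (by norm_num) hδ0.le]
          have := Real.rpow_pos_of_pos hδ0 (θ - 1)
          field_simp
  · rw [setLIntegral_const]
    exact ENNReal.mul_lt_top ENNReal.ofReal_lt_top measure_ball_lt_top

theorem eventually_le_logLogDepth (M : ℝ) {z : EuclideanSpace ℝ (Fin 2)}
    (hz : z ∈ frontier unitDisk) :
    ∀ᶠ r : ℝ in 𝓝[>] 0, ∀ x ∈ ballIn unitDisk z r, M ≤ logLogDepth x := by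
  have hT : Tendsto (fun r : ℝ => Real.log (Real.log (4 / r))) (𝓝[>] 0) atTop := by
    have h : Tendsto (fun r : ℝ => 4 * r⁻¹) (𝓝[>] 0) atTop :=
      tendsto_inv_nhdsGT_zero.const_mul_atTop (by norm_num)
    exact Real.tendsto_log_atTop.comp (Real.tendsto_log_atTop.comp h)
  filter_upwards [hT.eventually_ge_atTop M, self_mem_nhdsWithin,
    mem_nhdsWithin_of_mem_nhds (gt_mem_nhds (zero_lt_one' ℝ))] with r hr hr0 hr1 x hx
  refine hr.trans ?_
  have hx1 := depth_mem_Ioc x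
  have hr0' : 0 < r := hr0
  have hxr : 1 - ‖(x : EuclideanSpace ℝ (Fin 2))‖ ≤ r := by
    have h1 := mem_ball_iff_norm'.1 hx
    have h2 := norm_sub_norm_le z x
    rw [norm_eq_one_of_mem_frontier hz] at h2
    linarith
  have h4 := one_lt_log_four_div hr0' hr1.le
  exact Real.log_le_log (by linarith) (Real.log_le_log (by positivity)
    (div_le_div_of_nonneg_left (by norm_num) hx1.1 hxr))

theorem measureOn_ballIn_unitDisk_ne_zero {θ : ℝ} (hθ : 1 ≤ θ) {z : EuclideanSpace ℝ (Fin 2)}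
    (hz : z ∈ frontier unitDisk) {r : ℝ} (hr : 0 < r) :
    measureOn (diskMeasure θ) unitDisk (ballIn unitDisk z r) ≠ 0 ∧
      measureOn (diskMeasure θ) unitDisk (ballIn unitDisk z r) ≠ ∞ := by
  obtain ⟨_, hc⟩ := isDoublingOn_diskMeasure hθ
  obtain ⟨h1, -, -⟩ := hc z (frontier_subset_closure hz) (r / 2) (by linarith)
  obtain ⟨-, -, h2⟩ := hc z (frontier_subset_closure hz) r hr
  rw [mul_div_cancel₀ r two_ne_zero] at h1
  rw [measureOn_ballIn isOpen_unitDisk]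
  exact ⟨h1.ne', h2.ne⟩

theorem tendsto_setAverage_logLogDepth {θ : ℝ} (hθ : 1 ≤ θ) {z : EuclideanSpace ℝ (Fin 2)}
    (hz : z ∈ frontier unitDisk)
    (hint : Integrable logLogDepth (measureOn (diskMeasure θ) unitDisk)) :
    Tendsto (fun r : ℝ => ⨍ x in ballIn unitDisk z r, logLogDepth x
      ∂(measureOn (diskMeasure θ) unitDisk)) (𝓝[>] 0) atTop := by
  refine tendsto_atTop.2 fun M => ?_
  filter_upwards [eventually_le_logLogDepth M hz, self_mem_nhdsWithin] with r hr hr0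
  obtain ⟨h0, h1⟩ := measureOn_ballIn_unitDisk_ne_zero hθ hz hr0
  rw [setAverage_eq, smul_eq_mul, inv_mul_eq_div, le_div_iff₀ (by rw [measureReal_def]; exact ENNReal.toReal_pos h0 h1)]
  exact setIntegral_ge_of_const_le_real (measurableSet_ballIn _ _) h1 hr hint.integrableOn

theorem not_hasTraceAt_logLogDepth {θ : ℝ} (hθ : 1 ≤ θ) {z : EuclideanSpace ℝ (Fin 2)}
    (hz : z ∈ frontier unitDisk) (c : ℝ) :
    ¬ HasTraceAt (diskMeasure θ) unitDisk logLogDepth z c := by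
  intro h
  have h1 := (h.eventually (gt_mem_nhds (zero_lt_one' ℝ≥0∞))).and
    ((eventually_le_logLogDepth (c + 1) hz).and self_mem_nhdsWithin)
  obtain ⟨r, hr, hr1, hr0⟩ := h1.exists
  obtain ⟨h0, ht⟩ := measureOn_ballIn_unitDisk_ne_zero hθ hz hr0
  refine hr.not_ge ?_
  rw [← setLAverage_const h0 ht 1]
  refine laverage_mono_ae ((ae_restrict_mem (measurableSet_ballIn _ _)).mono fun x hx => ?_)
  have := hr1 x hx
  dsimp only
  rw [Real.enorm_eq_ofReal_abs, ENNReal.one_le_ofReal, abs_of_nonneg (by linarith)]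
  linarith

/-- The function is `log log (4 / dist(x, ∂Ω))`. -/
theorem exists_function_without_trace {ε : ℝ} (hε : 0 < ε) (hε1 : ε < 1) {θ : ℝ} (hθ : 1 ≤ θ)
    (hθε : 2 / ε ≤ θ) :
    ∃ (u : unitDisk → ℝ) (g : unitDisk → ℝ≥0∞),
      MemLp u (ENNReal.ofReal θ) (measureOn (diskMeasure θ) unitDisk) ∧
      IsHajlaszGradient (measureOn (diskMeasure θ) unitDisk) u g ∧
      (∫⁻ x, g x ^ θ ∂(measureOn (diskMeasure θ) unitDisk)) < ∞ ∧
      (∫⁻ x, g x ^ θ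
        ∂(logMeasureOn (diskMeasure θ) unitDisk ((1 - ε) * (θ + θ * ε / 4)))) < ∞ ∧
      u ∈ newtonian θ hθ (logMeasureOn (diskMeasure θ) unitDisk
        ((1 - ε) * (θ + θ * ε / 4))) ∧
      ∀ z ∈ frontier unitDisk,
        Tendsto (fun r : ℝ => ⨍ x in ((↑) : unitDisk → EuclideanSpace ℝ (Fin 2)) ⁻¹'
            Metric.ball z r, u x ∂(measureOn (diskMeasure θ) unitDisk))
          (𝓝[>] 0) atTop ∧
        ∀ c : ℝ, ¬ HasTraceAt (diskMeasure θ) unitDisk u z c := by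
  set a := (1 - ε) * (θ + θ * ε / 4) with ha
  have hθε2 : 2 ≤ θ * ε := (div_le_iff₀ hε).1 hθε
  have hθ1 : 1 < θ := by nlinarith
  have ha0 : 0 ≤ a := mul_nonneg (by linarith) (by positivity)
  -- `θ - a = θ ε (3 + ε) / 4`
  have haθ : a ≤ θ - 3 / 2 := by rw [ha]; nlinarith
  have hne : (frontier unitDisk).Nonempty := by
    rw [frontier_unitDisk]
    exact ⟨EuclideanSpace.single 0 1, by simp⟩
  have hle : ∀ f : unitDisk → ℝ≥0∞,
      ∫⁻ x, f x ∂(logMeasureOn (diskMeasure θ) unitDisk a) < ∞ →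
      ∫⁻ x, f x ∂(measureOn (diskMeasure θ) unitDisk) < ∞ := fun f hf =>
    (lintegral_measureOn_le_logMeasureOn isMetricDomain_unitDisk isBounded_unitDisk hne ha0
      f).trans_lt (ENNReal.mul_lt_top
        (ENNReal.inv_lt_top.2 (pos_iff_ne_zero.2 (ofReal_log_two_rpow_ne_zero a))) hf)
  have hu := lintegral_logLogDepth_rpow_lt_top hθ1 ha0
  have hg := lintegral_logLogDepthSlope_rpow_lt_top haθ
  have hLp : MemLp logLogDepth (ENNReal.ofReal θ) (measureOn (diskMeasure θ) unitDisk) := by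
    refine ⟨measurable_logLogDepth.aestronglyMeasurable, ?_⟩
    rw [eLpNorm_lt_top_iff_lintegral_rpow_enorm_lt_top
      (ENNReal.ofReal_pos.2 (by linarith)).ne' ENNReal.ofReal_ne_top,
      ENNReal.toReal_ofReal (by linarith)]
    exact hle _ hu
  have : IsFiniteMeasure (measureOn (diskMeasure θ) unitDisk) :=
    (isDoublingOn_diskMeasure hθ).isFiniteMeasure isMetricDomain_unitDisk isBounded_unitDisk
  have hint : Integrable logLogDepth (measureOn (diskMeasure θ) unitDisk) :=
    hLp.integrable (by rw [ENNReal.one_le_ofReal]; exact hθ)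
  refine ⟨logLogDepth, fun x => ENNReal.ofReal (logLogDepthSlope x), hLp,
    isHajlaszGradient_logLogDepth _, hle _ hg, hg,
    ⟨measurable_logLogDepth.aestronglyMeasurable,
      (newtonNorm_lt_top_iff hθ _ _).2 ⟨hu, _, isUpperGradient_logLogDepth, hg⟩⟩,
    fun z hz => ⟨tendsto_setAverage_logLogDepth hθ hz hint, not_hasTraceAt_logLogDepth hθ hz⟩⟩

/-! ### The trace theorem and its sharpness -/

theorem theorem1p3 :
    -- the trace operator and the extension operator
    (∀ (X : Type*) [MetricSpace X] [MeasurableSpace X] [BorelSpace X]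
        (μ : Measure X) [SigmaFinite μ] (_ : BallsPosFinite μ)
        (Ω : Set X) (_ : IsMetricDomain Ω) (_ : Bornology.IsBounded Ω)
        (θ : ℝ) (hθ : 1 ≤ θ) (_ : IsDoublingOn μ Ω) (_ : AdmitsPoincare θ (measureOn μ Ω))
        (H : Measure (frontier Ω)) [SigmaFinite H] (_ : IsCodimRegular μ Ω H θ),
      (∀ ε : ℝ, 0 < ε →
        ∃ (T : newtonian θ hθ (logMeasureOn μ Ω (θ + ε)) →ₗ[ℝ] Lp ℝ (ENNReal.ofReal θ) H)
          (C : ℝ≥0), ∀ u : newtonian θ hθ (logMeasureOn μ Ω (θ + ε)),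
            eLpNorm (T u) (ENNReal.ofReal θ) H ≤
              C * newtonNorm θ (logMeasureOn μ Ω (θ + ε)) (u : Ω → ℝ) ∧
            HasTrace μ Ω H (u : Ω → ℝ) (T u)) ∧
      (∃ (E : Lp ℝ (ENNReal.ofReal θ) H → newtonian θ hθ (measureOn μ Ω)) (C : ℝ≥0),
        ∀ f : Lp ℝ (ENNReal.ofReal θ) H,
          newtonNorm θ (measureOn μ Ω) (E f : Ω → ℝ) ≤ C * eLpNorm f (ENNReal.ofReal θ) H ∧
          HasTrace μ Ω H (E f : Ω → ℝ) f)) ∧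
    -- essential sharpness of the weight
    (∀ ε : ℝ, 0 < ε → ε < 1 → ∀ (θ : ℝ) (hθ : 1 ≤ θ), 2 / ε ≤ θ →
      BallsPosFinite (diskMeasure θ) ∧ IsUniformDomain unitDisk ∧
      IsDoublingOn (diskMeasure θ) unitDisk ∧
      AdmitsPoincare 1 (measureOn (diskMeasure θ) unitDisk) ∧
      IsCodimRegular (diskMeasure θ) unitDisk circleLength θ ∧
      ∃ (u : unitDisk → ℝ) (g : unitDisk → ℝ≥0∞),
        MemLp u (ENNReal.ofReal θ) (measureOn (diskMeasure θ) unitDisk) ∧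
        IsHajlaszGradient (measureOn (diskMeasure θ) unitDisk) u g ∧
        (∫⁻ x, g x ^ θ ∂(measureOn (diskMeasure θ) unitDisk)) < ∞ ∧
        (∫⁻ x, g x ^ θ
          ∂(logMeasureOn (diskMeasure θ) unitDisk ((1 - ε) * (θ + θ * ε / 4)))) < ∞ ∧
        u ∈ newtonian θ hθ (logMeasureOn (diskMeasure θ) unitDisk
          ((1 - ε) * (θ + θ * ε / 4))) ∧
        ∀ z ∈ frontier unitDisk,
          Tendsto (fun r : ℝ => ⨍ x in ((↑) : unitDisk → EuclideanSpace ℝ (Fin 2)) ⁻¹'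
              Metric.ball z r, u x ∂(measureOn (diskMeasure θ) unitDisk))
            (𝓝[>] 0) atTop ∧
          ∀ c : ℝ, ¬ HasTraceAt (diskMeasure θ) unitDisk u z c) := by
  refine ⟨fun X _ _ _ μ _ hBalls Ω hΩ hb θ hθ hμ hP H _ hreg =>
    ⟨fun ε hε => exists_traceOperator hΩ hb hθ hμ hP hreg hε,
      exists_extensionOperator hΩ hb hθ hμ hreg⟩,
    fun ε hε hε1 θ hθ hθε => ⟨ballsPosFinite_diskMeasure hθ, isUniformDomain_unitDisk,
      isDoublingOn_diskMeasure hθ, admitsPoincare_measureOn_unitDisk hθ,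
      isCodimRegular_circleLength hθ, exists_function_without_trace hε hε1 hθ hθε⟩⟩
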